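/- Let $N\ge 1$, let $K$ be an algebraically closed field containing $\mathbb C$ (for example $K=\mathbb C$), and let $\theta\in K$ be either a positive real number or transcendental over $\mathbb C$ (a formal variable). On $K[x_1,\dots,x_N]$ consider, with $(i,j)$ the operator exchanging $x_i$ and $x_j$, $$D_i=\frac{\partial}{\partial x_i}+\theta\sum_{j\ne i}\frac{1-(i,j)}{x_i-x_j},\qquad P_m=\sum_{i=1}^N (x_iD_i)^m\quad(m\ge 1).$$ For $\gamma\in\mathbb Z_{\ge0}^N$ let $\gamma^+$ be its nonincreasing rearrangement and $x^\gamma=x_1^{\gamma_1}\cdots x_N^{\gamma_N}$. For $\lambda=(\lambda_1\ge\dots\ge\lambda_N\ge0)$ let $V_\lambda$ be the span of the $x^\gamma$ with $\gamma^+=\lambda$; $S_N$ acts on it by permuting the variables. For an irreducible representation $\tau$ of $S_N$ over $K$ (up to isomorphism) with character $\chi^\tau$, let $V_{\lambda;\tau}$ be the $\tau$-isotypical component of $V_\lambda$. Let $\preceq$ be the dominance order on partitions of the same size. Call a family $F_{\lambda,\tau,i}$, indexed by all such $\lambda$ and $\tau$ and by $1\le i\le\dim V_{\lambda;\tau}$,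 an eigensystem if each $F_{\lambda,\tau,i}$ is nonzero and an eigenfunction of all $P_m$, $m\ge1$, is homogeneous of degree $|\lambda|$, contains only monomials $x^\gamma$ with $\gamma^+\preceq\lambda$, and has its part spanned by the monomials of $V_\lambda$ in $V_{\lambda;\tau}$, and if the $F_{\lambda,\tau,i}$ together span $K[x_1,\dots,x_N]$. Let $\mathrm{eig}_m(\lambda,\tau,i)$ be the eigenvalue of $P_m$ on $F_{\lambda,\tau,i}$. **Theorem.** Eigensystems exist. For each eigensystem, the following holds for all positive integers $n_1,\dots,n_p$ with $n_1+\dots+n_p=N$, all integers $d_1>\dots>d_p\ge0$, all $\tau$ and all $m\ge1$. Let $\lambda$ be the partition in which $d_a$ is repeated $n_a$ times, $1\le a\le p$. Then $$\sum_{i=1}^{\dim V_{\lambda;\tau}}\mathrm{eig}_m(\lambda,\tau,i)=\dim\tau\sum_{k=1}^{\min(m+1,p)}(-\theta)^{k-1}\sum_{\substack{A\subset\{1,\dots,p\}\\|A|=k}}h_{m+1-k}(\tilde\ell_a:a\in A)\;\chi^\tau[A;\mathbf n]\prod_{a\in A}n_a,$$ where $\tilde\ell_a=d_a+\theta(n_{a+1}+\dots+n_p)$,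 $h_q$ is the complete homogeneous symmetric polynomial of degree $q$, and, for $A=\{a_1<\dots<a_k\}$, $$\chi^\tau[A;\mathbf n]=\frac1{n_1!\cdots n_p!}\sum_{g\in S_{n_1}\times\dots\times S_{n_p}}\chi^\tau(g\,\mathfrak c),\qquad \mathfrak c=(n_1+\dots+n_{a_1},\;n_1+\dots+n_{a_2},\;\dots,\;n_1+\dots+n_{a_k}),$$ $S_{n_1}\times\dots\times S_{n_p}\subset S_N$ being the subgroup that preserves each of the $p$ consecutive blocks of $\{1,\dots,N\}$ of sizes $n_1,\dots,n_p$, and $\mathfrak c$ a $k$-cycle. -/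

import Mathlib

namespace HeckmanPolychronakos

noncomputable section

/-! ### The symmetric group acting on polynomials, Dunkl and Heckman-Polychronakos operators -/

/-- The action of `S_N` on `K[x_1, …, x_N]` by permuting the variables: `g` sends `x_i` to
`x_{g i}`, so that `g * h` first acts by `h` and then by `g`. -/
def permRep (K : Type*) [Field K] (N : ℕ) :
    Representation K (Equiv.Perm (Fin N)) (MvPolynomial (Fin N) K) where
  toFun g := (MvPolynomial.rename g).toLinearMap
  map_one' := by
    refine LinearMap.ext fun f => ?_
    simp
  map_mul' g h := by
    refine LinearMap.ext fun f => ?_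
    simp [MvPolynomial.rename_rename, Equiv.Perm.coe_mul]

/-- `f - (i,j) f` is divisible by `x_i - x_j`. -/
theorem X_sub_X_dvd {K : Type*} [Field K] {N : ℕ} (i j : Fin N) (f : MvPolynomial (Fin N) K) :
    (MvPolynomial.X i - MvPolynomial.X j : MvPolynomial (Fin N) K) ∣
      f - permRep K N (Equiv.swap i j) f := by
  rw [← Ideal.mem_span_singleton, ← Ideal.Quotient.mk_eq_mk_iff_sub_mem]
  have h : (Ideal.Quotient.mkₐ K (Ideal.span {(MvPolynomial.X i - MvPolynomial.X j :
      MvPolynomial (Fin N) K)})) = (Ideal.Quotient.mkₐ K (Ideal.span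
      {(MvPolynomial.X i - MvPolynomial.X j : MvPolynomial (Fin N) K)})).comp
      (MvPolynomial.rename (Equiv.swap i j)) := by
    apply MvPolynomial.algHom_ext
    intro k
    have e : Ideal.Quotient.mk (Ideal.span {(MvPolynomial.X i - MvPolynomial.X j :
        MvPolynomial (Fin N) K)}) (MvPolynomial.X i) = Ideal.Quotient.mk _ (MvPolynomial.X j) := by
      rw [Ideal.Quotient.mk_eq_mk_iff_sub_mem]
      exact Ideal.mem_span_singleton_self _
    simp only [Ideal.Quotient.mkₐ_eq_mk, AlgHom.coe_comp, Function.comp_apply,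
      MvPolynomial.rename_X]
    by_cases hi : k = i
    · subst hi
      rw [Equiv.swap_apply_left, e]
    · by_cases hj : k = j
      · subst hj
        rw [Equiv.swap_apply_right, e]
      · rw [Equiv.swap_apply_of_ne_of_ne hi hj]
  exact DFunLike.congr_fun h f

theorem X_sub_X_ne_zero {K : Type*} [Field K] {N : ℕ} {i j : Fin N} (h : i ≠ j) :
    (MvPolynomial.X i - MvPolynomial.X j : MvPolynomial (Fin N) K) ≠ 0 := by
  intro e
  exact h (MvPolynomial.X_injective (sub_eq_zero.mp e))

/-- The operator `f ↦ (f - (i,j) f) / (x_i - x_j)`: the unique polynomial whose product with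
`x_i - x_j` is `f - (i,j) f`. -/
def divDiff {K : Type*} [Field K] {N : ℕ} (i j : Fin N) (h : i ≠ j) :
    MvPolynomial (Fin N) K →ₗ[K] MvPolynomial (Fin N) K where
  toFun f := (X_sub_X_dvd i j f).choose
  map_add' f g := by
    apply mul_left_cancel₀ (X_sub_X_ne_zero (K := K) h)
    rw [mul_add, ← (X_sub_X_dvd i j (f + g)).choose_spec, ← (X_sub_X_dvd i j f).choose_spec,
      ← (X_sub_X_dvd i j g).choose_spec, map_add]
    ring
  map_smul' c f := by
    apply mul_left_cancel₀ (X_sub_X_ne_zero (K := K) h)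
    rw [RingHom.id_apply, mul_smul_comm, ← (X_sub_X_dvd i j (c • f)).choose_spec,
      ← (X_sub_X_dvd i j f).choose_spec, map_smul, smul_sub]

theorem X_sub_X_mul_divDiff {K : Type*} [Field K] {N : ℕ} (i j : Fin N) (h : i ≠ j)
    (f : MvPolynomial (Fin N) K) :
    (MvPolynomial.X i - MvPolynomial.X j) * divDiff i j h f =
      f - permRep K N (Equiv.swap i j) f :=
  (X_sub_X_dvd i j f).choose_spec.symm

/-- The Dunkl operator `D_i = ∂/∂x_i + θ ∑_{j ≠ i} (1 - (i,j)) / (x_i - x_j)`. -/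
def dunkl {K : Type*} [Field K] {N : ℕ} (θ : K) (i : Fin N) :
    Module.End K (MvPolynomial (Fin N) K) :=
  (MvPolynomial.pderiv i).toLinearMap + θ • ∑ j : {j : Fin N // j ≠ i}, divDiff i j j.2.symm

/-- The Heckman-Polychronakos operator `P_m = ∑_i (x_i D_i)^m`. -/
def hpOp {K : Type*} [Field K] {N : ℕ} (θ : K) (m : ℕ) :
    Module.End K (MvPolynomial (Fin N) K) :=
  ∑ i : Fin N, (LinearMap.mulLeft K (MvPolynomial.X i) * dunkl θ i) ^ m

/-! ### Partitions with at most `N` parts and the spaces `V_λ` -/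

/-- Partitions `λ_1 ≥ … ≥ λ_N ≥ 0`. -/
abbrev Part (N : ℕ) : Type := {l : Fin N → ℕ // Antitone l}

/-- `γ⁺`, the nonincreasing rearrangement of `γ`. -/
def plus {N : ℕ} (γ : Fin N → ℕ) : Part N :=
  ⟨fun i => γ (Tuple.sort γ i.rev), fun _ _ h => Tuple.monotone_sort γ (Fin.rev_le_rev.mpr h)⟩

/-- The dominance order `μ ⪯ λ` (equality allowed). -/
def Dominated {N : ℕ} (μ l : Part N) : Prop :=
  ∑ i, μ.1 i = ∑ i, l.1 i ∧
    ∀ k : Fin N, ∑ i ∈ Finset.Iic k, μ.1 i ≤ ∑ i ∈ Finset.Iic k, l.1 i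

/-- `V_λ`, the span of the monomials `x^γ` with `γ⁺ = λ`. -/
def V (K : Type*) [Field K] {N : ℕ} (l : Part N) : Submodule K (MvPolynomial (Fin N) K) :=
  Submodule.span K {f | ∃ γ : Fin N →₀ ℕ, plus γ = l ∧ f = MvPolynomial.monomial γ 1}

open Classical in
/-- The part of a polynomial spanned by the monomials of `V_λ`. -/
def leadingPart {K : Type*} [Field K] {N : ℕ} (l : Part N) (f : MvPolynomial (Fin N) K) :
    MvPolynomial (Fin N) K :=
  ∑ γ ∈ f.support.filter (fun γ : Fin N →₀ ℕ => plus γ = l), MvPolynomial.monomial γ (f.coeff γ)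

/-! ### Irreducible representations of `S_N` -/

/-- Isomorphism of irreducible representations of `S_N` on the spaces `K^d`. -/
def irrSetoid (K : Type*) [Field K] (N : ℕ) :
    Setoid (Σ d : ℕ, {ρ : Representation K (Equiv.Perm (Fin N)) (Fin d → K) //
      ρ.IsIrreducible}) where
  r a b := Nonempty (Representation.Equiv a.2.1 b.2.1)
  iseqv :=
    { refl := fun _ => ⟨Representation.Equiv.refl _⟩
      symm := fun ⟨e⟩ => ⟨e.symm⟩
      trans := fun ⟨e⟩ ⟨f⟩ => ⟨e.trans f⟩ }

/-- The set of isomorphism classes of irreducible representations of `S_N`; as the group is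
finite, each irreducible representation is isomorphic to one on some `K^d`. -/
def Irr (K : Type*) [Field K] (N : ℕ) : Type _ := Quotient (irrSetoid K N)

namespace Irr

variable {K : Type*} [Field K] {N : ℕ}

/-- `dim τ`. -/
def dim (τ : Irr K N) : ℕ := (Quotient.out τ).1

/-- A representative of the isomorphism class `τ`. -/
def rep (τ : Irr K N) : Representation K (Equiv.Perm (Fin N)) (Fin τ.dim → K) :=
  (Quotient.out τ).2.1

/-- The character `χ^τ`. -/
def chi (τ : Irr K N) (g : Equiv.Perm (Fin N)) : K := τ.rep.character g

end Irr

/-- `V_{λ;τ}`, the `τ`-isotypical component of `V_λ`: the sum of all subrepresentations of `V_λ`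
that are isomorphic to `τ`. -/
def isotypic {K : Type*} [Field K] {N : ℕ} (l : Part N) (τ : Irr K N) :
    Submodule K (MvPolynomial (Fin N) K) :=
  sSup {W | W ≤ V K l ∧ ∃ φ : Representation.IntertwiningMap τ.rep (permRep K N),
    Function.Injective φ ∧ LinearMap.range φ.toLinearMap = W}

/-! ### Joint eigenfunctions -/

/-- The family `F λ τ i`, `1 ≤ i ≤ dim V_{λ;τ}`, is a spanning family of joint eigenfunctions of
the operators `P_m`, `m ≥ 1`, with the leading terms in `V_{λ;τ}`, and `eig m λ τ i` are
the corresponding eigenvalues. -/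
structure IsEigenSystem {K : Type*} [Field K] {N : ℕ} (θ : K)
    (F : (l : Part N) → (τ : Irr K N) → Fin (Module.finrank K (isotypic l τ)) →
      MvPolynomial (Fin N) K)
    (eig : ℕ → (l : Part N) → (τ : Irr K N) → Fin (Module.finrank K (isotypic l τ)) → K) :
    Prop where
  ne_zero : ∀ l τ i, F l τ i ≠ 0
  eigen : ∀ m, 1 ≤ m → ∀ l τ i, hpOp θ m (F l τ i) = eig m l τ i • F l τ i
  homogeneous : ∀ l τ i, (F l τ i).IsHomogeneous (∑ j, l.1 j)
  dominated : ∀ l τ i, ∀ γ ∈ (F l τ i).support, Dominated (plus γ) l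
  leading : ∀ l τ i, leadingPart l (F l τ i) ∈ isotypic l τ
  span_eq_top : Submodule.span K {f | ∃ l τ i, f = F l τ i} = ⊤

/-! ### Partitions with prescribed multiplicities -/

theorem index_mono {N : ℕ} (n : Composition N) : Monotone n.index := by
  intro i j h
  by_contra hlt
  have h1 : ((n.index j : ℕ)).succ ≤ n.index i := Nat.succ_le_of_lt (not_le.mp hlt)
  have h2 := n.monotone_sizeUpTo h1
  have h3 := n.lt_sizeUpTo_index_succ j
  have h4 := n.sizeUpTo_index_le i
  have h5 : (i : ℕ) ≤ j := h
  exact absurd (h3.trans_le (h2.trans h4)) (not_lt.mpr h5)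

/-- The partition `(d_1^{n_1}, d_2^{n_2}, …, d_p^{n_p})`. -/
def blockPart {N : ℕ} (n : Composition N) (d : Fin n.length → ℕ) (hd : StrictAnti d) : Part N :=
  ⟨fun j => d (n.index j), fun _ _ h => hd.antitone (index_mono n h)⟩

/-- The shifted degrees `d_a + θ (n_{a+1} + … + n_p)`. -/
def shiftedDeg {K : Type*} [Field K] {N : ℕ} (θ : K) (n : Composition N)
    (d : Fin n.length → ℕ) (a : Fin n.length) : K :=
  d a + θ * ∑ b ∈ Finset.Ioi a, (n.blocksFun b : K)

/-- `h_q (ℓ̃_a : a ∈ A)`, the complete homogeneous symmetric polynomial of degree `q`. -/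
def hSub {K : Type*} [Field K] {N : ℕ} (θ : K) (n : Composition N)
    (d : Fin n.length → ℕ) (A : Finset (Fin n.length)) (q : ℕ) : K :=
  MvPolynomial.aeval (fun a : A => shiftedDeg θ n d a) (MvPolynomial.hsymm A K q)

/-- The last element of the `a`-th block of `{1, …, N}`. -/
def lastOfBlock {N : ℕ} (n : Composition N) (a : Fin n.length) : Fin N :=
  n.embedding a ⟨n.blocksFun a - 1, Nat.sub_lt (n.one_le_blocksFun a) one_pos⟩

/-- The cycle through the last elements of the blocks `a ∈ A`, in increasing order of `a`. -/
def blockCycle {N : ℕ} (n : Composition N) (A : Finset (Fin n.length)) :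
    Equiv.Perm (Fin N) :=
  ((A.sort (· ≤ ·)).map (lastOfBlock n)).formPerm

/-- `χ^τ[A; n]`: the average of `χ^τ (g c)` over `g` in the Young subgroup
`S_{n_1} × … × S_{n_p}` (the permutations preserving each block), `c` being the block cycle. -/
def avgChi {K : Type*} [Field K] {N : ℕ} (n : Composition N) (τ : Irr K N)
    (A : Finset (Fin n.length)) : K :=
  (∏ a, ((n.blocksFun a).factorial : K))⁻¹ *
    ∑ g : Equiv.Perm (Fin N) with ∀ j, n.index (g j) = n.index j, τ.chi (g * blockCycle n A)

end

end HeckmanPolychronakos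

namespace HeckmanPolychronakos

open MvPolynomial Finset

/-! ### Permutations, divided differences and Dunkl operators -/

section Algebra

variable {K : Type*} [Field K] {N : ℕ}

/-! Write `y_i = x_i D_i`, so that `P_m = ∑ y_i ^ m`. Modulo monomials strictly lower in dominance,
`y_i` multiplies `x^γ` by `γ_i + θ #{j : γ_j < γ_i}` and subtracts `θ (i,j) x^γ` for each `j` with
`γ_j > γ_i` (`xD_monomial_sub_xDLead`). Hence `P_m` is triangular. It also commutes with `S_N`, so
its leading part acts on each `V_{λ;τ}`. Leading parts of an eigensystem form a basis of `V_{λ;τ}`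
(`IsEigenSystem.isotypic_le_span_lead`), so the sum of eigenvalues is the trace of this action
(`IsEigenSystem.sum_eig`), whatever eigensystem is chosen.

To compute the trace, view it as the trace on `V_λ` of the leading part composed with the isotypical
projection. This operator commutes with `S_N`, which permutes the monomials of `V_λ` transitively
with stabilizer the Young subgroup. The trace is therefore the number of monomials times the
diagonal coefficient at `x^λ` (`trace_mul_card_young`).

The leading part of `y_i ^ m x^λ` is a sum over walks. At each step the exponent at position `i`
either stays in its block `a`, with weight `ℓ̃_a`, or is exchanged for one from an earlier block,
with weight `-θ`. A walk through `k` blocks has `k - 1` jumps and `m + 1 - k` stays; summing over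
the distribution of the stays gives `(-θ)^(k-1) h_{m+1-k}`. The monomial reached is `c⁻¹ x^λ`, with
`c` the increasing cycle through the positions used (`lead_hpOp_monomial`). Its coefficient at `x^λ`
after projection is a character sum over the Young subgroup times `c`. It depends only on the set
`A` of blocks visited, and `∏_{a ∈ A} n_a` cycles visit `A` (`trace_leadEnd`).

Existence rests on two facts. The `P_m` commute, by a computation from `[y_i, y_j] = θ (y_j - y_i)
(i,j)` (`hpOp_commute`). Each `P_m` is semisimple on homogeneous polynomials
(`exists_squarefree_aeval_hpOp`): over an ordered field with `θ > 0` it is self-adjoint for the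
positive definite pairing `(f(D) g)(0)`, and a squarefree annihilating polynomial survives extension
of scalars in characteristic zero. Joint eigenvectors with leading parts forming a basis of
`V_{λ;τ}` can then be selected (`exists_isEigenSystem`). -/

theorem permRep_apply (g : Equiv.Perm (Fin N)) (f : MvPolynomial (Fin N) K) :
    permRep K N g f = rename g f := rfl

theorem permRep_X (g : Equiv.Perm (Fin N)) (i : Fin N) :
    permRep K N g (X i) = X (g i) := by simp [permRep_apply]

theorem permRep_C (g : Equiv.Perm (Fin N)) (a : K) :
    permRep K N g (C a) = C a := by simp [permRep_apply]

theorem permRep_mul_apply (g : Equiv.Perm (Fin N)) (f f' : MvPolynomial (Fin N) K) :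
    permRep K N g (f * f') = permRep K N g f * permRep K N g f' := by simp [permRep_apply]

theorem permRep_permRep (g h : Equiv.Perm (Fin N)) (f : MvPolynomial (Fin N) K) :
    permRep K N g (permRep K N h f) = permRep K N (g * h) f := by
  rw [map_mul]; rfl

theorem permRep_swap_swap (i j : Fin N) (f : MvPolynomial (Fin N) K) :
    permRep K N (Equiv.swap i j) (permRep K N (Equiv.swap i j) f) = f := by
  rw [permRep_permRep, Equiv.swap_mul_self, map_one]; rfl

/-- `divDiff` extended by zero to the case `i = j`. -/
noncomputable def divDiff₀ (i j : Fin N) : Module.End K (MvPolynomial (Fin N) K) :=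
  if h : i ≠ j then divDiff i j h else 0

theorem divDiff₀_self (i : Fin N) : divDiff₀ (K := K) i i = 0 := by simp [divDiff₀]

theorem divDiff₀_of_ne {i j : Fin N} (h : i ≠ j) : divDiff₀ (K := K) i j = divDiff i j h := by
  simp [divDiff₀, h]

theorem X_sub_X_mul_divDiff₀ (i j : Fin N) (f : MvPolynomial (Fin N) K) :
    (X i - X j) * divDiff₀ i j f = f - permRep K N (Equiv.swap i j) f := by
  by_cases h : i = j
  · subst h
    rw [Equiv.swap_self, ← Equiv.Perm.one_def, map_one]
    simp
  · rw [divDiff₀_of_ne h, X_sub_X_mul_divDiff]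

theorem divDiff₀_eq {i j : Fin N} (h : i ≠ j) {f g : MvPolynomial (Fin N) K}
    (e : (X i - X j) * g = f - permRep K N (Equiv.swap i j) f) : divDiff₀ i j f = g := by
  apply mul_left_cancel₀ (X_sub_X_ne_zero (K := K) h)
  rw [e, X_sub_X_mul_divDiff₀]

theorem dunkl_apply (θ : K) (i : Fin N) (f : MvPolynomial (Fin N) K) :
    dunkl θ i f = pderiv i f + θ • ∑ j, divDiff₀ i j f := by
  have h : ∑ j, divDiff₀ i j f = ∑ j : {j : Fin N // j ≠ i}, divDiff i j j.2.symm f := by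
    rw [← Finset.sum_subset (Finset.subset_univ (Finset.univ.filter (· ≠ i)))]
    · rw [Finset.sum_subtype (p := fun j => j ≠ i) _ (by simp)]
      exact Finset.sum_congr rfl fun j _ => by rw [divDiff₀_of_ne j.2.symm]
    · intro j _ hj
      have : j = i := by simpa using hj
      subst this
      simp [divDiff₀_self]
  simp [dunkl, h]

theorem divDiff₀_X_mul_of_ne {i j k : Fin N} (hi : k ≠ i) (hj : k ≠ j)
    (f : MvPolynomial (Fin N) K) : divDiff₀ i j (X k * f) = X k * divDiff₀ i j f := by
  by_cases h : i = j
  · subst h; simp [divDiff₀_self]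
  apply divDiff₀_eq h
  rw [mul_left_comm, X_sub_X_mul_divDiff₀, permRep_mul_apply, permRep_X,
    Equiv.swap_apply_of_ne_of_ne hi hj, mul_sub]

theorem divDiff₀_X_mul_right {i j : Fin N} (h : i ≠ j) (f : MvPolynomial (Fin N) K) :
    divDiff₀ i j (X j * f) = X j * divDiff₀ i j f - permRep K N (Equiv.swap i j) f := by
  apply divDiff₀_eq h
  rw [mul_sub, mul_left_comm, X_sub_X_mul_divDiff₀, permRep_mul_apply, permRep_X,
    Equiv.swap_apply_right]
  ring

theorem divDiff₀_X_mul_left {i j : Fin N} (h : i ≠ j) (f : MvPolynomial (Fin N) K) :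
    divDiff₀ i j (X i * f) = X i * divDiff₀ i j f + permRep K N (Equiv.swap i j) f := by
  apply divDiff₀_eq h
  rw [mul_add, mul_left_comm, X_sub_X_mul_divDiff₀, permRep_mul_apply, permRep_X,
    Equiv.swap_apply_left]
  ring

theorem permRep_divDiff₀ (g : Equiv.Perm (Fin N)) (i j : Fin N) (f : MvPolynomial (Fin N) K) :
    permRep K N g (divDiff₀ i j f) = divDiff₀ (g i) (g j) (permRep K N g f) := by
  by_cases h : i = j
  · subst h; simp [divDiff₀_self]
  symm
  apply divDiff₀_eq (fun e => h (g.injective e))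
  rw [← permRep_X, ← permRep_X, ← map_sub, ← permRep_mul_apply, X_sub_X_mul_divDiff₀, map_sub,
    permRep_permRep, permRep_permRep, Equiv.mul_swap_eq_swap_mul]

theorem permRep_dunkl (θ : K) (g : Equiv.Perm (Fin N)) (i : Fin N) (f : MvPolynomial (Fin N) K) :
    permRep K N g (dunkl θ i f) = dunkl θ (g i) (permRep K N g f) := by
  simp only [dunkl_apply, map_add, map_smul, map_sum, permRep_divDiff₀]
  congr 1
  · simp only [permRep_apply]
    exact (pderiv_rename g.injective i f).symm
  · congr 1
    exact Equiv.sum_comp g (fun j => divDiff₀ (g i) j (permRep K N g f))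

theorem dunkl_X_mul_of_ne (θ : K) {i j : Fin N} (h : i ≠ j) (f : MvPolynomial (Fin N) K) :
    dunkl θ i (X j * f) = X j * dunkl θ i f - θ • permRep K N (Equiv.swap i j) f := by
  simp only [dunkl_apply, mul_add, Algebra.mul_smul_comm]
  have h1 : pderiv i (X j * f) = X j * pderiv i f := by
    rw [Derivation.leibniz, pderiv_X_of_ne h.symm]; simp
  have h2 : ∑ k, divDiff₀ i k (X j * f) =
      X j * ∑ k, divDiff₀ i k f - permRep K N (Equiv.swap i j) f := by
    rw [← Finset.add_sum_erase _ _ (Finset.mem_univ j),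
      ← Finset.add_sum_erase _ (fun k => divDiff₀ i k f) (Finset.mem_univ j),
      divDiff₀_X_mul_right h, mul_add, Finset.mul_sum]
    rw [Finset.sum_congr rfl fun k hk => divDiff₀_X_mul_of_ne (j := k) h.symm
      (Finset.ne_of_mem_erase hk).symm f]
    ring
  rw [h1, h2, smul_sub, add_sub_assoc]

theorem dunkl_X_mul_self (θ : K) (i : Fin N) (f : MvPolynomial (Fin N) K) :
    dunkl θ i (X i * f) = X i * dunkl θ i f + f +
      θ • ∑ j ∈ univ.erase i, permRep K N (Equiv.swap i j) f := by
  simp only [dunkl_apply, mul_add, Algebra.mul_smul_comm]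
  have h1 : pderiv i (X i * f) = X i * pderiv i f + f := by
    rw [Derivation.leibniz, pderiv_X_self]; simp
  have h2 : ∑ k, divDiff₀ i k (X i * f) =
      X i * ∑ k, divDiff₀ i k f + ∑ j ∈ univ.erase i, permRep K N (Equiv.swap i j) f := by
    rw [← Finset.add_sum_erase _ _ (Finset.mem_univ i),
      ← Finset.add_sum_erase _ (fun k => divDiff₀ i k f) (Finset.mem_univ i), mul_add,
      Finset.mul_sum, divDiff₀_self]
    rw [Finset.sum_congr rfl fun k hk => divDiff₀_X_mul_left (Finset.ne_of_mem_erase hk).symm f,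
      Finset.sum_add_distrib]
    simp
  rw [h1, h2, smul_add]
  ring

theorem divDiff₀_C (i j : Fin N) (a : K) : divDiff₀ i j (C a : MvPolynomial (Fin N) K) = 0 := by
  by_cases h : i = j
  · subst h; simp [divDiff₀_self]
  · exact divDiff₀_eq h (by simp [permRep_C])

theorem dunkl_C (θ : K) (i : Fin N) (a : K) :
    dunkl θ i (C a : MvPolynomial (Fin N) K) = 0 := by
  simp [dunkl_apply, divDiff₀_C]

/-- The inductive step for `D_i D_j = D_j D_i`. Moving both operators past `x_j` creates exchange
terms; those with `(i,j)` cancel since `D_i (i,j) = (i,j) D_j`, and the other `(j,l)` commute with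
`D_i`. -/
theorem dunkl_comm_X_mul_self (θ : K) {i j : Fin N} (h : i ≠ j) (f : MvPolynomial (Fin N) K)
    (ih : dunkl θ i (dunkl θ j f) = dunkl θ j (dunkl θ i f)) :
    dunkl θ i (dunkl θ j (X j * f)) = dunkl θ j (dunkl θ i (X j * f)) := by
  have hi : i ∈ univ.erase j := Finset.mem_erase.mpr ⟨h, Finset.mem_univ _⟩
  rw [dunkl_X_mul_self, dunkl_X_mul_of_ne θ h, map_sub, map_add, map_add, dunkl_X_mul_self,
    dunkl_X_mul_of_ne θ h, ih, map_smul, map_smul, map_sum, ← Finset.add_sum_erase _ _ hi,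
    ← Finset.add_sum_erase _ _ hi]
  have e : ∀ l ∈ (univ.erase j).erase i, dunkl θ i (permRep K N (Equiv.swap j l) f) =
      permRep K N (Equiv.swap j l) (dunkl θ i f) := by
    intro l hl
    rw [permRep_dunkl, Equiv.swap_apply_of_ne_of_ne h (Finset.ne_of_mem_erase hl).symm]
  rw [Finset.sum_congr rfl e, permRep_dunkl, permRep_dunkl, Equiv.swap_comm j i,
    Equiv.swap_apply_left, Equiv.swap_apply_right, smul_add, smul_add]
  ring

theorem dunkl_comm (θ : K) (i j : Fin N) (f : MvPolynomial (Fin N) K) :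
    dunkl θ i (dunkl θ j f) = dunkl θ j (dunkl θ i f) := by
  by_cases hij : i = j
  · rw [hij]
  induction f using MvPolynomial.induction_on with
  | C a => simp [dunkl_C]
  | add p q hp hq => simp only [map_add, hp, hq]
  | mul_X p k ih =>
    rw [mul_comm p]
    by_cases hj : k = j
    · subst hj; exact dunkl_comm_X_mul_self θ hij p ih
    by_cases hi : k = i
    · subst hi; exact (dunkl_comm_X_mul_self θ (Ne.symm hij) p ih.symm).symm
    rw [dunkl_X_mul_of_ne θ (Ne.symm hj), dunkl_X_mul_of_ne θ (Ne.symm hi), map_sub, map_sub,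
      dunkl_X_mul_of_ne θ (Ne.symm hj), dunkl_X_mul_of_ne θ (Ne.symm hi), map_smul, map_smul, ih,
      permRep_dunkl, permRep_dunkl, Equiv.swap_apply_of_ne_of_ne hij (Ne.symm hi),
      Equiv.swap_apply_of_ne_of_ne (Ne.symm hij) (Ne.symm hj)]
    ring

/-- The operator `x_i D_i`. -/
noncomputable def xD (θ : K) (i : Fin N) : Module.End K (MvPolynomial (Fin N) K) :=
  LinearMap.mulLeft K (X i) * dunkl θ i

theorem xD_apply (θ : K) (i : Fin N) (f : MvPolynomial (Fin N) K) :
    xD θ i f = X i * dunkl θ i f := rfl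

theorem hpOp_eq (θ : K) (m : ℕ) : hpOp (N := N) θ m = ∑ i, xD θ i ^ m := rfl

theorem permRep_mul_xD (θ : K) (g : Equiv.Perm (Fin N)) (i : Fin N) :
    permRep K N g * xD θ i = xD θ (g i) * permRep K N g := by
  refine LinearMap.ext fun f => ?_
  simp only [Module.End.mul_apply, xD_apply]
  rw [permRep_mul_apply, permRep_X, permRep_dunkl]

theorem permRep_mul_hpOp (θ : K) (g : Equiv.Perm (Fin N)) (m : ℕ) :
    permRep K N g * hpOp θ m = hpOp θ m * permRep K N g := by
  have h : ∀ i, permRep K N g * xD θ i ^ m = xD θ (g i) ^ m * permRep K N g := fun i =>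
    (show SemiconjBy (permRep K N g) (xD θ i) (xD θ (g i)) from
      permRep_mul_xD θ g i).pow_right m
  rw [hpOp_eq, Finset.mul_sum, Finset.sum_congr rfl fun i _ => h i, Finset.sum_mul]
  exact Equiv.sum_comp g fun i => xD θ i ^ m * permRep K N g

/-- Commutativity of the Dunkl operators cancels the terms `x_i x_j D_i D_j`; what is left comes
from the exchange terms. This is the only relation between the `x_i D_i` used for the commutativity
of the `P_m`. -/
theorem xD_commutator (θ : K) {i j : Fin N} (h : i ≠ j) :
    xD θ i * xD θ j - xD θ j * xD θ i =
      θ • ((xD θ j - xD θ i) * permRep K N (Equiv.swap i j)) := by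
  refine LinearMap.ext fun f => ?_
  simp only [Module.End.mul_apply, LinearMap.sub_apply, LinearMap.smul_apply, xD_apply]
  rw [dunkl_X_mul_of_ne θ h, dunkl_X_mul_of_ne θ h.symm, dunkl_comm θ i j, permRep_dunkl,
    permRep_dunkl, Equiv.swap_comm j i, Equiv.swap_apply_right, Equiv.swap_apply_left]
  simp only [mul_sub, smul_sub, Algebra.mul_smul_comm]
  ring

end Algebra

/-! ### Commutativity of the operators `P_m` -/

section Commute

variable {K A : Type*} [Field K] [Ring A] [Algebra K A]

theorem commutator_pow_right {θ : K} {a b s : A} (h : a * b - b * a = θ • ((b - a) * s))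
    (hb : s * b = a * s) (n : ℕ) :
    a * b ^ n - b ^ n * a = θ • ((b ^ n - a ^ n) * s) := by
  induction n with
  | zero => simp
  | succ n ih =>
    have e : a * b ^ (n + 1) - b ^ (n + 1) * a =
        (a * b ^ n - b ^ n * a) * b + b ^ n * (a * b - b * a) := by
      rw [pow_succ]; noncomm_ring
    rw [e, ih, h, smul_mul_assoc, mul_assoc _ s b, hb, mul_smul_comm, ← smul_add]
    congr 1
    rw [pow_succ, pow_succ]
    noncomm_ring

/-- Leibniz expansion over the factors of `a ^ m`. Each commutator leaves one `s`; moving it to the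
right turns every `a` that it passes into `b`. -/
theorem commutator_pow_pow {θ : K} {a b s : A} (h : a * b - b * a = θ • ((b - a) * s))
    (hb : s * b = a * s) (ha : s * a = b * s) (m n : ℕ) :
    a ^ m * b ^ n - b ^ n * a ^ m =
      θ • ((∑ k ∈ range m, a ^ k * (b ^ n - a ^ n) * b ^ (m - 1 - k)) * s) := by
  have hs : ∀ k, s * a ^ k = b ^ k * s := fun k =>
    (show SemiconjBy s a b from ha).pow_right k
  induction m with
  | zero => simp
  | succ m ih =>
    have e : a ^ (m + 1) * b ^ n - b ^ n * a ^ (m + 1) =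
        a * (a ^ m * b ^ n - b ^ n * a ^ m) + (a * b ^ n - b ^ n * a) * a ^ m := by
      rw [pow_succ']; noncomm_ring
    rw [e, ih, commutator_pow_right h hb, smul_mul_assoc, mul_assoc _ s, hs, mul_smul_comm,
      ← smul_add, Finset.sum_range_succ', ← mul_assoc, ← mul_assoc, ← add_mul, Finset.mul_sum]
    congr 3
    · refine Finset.sum_congr rfl fun k hk => ?_
      rw [pow_succ', show m + 1 - 1 - (k + 1) = m - 1 - k by omega]
      noncomm_ring
    · simp

/-- After a reflection of indices, the `k`-th terms of the two sums add up to `[a^k, b^q] + [b^k,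
a^q]` with `q = n + m - 1 - k`. By `commutator_pow_pow` this is `θ` times the same expression with
`m` replaced by `k < m`, times `s`, so strong induction applies. -/
theorem symmetrized_commutator_eq_zero {θ : K} {a b s : A}
    (h : a * b - b * a = θ • ((b - a) * s)) (hb : s * b = a * s) (ha : s * a = b * s) (m n : ℕ) :
    ∑ k ∈ range m, a ^ k * (b ^ n - a ^ n) * b ^ (m - 1 - k) +
      ∑ k ∈ range m, b ^ k * (a ^ n - b ^ n) * a ^ (m - 1 - k) = 0 := by
  induction m using Nat.strong_induction_on generalizing n with
  | _ m ih =>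
    have h' : b * a - a * b = θ • ((a - b) * s) := by
      rw [← neg_sub (a * b), h, ← neg_sub b a, neg_mul, smul_neg]
    have r1 : ∑ k ∈ range m, a ^ k * (b ^ n - a ^ n) * b ^ (m - 1 - k) =
        ∑ k ∈ range m, (a ^ k * b ^ (n + m - 1 - k) - a ^ (n + m - 1 - k) * b ^ k) := by
      simp only [Finset.sum_sub_distrib, mul_sub, sub_mul]
      congr 1
      · refine Finset.sum_congr rfl fun k hk => ?_
        have := Finset.mem_range.mp hk
        rw [mul_assoc, ← pow_add]; congr 2; omega
      · rw [← Finset.sum_range_reflect]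
        refine Finset.sum_congr rfl fun k hk => ?_
        have := Finset.mem_range.mp hk
        rw [← pow_add]; congr 2 <;> omega
    have r2 : ∑ k ∈ range m, b ^ k * (a ^ n - b ^ n) * a ^ (m - 1 - k) =
        ∑ k ∈ range m, (b ^ k * a ^ (n + m - 1 - k) - b ^ (n + m - 1 - k) * a ^ k) := by
      simp only [Finset.sum_sub_distrib, mul_sub, sub_mul]
      congr 1
      · refine Finset.sum_congr rfl fun k hk => ?_
        have := Finset.mem_range.mp hk
        rw [mul_assoc, ← pow_add]; congr 2; omega
      · rw [← Finset.sum_range_reflect]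
        refine Finset.sum_congr rfl fun k hk => ?_
        have := Finset.mem_range.mp hk
        rw [← pow_add]; congr 2 <;> omega
    rw [r1, r2, ← Finset.sum_add_distrib]
    refine Finset.sum_eq_zero fun k hk => ?_
    have := ih k (Finset.mem_range.mp hk) (n + m - 1 - k)
    have c1 := commutator_pow_pow h hb ha k (n + m - 1 - k)
    have c2 := commutator_pow_pow h' ha hb k (n + m - 1 - k)
    have c3 : (a ^ k * b ^ (n + m - 1 - k) - b ^ (n + m - 1 - k) * a ^ k) +
        (b ^ k * a ^ (n + m - 1 - k) - a ^ (n + m - 1 - k) * b ^ k) = 0 := by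
      rw [c1, c2, ← smul_add, ← add_mul, this, zero_mul, smul_zero]
    rw [← c3]; abel

end Commute

theorem hpOp_commute {K : Type*} [Field K] [CharZero K] {N : ℕ} (θ : K) (m n : ℕ) :
    Commute (hpOp (N := N) θ m) (hpOp θ n) := by
  classical
  rw [commute_iff_eq, ← sub_eq_zero, hpOp_eq, hpOp_eq]
  set y : Fin N → Module.End K (MvPolynomial (Fin N) K) := xD θ with hy
  set s : Fin N → Fin N → Module.End K (MvPolynomial (Fin N) K) :=
    fun i j => permRep K N (Equiv.swap i j) with hs
  have hsym : ∀ i j, s i j = s j i := fun i j => by simp only [hs, Equiv.swap_comm]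
  have hl : ∀ i j, s i j * y i = y j * s i j := fun i j => by
    simp only [hs, hy, permRep_mul_xD, Equiv.swap_apply_left]
  have hr : ∀ i j, s i j * y j = y i * s i j := fun i j => by
    simp only [hs, hy, permRep_mul_xD, Equiv.swap_apply_right]
  have hc : ∀ i j, y i * y j - y j * y i = θ • ((y j - y i) * s i j) := fun i j => by
    by_cases h : i = j
    · subst h; simp
    · exact xD_commutator θ h
  let T : Fin N → Fin N → Module.End K (MvPolynomial (Fin N) K) := fun i j =>
    ∑ k ∈ range m, y i ^ k * (y j ^ n - y i ^ n) * y j ^ (m - 1 - k)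
  have hT : (∑ i, y i ^ m) * ∑ j, y j ^ n - (∑ j, y j ^ n) * ∑ i, y i ^ m =
      θ • ∑ i, ∑ j, T i j * s i j := by
    rw [Finset.sum_mul_sum, Finset.sum_mul_sum, Finset.sum_comm (f := fun i j => y i ^ n * y j ^ m),
      ← Finset.sum_sub_distrib, Finset.smul_sum]
    refine Finset.sum_congr rfl fun i _ => ?_
    rw [← Finset.sum_sub_distrib, Finset.smul_sum]
    exact Finset.sum_congr rfl fun j _ => commutator_pow_pow (hc i j) (hr i j) (hl i j) m n
  -- Since `s i j = s j i`, adding the sum to its transpose gives the coefficients `T i j + T j i`,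
  -- which vanish by `symmetrized_commutator_eq_zero`; characteristic zero then allows division by
  -- `2`.
  have h0 : ∑ i, ∑ j, T i j * s i j + ∑ i, ∑ j, T i j * s i j = 0 := by
    nth_rewrite 2 [Finset.sum_comm]
    rw [← Finset.sum_add_distrib]
    refine Finset.sum_eq_zero fun i _ => ?_
    rw [← Finset.sum_add_distrib]
    refine Finset.sum_eq_zero fun j _ => ?_
    rw [hsym j i, ← add_mul, symmetrized_commutator_eq_zero (hc i j) (hr i j) (hl i j), zero_mul]
  have h2 : (2 : K) • ∑ i, ∑ j, T i j * s i j = 0 := by rw [two_smul, h0]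
  rw [hT, (smul_eq_zero.mp h2).resolve_left two_ne_zero, smul_zero]

end HeckmanPolychronakos

namespace HeckmanPolychronakos

open MvPolynomial Finset

/-! ### Rearrangements and the dominance order -/

section Dominance

variable {N : ℕ}

theorem exists_plus_eq_comp (γ : Fin N → ℕ) : ∃ σ : Equiv.Perm (Fin N), (plus γ).1 = γ ∘ σ :=
  ⟨Fin.revPerm.trans (Tuple.sort γ), rfl⟩

theorem plus_comp (γ : Fin N → ℕ) (σ : Equiv.Perm (Fin N)) : plus (γ ∘ σ) = plus γ := by
  apply Subtype.ext
  funext i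
  exact congrFun (Tuple.comp_perm_comp_sort_eq_comp_sort (f := γ) (σ := σ)) i.rev

theorem plus_self (l : Part N) : plus l.1 = l := by
  apply Subtype.ext
  have h : l.1 ∘ Fin.revPerm = l.1 ∘ Tuple.sort l.1 :=
    Tuple.comp_sort_eq_comp_iff_monotone.mpr fun i j h => l.2 (Fin.rev_le_rev.mpr h)
  funext i
  have := congrFun h i.rev
  simp only [Function.comp_apply, Fin.revPerm_apply, Fin.rev_rev] at this
  exact this.symm

theorem plus_eq_iff (γ δ : Fin N → ℕ) :
    plus γ = plus δ ↔ ∃ σ : Equiv.Perm (Fin N), γ = δ ∘ σ := by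
  constructor
  · intro h
    obtain ⟨σ, hσ⟩ := exists_plus_eq_comp γ
    obtain ⟨ρ, hρ⟩ := exists_plus_eq_comp δ
    refine ⟨ρ * σ⁻¹, ?_⟩
    have : γ ∘ σ = δ ∘ ρ := by rw [← hσ, ← hρ, h]
    funext i
    have := congrFun this (σ⁻¹ i)
    simpa using this
  · rintro ⟨σ, rfl⟩
    exact plus_comp δ σ

theorem sum_plus (γ : Fin N → ℕ) : ∑ i, (plus γ).1 i = ∑ i, γ i := by
  obtain ⟨σ, hσ⟩ := exists_plus_eq_comp γ
  rw [hσ]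
  exact Equiv.sum_comp σ γ

theorem sum_sq_plus (γ : Fin N → ℕ) : ∑ i, (plus γ).1 i ^ 2 = ∑ i, γ i ^ 2 := by
  obtain ⟨σ, hσ⟩ := exists_plus_eq_comp γ
  rw [hσ]
  exact Equiv.sum_comp σ fun i => γ i ^ 2

/-- The sets `S \ Iic k` and `Iic k \ S` have the same size; the value `l k` bounds `l` from above
on the first and from below on the second. -/
theorem sum_le_sum_Iic_of_antitone {l : Fin N → ℕ} (hl : Antitone l) (k : Fin N)
    (S : Finset (Fin N)) (hS : S.card = (Iic k).card) : ∑ i ∈ S, l i ≤ ∑ i ∈ Iic k, l i := by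
  rw [← Finset.sum_inter_add_sum_sdiff S (Iic k), ← Finset.sum_inter_add_sum_sdiff (Iic k) S,
    Finset.inter_comm]
  refine Nat.add_le_add_left ?_ _
  have hc : (S \ Iic k).card = (Iic k \ S).card := Finset.card_sdiff_comm hS
  calc ∑ i ∈ S \ Iic k, l i ≤ (S \ Iic k).card • l k :=
        Finset.sum_le_card_nsmul _ _ _ fun i hi => hl (by
          have := (Finset.mem_sdiff.mp hi).2
          rw [Finset.mem_Iic] at this
          exact (not_le.mp this).le)
    _ = (Iic k \ S).card • l k := by rw [hc]
    _ ≤ ∑ i ∈ Iic k \ S, l i := Finset.card_nsmul_le_sum _ _ _ fun i hi => hl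
        (Finset.mem_Iic.mp (Finset.mem_sdiff.mp hi).1)

theorem sum_le_sum_Iic_plus (γ : Fin N → ℕ) (k : Fin N)
    (S : Finset (Fin N)) (hS : S.card = (Iic k).card) :
    ∑ i ∈ S, γ i ≤ ∑ i ∈ Iic k, (plus γ).1 i := by
  obtain ⟨σ, hσ⟩ := exists_plus_eq_comp γ
  have h : ∑ i ∈ S, γ i = ∑ i ∈ S.map σ⁻¹.toEmbedding, (plus γ).1 i := by
    rw [Finset.sum_map, hσ]
    simp
  rw [h]
  exact sum_le_sum_Iic_of_antitone (plus γ).2 k _ (by rw [Finset.card_map, hS])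

theorem Dominated.refl (l : Part N) : Dominated l l := ⟨rfl, fun _ => le_rfl⟩

theorem Dominated.trans {a b c : Part N} (h : Dominated a b) (h' : Dominated b c) :
    Dominated a c := ⟨h.1.trans h'.1, fun k => (h.2 k).trans (h'.2 k)⟩

theorem Dominated.antisymm {a b : Part N} (h : Dominated a b) (h' : Dominated b a) : a = b := by
  apply Subtype.ext
  funext k
  induction k using WellFoundedLT.induction with
  | _ k ih =>
    have e := le_antisymm (h.2 k) (h'.2 k)
    rw [← Finset.Iio_insert, Finset.sum_insert (by simp), Finset.sum_insert (by simp),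
      Finset.sum_congr rfl fun i hi => ih i (Finset.mem_Iio.mp hi)] at e
    exact Nat.add_right_cancel e

/-- A partial sum of the rearrangement of `δ` is a sum over some index set. If the set contains both
or neither of `i`, `j`, its `γ`-sum is the same; if it contains exactly one, that index can be
replaced by the one of `i`, `j` at which `γ` is larger. -/
theorem dominated_of_transfer {γ δ : Fin N → ℕ} {i j : Fin N} (hij : i ≠ j)
    (hne : ∀ k, k ≠ i → k ≠ j → δ k = γ k) (hsum : δ i + δ j = γ i + γ j)
    (hi : δ i ≤ max (γ i) (γ j)) (hj : δ j ≤ max (γ i) (γ j)) :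
    Dominated (plus δ) (plus γ) := by
  have key : ∀ S : Finset (Fin N), i ∈ S → j ∈ S → ∑ k ∈ S, δ k = ∑ k ∈ S, γ k := by
    intro S hiS hjS
    have hj' : j ∈ S.erase i := Finset.mem_erase.mpr ⟨hij.symm, hjS⟩
    rw [← Finset.add_sum_erase _ _ hiS, ← Finset.add_sum_erase _ _ hj',
      ← Finset.add_sum_erase (S) γ hiS, ← Finset.add_sum_erase _ γ hj', ← add_assoc, ← add_assoc,
      hsum]
    congr 1
    refine Finset.sum_congr rfl fun k hk => hne k ?_ ?_
    · exact Finset.ne_of_mem_erase (Finset.mem_of_mem_erase hk)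
    · exact Finset.ne_of_mem_erase hk
  have key2 : ∀ (S : Finset (Fin N)) (x y : Fin N), x ∈ S → y ∉ S →
      (∀ k ∈ S, k ≠ x → δ k = γ k) → δ x ≤ max (γ x) (γ y) →
      ∃ T : Finset (Fin N), T.card = S.card ∧ ∑ k ∈ S, δ k ≤ ∑ k ∈ T, γ k := by
    intro S x y hx hy h1 h2
    have e : ∑ k ∈ S.erase x, δ k = ∑ k ∈ S.erase x, γ k :=
      Finset.sum_congr rfl fun k hk => h1 k (Finset.mem_of_mem_erase hk) (Finset.ne_of_mem_erase hk)
    rcases le_max_iff.mp h2 with h | h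
    · refine ⟨S, rfl, ?_⟩
      rw [← Finset.add_sum_erase _ _ hx, ← Finset.add_sum_erase _ γ hx, e]
      exact Nat.add_le_add_right h _
    · have hy' : y ∉ S.erase x := fun h => hy (Finset.mem_of_mem_erase h)
      refine ⟨insert y (S.erase x), ?_, ?_⟩
      · rw [Finset.card_insert_of_notMem hy', Finset.card_erase_add_one hx]
      · rw [← Finset.add_sum_erase _ _ hx, Finset.sum_insert hy', e]
        exact Nat.add_le_add_right h _
  refine ⟨?_, fun k => ?_⟩
  · rw [sum_plus, sum_plus]
    exact key _ (Finset.mem_univ _) (Finset.mem_univ _)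
  · obtain ⟨σ, hσ⟩ := exists_plus_eq_comp δ
    have h : ∑ x ∈ Iic k, (plus δ).1 x = ∑ x ∈ (Iic k).map σ.toEmbedding, δ x := by
      rw [Finset.sum_map, hσ]; rfl
    have hcard : ((Iic k).map σ.toEmbedding).card = (Iic k).card := Finset.card_map _
    rw [h]
    generalize (Iic k).map σ.toEmbedding = S at hcard
    obtain ⟨T, hT, hle⟩ : ∃ T : Finset (Fin N), T.card = S.card ∧ ∑ k ∈ S, δ k ≤ ∑ k ∈ T, γ k := by
      by_cases hiS : i ∈ S <;> by_cases hjS : j ∈ S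
      · exact ⟨S, rfl, (key S hiS hjS).le⟩
      · exact key2 S i j hiS hjS
          (fun k hk h => hne k h (fun e => hjS (e ▸ hk))) hi
      · exact key2 S j i hjS hiS
          (fun k hk h => hne k (fun e => hiS (e ▸ hk)) h) (by rw [max_comm]; exact hj)
      · exact ⟨S, rfl, (Finset.sum_congr rfl fun k hk =>
          hne k (fun e => hiS (e ▸ hk)) (fun e => hjS (e ▸ hk))).le⟩
    exact hle.trans (sum_le_sum_Iic_plus γ k T (hT.trans hcard))

/-- Bringing two entries strictly closer together, with their sum fixed, strictly decreases the sum
of squares, which a rearrangement would preserve. -/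
theorem plus_ne_of_transfer {γ δ : Fin N → ℕ} {i j : Fin N} (hij : i ≠ j)
    (hne : ∀ k, k ≠ i → k ≠ j → δ k = γ k) (hsum : δ i + δ j = γ i + γ j)
    (hi : δ i < max (γ i) (γ j)) (hj : δ j < max (γ i) (γ j)) : plus δ ≠ plus γ := by
  intro h
  have e : ∑ k, δ k ^ 2 = ∑ k, γ k ^ 2 := by rw [← sum_sq_plus, h, sum_sq_plus]
  have hj' : j ∈ univ.erase i := Finset.mem_erase.mpr ⟨hij.symm, Finset.mem_univ _⟩
  rw [← Finset.add_sum_erase _ _ (Finset.mem_univ i), ← Finset.add_sum_erase _ _ hj',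
    ← Finset.add_sum_erase _ (fun k => γ k ^ 2) (Finset.mem_univ i),
    ← Finset.add_sum_erase _ (fun k => γ k ^ 2) hj', ← add_assoc, ← add_assoc,
    Finset.sum_congr rfl fun k hk => by
      rw [hne k (Finset.ne_of_mem_erase (Finset.mem_of_mem_erase hk)) (Finset.ne_of_mem_erase hk)]]
    at e
  have e2 := Nat.add_right_cancel e
  rcases le_total (γ i) (γ j) with h1 | h1
  · rw [max_eq_right h1] at hi hj
    zify at *
    nlinarith
  · rw [max_eq_left h1] at hi hj
    zify at *
    nlinarith

theorem finite_setOf_sum_eq (n : ℕ) : {γ : Fin N →₀ ℕ | ∑ i, γ i = n}.Finite := by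
  refine Set.Finite.subset (Set.finite_Iic (Finsupp.equivFunOnFinite.symm fun _ => n)) ?_
  intro γ hγ i
  have : γ i ≤ ∑ i, γ i := Finset.single_le_sum (fun _ _ => Nat.zero_le _) (Finset.mem_univ i)
  simpa using this.trans hγ.le

end Dominance

end HeckmanPolychronakos

namespace HeckmanPolychronakos

open MvPolynomial Finset

/-! ### Triangularity -/

section Triangular

variable {K : Type*} [Field K] {N : ℕ}

/-- Polynomials whose monomials `x^γ` satisfy `γ⁺ ∈ S`. -/
noncomputable def partSpan (K : Type*) [Field K] {N : ℕ} (S : Set (Part N)) :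
    Submodule K (MvPolynomial (Fin N) K) :=
  restrictSupport K {γ : Fin N →₀ ℕ | plus γ ∈ S}

theorem mem_partSpan {S : Set (Part N)} {f : MvPolynomial (Fin N) K} :
    f ∈ partSpan K S ↔ ∀ γ ∈ f.support, plus γ ∈ S := by
  simp [partSpan, mem_restrictSupport_iff, Set.subset_def]

theorem monomial_mem_partSpan {S : Set (Part N)} {γ : Fin N →₀ ℕ} (h : plus γ ∈ S) (c : K) :
    monomial γ c ∈ partSpan K S := by
  rw [partSpan, monomial_mem_restrictSupport]
  exact Or.inl h

theorem partSpan_mono {S T : Set (Part N)} (h : S ⊆ T) : partSpan K S ≤ partSpan K T :=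
  restrictSupport_mono _ fun _ hγ => h hγ

theorem partSpan_univ : partSpan K (Set.univ : Set (Part N)) = ⊤ := by
  simp [partSpan]

theorem partSpan_induction {S : Set (Part N)} {p : MvPolynomial (Fin N) K → Prop}
    (hm : ∀ γ : Fin N →₀ ℕ, plus γ ∈ S → p (monomial γ 1)) (h0 : p 0)
    (hadd : ∀ f g, p f → p g → p (f + g)) (hsmul : ∀ (c : K) f, p f → p (c • f))
    {f : MvPolynomial (Fin N) K} (hf : f ∈ partSpan K S) : p f := by
  rw [partSpan, restrictSupport_eq_span] at hf
  induction hf using Submodule.span_induction with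
  | mem x hx => obtain ⟨γ, hγ, rfl⟩ := hx; exact hm γ hγ
  | zero => exact h0
  | add x y _ _ hx hy => exact hadd x y hx hy
  | smul c x _ hx => exact hsmul c x hx

theorem V_eq_partSpan (l : Part N) : V K l = partSpan K {l} := by
  rw [V, partSpan, restrictSupport_eq_span]
  congr 1
  ext f
  simp [eq_comm]

theorem permRep_monomial (g : Equiv.Perm (Fin N)) (γ : Fin N →₀ ℕ) (c : K) :
    permRep K N g (monomial γ c) = monomial (γ.mapDomain g) c := by
  rw [permRep_apply, rename_monomial]

theorem coe_mapDomain_perm (g : Equiv.Perm (Fin N)) (γ : Fin N →₀ ℕ) :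
    ⇑(γ.mapDomain g) = ⇑γ ∘ ⇑g⁻¹ := by
  funext i
  rw [Finsupp.mapDomain_equiv_apply]; rfl

theorem plus_mapDomain (g : Equiv.Perm (Fin N)) (γ : Fin N →₀ ℕ) :
    plus (γ.mapDomain g) = plus γ := by
  rw [coe_mapDomain_perm, plus_comp]

theorem permRep_mem_partSpan {S : Set (Part N)} (g : Equiv.Perm (Fin N))
    {f : MvPolynomial (Fin N) K} (hf : f ∈ partSpan K S) : permRep K N g f ∈ partSpan K S := by
  refine partSpan_induction (p := fun f => permRep K N g f ∈ partSpan K S) (fun γ hγ => ?_)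
    (by simp) (fun f g hf hg => ?_) (fun c f hf => ?_) hf
  · rw [permRep_monomial]
    exact monomial_mem_partSpan (by rwa [plus_mapDomain]) _
  · rw [map_add]; exact add_mem hf hg
  · rw [map_smul]; exact Submodule.smul_mem _ _ hf

/-- The partitions strictly dominated by `l`. -/
def below (l : Part N) : Set (Part N) := {μ | Dominated μ l ∧ μ ≠ l}

theorem monomial_eq_mul_pow {i j : Fin N} (h : i ≠ j) (γ : Fin N →₀ ℕ) :
    (monomial γ 1 : MvPolynomial (Fin N) K) =
      monomial ((γ.erase i).erase j) 1 * (X i ^ γ i * X j ^ γ j) := by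
  rw [X_pow_eq_monomial, X_pow_eq_monomial, monomial_mul, monomial_mul]
  simp only [mul_one]
  refine congrArg (fun δ => monomial δ (1 : K)) ?_
  ext k
  by_cases hj : k = j
  · subst hj; simp [h]
  · by_cases hi : k = i
    · subst hi; simp [h]
    · simp [hi, hj]

theorem permRep_swap_monomial_erase (i j : Fin N) (γ : Fin N →₀ ℕ) :
    permRep K N (Equiv.swap i j) (monomial ((γ.erase i).erase j) 1) =
      monomial ((γ.erase i).erase j) 1 := by
  rw [permRep_monomial]
  refine congrArg (fun δ => monomial δ (1 : K)) ?_
  ext k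
  rw [Finsupp.mapDomain_equiv_apply, Equiv.symm_swap]
  by_cases hi : k = i
  · subst hi
    rw [Equiv.swap_apply_left]
    by_cases h : k = j
    · simp [h]
    · simp [h]
  · by_cases hj : k = j
    · subst hj
      rw [Equiv.swap_apply_right]
      simp [Ne.symm hi]
    · rw [Equiv.swap_apply_of_ne_of_ne hi hj]

/-- The divided difference is a geometric sum. After multiplication by `x_i` its top term is `x^γ`,
and in every other term the exponents of `x_i` and `x_j` are both smaller than `γ i`, so that the
rearrangement is strictly lower in dominance. -/
theorem X_mul_divDiff₀_monomial_of_gt {i j : Fin N} {γ : Fin N →₀ ℕ} (h : γ j < γ i) :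
    X i * divDiff₀ i j (monomial γ (1 : K)) - monomial γ 1 ∈ partSpan K (below (plus γ)) := by
  have hij : i ≠ j := by rintro rfl; exact lt_irrefl _ h
  obtain ⟨c, hc⟩ : ∃ c, γ i = γ j + c + 1 := ⟨γ i - γ j - 1, by omega⟩
  set u : MvPolynomial (Fin N) K := monomial ((γ.erase i).erase j) 1 with hu
  have hγ : (monomial γ 1 : MvPolynomial (Fin N) K) = u * (X i ^ γ i * X j ^ γ j) :=
    monomial_eq_mul_pow hij γ
  -- With `u` the part of the monomial free of `x_i` and `x_j`, this divides `u (x_i x_j)^(γ j)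
  -- (x_i^(c+1) - x_j^(c+1))` by `x_i - x_j`.
  have hd : divDiff₀ i j (monomial γ (1 : K)) =
      ∑ k ∈ range (c + 1), u * (X i ^ (γ j + k) * X j ^ (γ j + (c - k))) := by
    apply divDiff₀_eq hij
    have e : ∑ k ∈ range (c + 1), u * (X i ^ (γ j + k) * X j ^ (γ j + (c - k))) =
        u * (X i ^ γ j * X j ^ γ j) *
          ∑ k ∈ range (c + 1), X i ^ k * X j ^ (c + 1 - 1 - k) := by
      rw [Finset.mul_sum]
      refine Finset.sum_congr rfl fun k _ => ?_
      rw [pow_add, pow_add, Nat.add_sub_cancel]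
      ring
    rw [e, mul_left_comm, mul_comm (X i - X j) (∑ _ ∈ _, _), (Commute.all _ _).geom_sum₂_mul, hγ,
      permRep_mul_apply, permRep_swap_monomial_erase, permRep_mul_apply]
    simp only [permRep_apply, map_pow, rename_X, Equiv.swap_apply_left, Equiv.swap_apply_right]
    rw [hc, add_assoc, pow_add, pow_add]
    ring
  have hr : X i * divDiff₀ i j (monomial γ (1 : K)) - monomial γ 1 =
      ∑ k ∈ range c, u * (X i ^ (γ j + k + 1) * X j ^ (γ j + (c - k))) := by
    rw [hd, Finset.sum_range_succ, mul_add, Finset.mul_sum, hγ, hc, Nat.sub_self]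
    have : ∀ k ∈ range c, X i * (u * (X i ^ (γ j + k) * X j ^ (γ j + (c - k)))) =
        u * (X i ^ (γ j + k + 1) * X j ^ (γ j + (c - k))) := fun k _ => by ring
    rw [Finset.sum_congr rfl this]
    ring
  rw [hr]
  refine Submodule.sum_mem _ fun k hk => ?_
  have hk := Finset.mem_range.mp hk
  set δ : Fin N →₀ ℕ := (γ.erase i).erase j + (Finsupp.single i (γ j + k + 1) +
    Finsupp.single j (γ j + (c - k))) with hδ
  have : u * (X i ^ (γ j + k + 1) * X j ^ (γ j + (c - k))) = monomial δ 1 := by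
    rw [hu, X_pow_eq_monomial, X_pow_eq_monomial, monomial_mul, monomial_mul]
    simp [hδ]
  rw [this]
  have hδi : δ i = γ j + k + 1 := by simp [hδ, hij]
  have hδj : δ j = γ j + (c - k) := by simp [hδ, hij]
  have hδk : ∀ m, m ≠ i → m ≠ j → δ m = γ m := fun m hi hj => by
    simp [hδ, hi, hj]
  have hs : δ i + δ j = γ i + γ j := by omega
  have h1 : δ i < max (γ i) (γ j) := lt_max_of_lt_left (by omega)
  have h2 : δ j < max (γ i) (γ j) := lt_max_of_lt_left (by omega)
  exact monomial_mem_partSpan (show plus δ ∈ below (plus γ) from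
    ⟨dominated_of_transfer hij hδk hs h1.le h2.le, plus_ne_of_transfer hij hδk hs h1 h2⟩) _

theorem divDiff₀_permRep_swap (i j : Fin N) (f : MvPolynomial (Fin N) K) :
    divDiff₀ i j (permRep K N (Equiv.swap i j) f) = - divDiff₀ i j f := by
  by_cases h : i = j
  · subst h; simp [divDiff₀_self]
  · apply divDiff₀_eq h
    rw [mul_neg, X_sub_X_mul_divDiff₀, permRep_swap_swap, neg_sub]

/-- The exchanged monomial falls under the opposite case, and the divided difference changes sign
under the exchange. -/
theorem X_mul_divDiff₀_monomial_of_lt {i j : Fin N} {γ : Fin N →₀ ℕ} (h : γ i < γ j) :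
    X i * divDiff₀ i j (monomial γ (1 : K)) + permRep K N (Equiv.swap i j) (monomial γ 1) ∈
      partSpan K (below (plus γ)) := by
  have h1 := X_mul_divDiff₀_monomial_of_gt (K := K) (i := i) (j := j)
    (γ := γ.mapDomain (Equiv.swap i j)) (by
      rw [Finsupp.mapDomain_equiv_apply, Finsupp.mapDomain_equiv_apply, Equiv.symm_swap,
        Equiv.swap_apply_left, Equiv.swap_apply_right]
      exact h)
  rw [plus_mapDomain, ← permRep_monomial, divDiff₀_permRep_swap, mul_neg, ← neg_add'] at h1
  exact neg_mem_iff.mp h1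

theorem divDiff₀_monomial_of_eq {i j : Fin N} {γ : Fin N →₀ ℕ} (h : γ i = γ j) :
    divDiff₀ i j (monomial γ (1 : K)) = 0 := by
  by_cases hij : i = j
  · subst hij; simp [divDiff₀_self]
  apply divDiff₀_eq hij
  have : γ.mapDomain (Equiv.swap i j) = γ := by
    ext k
    rw [Finsupp.mapDomain_equiv_apply, Equiv.symm_swap]
    by_cases hi : k = i
    · subst hi; rw [Equiv.swap_apply_left, h]
    · by_cases hj : k = j
      · subst hj; rw [Equiv.swap_apply_right, h]
      · rw [Equiv.swap_apply_of_ne_of_ne hi hj]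
  rw [permRep_monomial, this, mul_zero, sub_self]

theorem X_mul_pderiv_monomial (i : Fin N) (γ : Fin N →₀ ℕ) :
    X i * pderiv i (monomial γ (1 : K)) = (γ i : K) • monomial γ 1 := by
  rw [pderiv_monomial, one_mul]
  by_cases h : γ i = 0
  · simp [h]
  · rw [X, monomial_mul, smul_monomial, one_mul, smul_eq_mul, mul_one]
    refine congrArg (fun δ => monomial δ (γ i : K)) ?_
    ext k
    by_cases hk : k = i
    · subst hk; simp; omega
    · simp [Ne.symm hk]

/-- The leading term of `x_i D_i x^γ` with respect to dominance. -/
noncomputable def xDLead (θ : K) (i : Fin N) (γ : Fin N →₀ ℕ) : MvPolynomial (Fin N) K :=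
  (γ i + θ * #{j | γ j < γ i} : K) • monomial γ 1 -
    θ • ∑ j with γ i < γ j, permRep K N (Equiv.swap i j) (monomial γ 1)

theorem xD_monomial_sub_xDLead (θ : K) (i : Fin N) (γ : Fin N →₀ ℕ) :
    xD θ i (monomial γ 1) - xDLead θ i γ ∈ partSpan K (below (plus γ)) := by
  set m : MvPolynomial (Fin N) K := monomial γ 1 with hm
  let t : Fin N → MvPolynomial (Fin N) K := fun j =>
    if γ j < γ i then m else if γ i < γ j then - permRep K N (Equiv.swap i j) m else 0
  have h1 : xD θ i m - xDLead θ i γ = θ • ∑ j, (X i * divDiff₀ i j m - t j) := by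
    rw [xD_apply, dunkl_apply, mul_add, X_mul_pderiv_monomial, ← hm, xDLead, ← hm,
      Algebra.mul_smul_comm, Finset.sum_sub_distrib, Finset.mul_sum]
    have h2 : ∑ j, t j = (#{j | γ j < γ i} : K) • m -
        ∑ j with γ i < γ j, permRep K N (Equiv.swap i j) m := by
      have h3 : ∀ j, t j = (if γ j < γ i then m else 0) -
          (if γ i < γ j then permRep K N (Equiv.swap i j) m else 0) := by
        intro j
        simp only [t]
        split_ifs with a b <;> first | omega | simp
      rw [Finset.sum_congr rfl fun j _ => h3 j, Finset.sum_sub_distrib, ← Finset.sum_filter,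
        ← Finset.sum_filter, Finset.sum_const, Nat.cast_smul_eq_nsmul]
    rw [h2, smul_sub, smul_sub, add_smul, mul_smul]
    ring
  rw [h1]
  refine Submodule.smul_mem _ _ (Submodule.sum_mem _ fun j _ => ?_)
  simp only [t]
  split_ifs with a b
  · exact X_mul_divDiff₀_monomial_of_gt a
  · rw [sub_neg_eq_add]; exact X_mul_divDiff₀_monomial_of_lt b
  · rw [hm, divDiff₀_monomial_of_eq (by omega)]; simp

theorem xDLead_mem (θ : K) (i : Fin N) (γ : Fin N →₀ ℕ) :
    xDLead θ i γ ∈ partSpan K {plus γ} := by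
  have h : monomial γ (1 : K) ∈ partSpan K {plus γ} :=
    monomial_mem_partSpan (Set.mem_singleton _) 1
  exact sub_mem (Submodule.smul_mem _ _ h)
    (Submodule.smul_mem _ _ (Submodule.sum_mem _ fun j _ => permRep_mem_partSpan _ h))

/-- Sets of partitions that are closed downwards in the dominance order. -/
def IsDominanceLower (S : Set (Part N)) : Prop := ∀ l ∈ S, ∀ μ, Dominated μ l → μ ∈ S

theorem isDominanceLower_below (l : Part N) : IsDominanceLower (below l) := by
  rintro μ ⟨h1, h2⟩ ν h
  refine ⟨h.trans h1, ?_⟩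
  rintro rfl
  exact h2 (h1.antisymm h)

theorem isDominanceLower_dominated (l : Part N) : IsDominanceLower {μ | Dominated μ l} :=
  fun _ h _ h' => h'.trans h

theorem isDominanceLower_size (n : ℕ) : IsDominanceLower {μ : Part N | ∑ i, μ.1 i = n} :=
  fun _ h _ h' => h'.1.trans h

theorem xD_mem_partSpan (θ : K) (i : Fin N) {S : Set (Part N)} (hS : IsDominanceLower S)
    {f : MvPolynomial (Fin N) K} (hf : f ∈ partSpan K S) : xD θ i f ∈ partSpan K S := by
  refine partSpan_induction (p := fun f => xD θ i f ∈ partSpan K S) (fun γ hγ => ?_)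
    (by simp) (fun f g hf hg => ?_) (fun c f hf => ?_) hf
  · rw [← sub_add_cancel (xD θ i (monomial γ 1)) (xDLead θ i γ)]
    refine add_mem (partSpan_mono ?_ (xD_monomial_sub_xDLead θ i γ))
      (partSpan_mono ?_ (xDLead_mem θ i γ))
    · exact fun μ hμ => hS _ hγ _ hμ.1
    · rintro _ rfl; exact hγ
  · rw [map_add]; exact add_mem hf hg
  · rw [map_smul]; exact Submodule.smul_mem _ _ hf

theorem xD_pow_mem_partSpan (θ : K) (i : Fin N) (m : ℕ) {S : Set (Part N)}
    (hS : IsDominanceLower S) {f : MvPolynomial (Fin N) K} (hf : f ∈ partSpan K S) :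
    (xD θ i ^ m) f ∈ partSpan K S := by
  induction m with
  | zero => simpa using hf
  | succ m ih => rw [pow_succ', Module.End.mul_apply]; exact xD_mem_partSpan θ i hS ih

theorem hpOp_mem_partSpan (θ : K) (m : ℕ) {S : Set (Part N)}
    (hS : IsDominanceLower S) {f : MvPolynomial (Fin N) K} (hf : f ∈ partSpan K S) :
    hpOp θ m f ∈ partSpan K S := by
  rw [hpOp_eq, LinearMap.sum_apply]
  exact Submodule.sum_mem _ fun i _ => xD_pow_mem_partSpan θ i m hS hf

/-! ### Leading parts -/

theorem coeff_leadingPart (l : Part N) (f : MvPolynomial (Fin N) K) (γ : Fin N →₀ ℕ)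
    [Decidable (plus γ = l)] :
    coeff γ (leadingPart l f) = if plus γ = l then coeff γ f else 0 := by
  classical
  rw [leadingPart, coeff_sum]
  simp only [coeff_monomial]
  rw [Finset.sum_ite_eq']
  by_cases h : γ ∈ f.support
  · simp only [Finset.mem_filter, h, true_and]
  · have : coeff γ f = 0 := notMem_support_iff.mp h
    simp [h, this]

/-- `leadingPart` as a linear map. -/
noncomputable def lead (K : Type*) [Field K] {N : ℕ} (l : Part N) :
    Module.End K (MvPolynomial (Fin N) K) where
  toFun := leadingPart l
  map_add' f g := by
    classical
    ext γ
    simp only [coeff_leadingPart, coeff_add]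
    split_ifs <;> simp
  map_smul' c f := by
    classical
    ext γ
    simp only [coeff_leadingPart, coeff_smul, RingHom.id_apply]
    split_ifs <;> simp

theorem lead_apply (l : Part N) (f : MvPolynomial (Fin N) K) : lead K l f = leadingPart l f := rfl

theorem coeff_lead (l : Part N) (f : MvPolynomial (Fin N) K) (γ : Fin N →₀ ℕ)
    [Decidable (plus γ = l)] :
    coeff γ (lead K l f) = if plus γ = l then coeff γ f else 0 := coeff_leadingPart l f γ

theorem lead_mem (l : Part N) (f : MvPolynomial (Fin N) K) : lead K l f ∈ partSpan K {l} := by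
  classical
  rw [mem_partSpan]
  intro γ hγ
  by_contra h
  rw [mem_support_iff, coeff_lead] at hγ
  simp only [Set.mem_singleton_iff] at h
  simp [h] at hγ

theorem sub_lead_mem {l : Part N} {S : Set (Part N)} {f : MvPolynomial (Fin N) K}
    (hf : f ∈ partSpan K S) : f - lead K l f ∈ partSpan K (S \ {l}) := by
  classical
  rw [mem_partSpan] at hf ⊢
  intro γ hγ
  rw [mem_support_iff, coeff_sub, coeff_lead] at hγ
  by_cases h : plus γ = l
  · simp [h] at hγ
  · rw [if_neg h, sub_zero] at hγ
    exact ⟨hf γ (mem_support_iff.mpr hγ), h⟩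

theorem sub_lead_mem_below {l : Part N} {f : MvPolynomial (Fin N) K}
    (hf : f ∈ partSpan K {μ | Dominated μ l}) : f - lead K l f ∈ partSpan K (below l) :=
  sub_lead_mem hf

theorem lead_eq_zero {l : Part N} {S : Set (Part N)} (hl : l ∉ S) {f : MvPolynomial (Fin N) K}
    (hf : f ∈ partSpan K S) : lead K l f = 0 := by
  classical
  ext γ
  rw [coeff_lead, coeff_zero]
  split_ifs with h
  · by_contra hc
    exact hl (h ▸ mem_partSpan.mp hf γ (mem_support_iff.mpr hc))
  · rfl

theorem lead_below {l : Part N} {f : MvPolynomial (Fin N) K} (hf : f ∈ partSpan K (below l)) :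
    lead K l f = 0 := lead_eq_zero (fun h => h.2 rfl) hf

theorem lead_of_mem {l : Part N} {f : MvPolynomial (Fin N) K} (hf : f ∈ partSpan K {l}) :
    lead K l f = f := by
  have := sub_lead_mem (l := l) hf
  rw [Set.sdiff_self] at this
  have h : f - lead K l f = 0 := by
    rw [← support_eq_empty, Finset.eq_empty_iff_forall_notMem]
    exact fun γ hγ => mem_partSpan.mp this γ hγ
  exact (sub_eq_zero.mp h).symm

theorem partSpan_singleton_le (l : Part N) :
    partSpan K {l} ≤ partSpan K {μ | Dominated μ l} :=
  partSpan_mono (by rintro _ rfl; exact Dominated.refl _)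

theorem permRep_lead (l : Part N) (g : Equiv.Perm (Fin N)) (f : MvPolynomial (Fin N) K) :
    permRep K N g (lead K l f) = lead K l (permRep K N g f) := by
  have hd : permRep K N g f = permRep K N g (lead K l f) + permRep K N g (f - lead K l f) := by
    rw [← map_add]; congr 1; abel
  have hu : f ∈ partSpan K (Set.univ : Set (Part N)) := by rw [partSpan_univ]; trivial
  rw [hd, map_add, lead_of_mem (permRep_mem_partSpan g (lead_mem l f)),
    lead_eq_zero (S := Set.univ \ {l}) (by simp) (permRep_mem_partSpan g (sub_lead_mem hu)),
    add_zero]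

/-- Terms strictly below `l` stay strictly below `l` under `x_i D_i`, so discarding them after every
step does not affect the final leading part. -/
theorem lead_xD_pow (θ : K) (l : Part N) (i : Fin N) (m : ℕ) {f : MvPolynomial (Fin N) K}
    (hf : f ∈ partSpan K {μ | Dominated μ l}) :
    lead K l ((xD θ i ^ m) f) = ((lead K l * xD θ i) ^ m) (lead K l f) := by
  induction m with
  | zero => simp
  | succ m ih =>
    have h := xD_pow_mem_partSpan θ i m (isDominanceLower_dominated l) hf
    rw [pow_succ', pow_succ', Module.End.mul_apply, Module.End.mul_apply, ← ih,
      Module.End.mul_apply]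
    set F := (xD θ i ^ m) f
    rw [← sub_eq_zero, ← map_sub, ← map_sub]
    exact lead_below (xD_mem_partSpan θ i (isDominanceLower_below l) (sub_lead_mem_below h))

theorem lead_hpOp (θ : K) (l : Part N) (m : ℕ) {f : MvPolynomial (Fin N) K}
    (hf : f ∈ partSpan K {μ | Dominated μ l}) :
    lead K l (hpOp θ m f) = lead K l (hpOp θ m (lead K l f)) := by
  rw [← sub_eq_zero, ← map_sub, ← map_sub]
  exact lead_below (hpOp_mem_partSpan θ m (isDominanceLower_below l) (sub_lead_mem_below hf))

theorem lead_xD_monomial (θ : K) (i : Fin N) (γ : Fin N →₀ ℕ) :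
    lead K (plus γ) (xD θ i (monomial γ 1)) = xDLead θ i γ := by
  have h := lead_below (xD_monomial_sub_xDLead θ i γ)
  rw [map_sub, lead_of_mem (xDLead_mem θ i γ)] at h
  exact sub_eq_zero.mp h

/-! ### Degrees and finite dimension -/

theorem mem_partSpan_size_iff (n : ℕ) (f : MvPolynomial (Fin N) K) :
    f ∈ partSpan K {μ | ∑ i, μ.1 i = n} ↔ f.IsHomogeneous n := by
  rw [mem_partSpan]
  have h : ∀ γ : Fin N →₀ ℕ, plus γ ∈ {μ : Part N | ∑ i, μ.1 i = n} ↔ γ.degree = n := by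
    intro γ
    rw [Set.mem_ofPred_eq, sum_plus, Finsupp.degree_eq_sum]
  simp only [h, IsHomogeneous, IsWeightedHomogeneous, mem_support_iff, Finsupp.degree_eq_weight_one]
  rfl

theorem finite_partSpan {S : Set (Part N)} {n : ℕ} (hS : ∀ μ ∈ S, ∑ i, μ.1 i = n) :
    Module.Finite K (partSpan K S) := by
  have h : ({γ : Fin N →₀ ℕ | plus γ ∈ S}).Finite :=
    (finite_setOf_sum_eq n).subset fun γ hγ => (sum_plus γ).symm.trans (hS _ hγ)
  have := h.to_subtype
  exact Module.Finite.of_basis (basisRestrictSupport K {γ : Fin N →₀ ℕ | plus γ ∈ S})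

instance finite_partSpan_singleton (l : Part N) : Module.Finite K (partSpan K {l}) :=
  finite_partSpan (n := ∑ i, l.1 i) (by rintro _ rfl; rfl)

instance finite_partSpan_size (n : ℕ) :
    Module.Finite K (partSpan K {μ : Part N | ∑ i, μ.1 i = n}) :=
  finite_partSpan fun _ h => h

end Triangular

end HeckmanPolychronakos

namespace HeckmanPolychronakos

open MvPolynomial Finset

/-! ### The Dunkl pairing over an ordered field -/

section Pairing

variable {K : Type*} [Field K] {N : ℕ}

open scoped IsMulCommutative in
-- Evaluation of polynomials needs a commutative target. By `dunkl_comm` the Dunkl operators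
-- generate a commutative subalgebra, which is then included into all endomorphisms.
theorem exists_dunklHom (θ : K) :
    ∃ Φ : MvPolynomial (Fin N) K →ₐ[K] Module.End K (MvPolynomial (Fin N) K),
      ∀ i, Φ (X i) = dunkl θ i := by
  have hc : ∀ a ∈ Set.range (dunkl (N := N) θ), ∀ b ∈ Set.range (dunkl (N := N) θ),
      a * b = b * a := by
    rintro _ ⟨i, rfl⟩ _ ⟨j, rfl⟩
    exact LinearMap.ext fun f => dunkl_comm θ i j f
  have := Algebra.isMulCommutative_adjoin K hc
  refine ⟨(Algebra.adjoin K (Set.range (dunkl (N := N) θ))).val.comp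
    (aeval fun i => ⟨dunkl θ i, Algebra.subset_adjoin ⟨i, rfl⟩⟩), fun i => ?_⟩
  simp

/-- The substitution `x_i ↦ D_i`. -/
noncomputable def dunklHom (θ : K) :
    MvPolynomial (Fin N) K →ₐ[K] Module.End K (MvPolynomial (Fin N) K) :=
  (exists_dunklHom θ).choose

theorem dunklHom_X (θ : K) (i : Fin N) : dunklHom θ (X i) = dunkl θ i :=
  (exists_dunklHom θ).choose_spec i

/-- The Dunkl pairing `(f, g) ↦ (f(D) g)(0)`. -/
noncomputable def pairing (θ : K) (f g : MvPolynomial (Fin N) K) : K :=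
  constantCoeff (dunklHom θ f g)

theorem pairing_add_left (θ : K) (f f' g : MvPolynomial (Fin N) K) :
    pairing θ (f + f') g = pairing θ f g + pairing θ f' g := by simp [pairing]

theorem pairing_add_right (θ : K) (f g g' : MvPolynomial (Fin N) K) :
    pairing θ f (g + g') = pairing θ f g + pairing θ f g' := by simp [pairing]

theorem pairing_smul_left (θ c : K) (f g : MvPolynomial (Fin N) K) :
    pairing θ (c • f) g = c * pairing θ f g := by simp [pairing, constantCoeff_eq]

theorem pairing_smul_right (θ c : K) (f g : MvPolynomial (Fin N) K) :
    pairing θ f (c • g) = c * pairing θ f g := by simp [pairing, constantCoeff_eq]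

theorem pairing_zero_right (θ : K) (f : MvPolynomial (Fin N) K) :
    pairing θ f 0 = 0 := by simp [pairing]

theorem pairing_sub_left (θ : K) (f f' g : MvPolynomial (Fin N) K) :
    pairing θ (f - f') g = pairing θ f g - pairing θ f' g := by simp [pairing]

theorem pairing_sub_right (θ : K) (f g g' : MvPolynomial (Fin N) K) :
    pairing θ f (g - g') = pairing θ f g - pairing θ f g' := by simp [pairing]

theorem pairing_sum_left {ι : Type*} (θ : K) (s : Finset ι) (f : ι → MvPolynomial (Fin N) K)
    (g : MvPolynomial (Fin N) K) :
    pairing θ (∑ i ∈ s, f i) g = ∑ i ∈ s, pairing θ (f i) g := by simp [pairing]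

theorem pairing_sum_right {ι : Type*} (θ : K) (s : Finset ι) (f : MvPolynomial (Fin N) K)
    (g : ι → MvPolynomial (Fin N) K) :
    pairing θ f (∑ i ∈ s, g i) = ∑ i ∈ s, pairing θ f (g i) := by simp [pairing]

theorem pairing_X_mul (θ : K) (i : Fin N) (f g : MvPolynomial (Fin N) K) :
    pairing θ (X i * f) g = pairing θ f (dunkl θ i g) := by
  rw [pairing, mul_comm, map_mul, dunklHom_X]; rfl

theorem permRep_dunklHom (θ : K) (s : Equiv.Perm (Fin N)) (f g : MvPolynomial (Fin N) K) :
    permRep K N s (dunklHom θ f g) = dunklHom θ (permRep K N s f) (permRep K N s g) := by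
  induction f using MvPolynomial.induction_on generalizing g with
  | C a =>
    rw [permRep_C, ← algebraMap_eq, AlgHom.commutes, Module.algebraMap_end_apply,
      Module.algebraMap_end_apply, map_smul]
  | add p q hp hq => simp only [map_add, LinearMap.add_apply, hp, hq]
  | mul_X p i ih =>
    rw [permRep_mul_apply, permRep_X, map_mul, map_mul, dunklHom_X, dunklHom_X,
      Module.End.mul_apply, Module.End.mul_apply, ih, permRep_dunkl]

theorem pairing_permRep (θ : K) (s : Equiv.Perm (Fin N)) (f g : MvPolynomial (Fin N) K) :
    pairing θ (permRep K N s f) (permRep K N s g) = pairing θ f g := by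
  rw [pairing, ← permRep_dunklHom, permRep_apply, constantCoeff_rename, pairing]

theorem pairing_swap (θ : K) (i j : Fin N) (f g : MvPolynomial (Fin N) K) :
    pairing θ (permRep K N (Equiv.swap i j) f) g =
      pairing θ f (permRep K N (Equiv.swap i j) g) := by
  rw [← pairing_permRep θ (Equiv.swap i j) (permRep K N (Equiv.swap i j) f), permRep_swap_swap]

/-- The polynomials that are homogeneous of degree `n`. -/
noncomputable abbrev homog (K : Type*) [Field K] (N n : ℕ) :
    Submodule K (MvPolynomial (Fin N) K) := partSpan K {μ : Part N | ∑ i, μ.1 i = n}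

theorem mem_homog {n : ℕ} {f : MvPolynomial (Fin N) K} : f ∈ homog K N n ↔ f.IsHomogeneous n :=
  mem_partSpan_size_iff n f

/-- Multiplication by `x_i` only shifts exponents, so the degree of `D_i f` can be read off from
that of `x_i D_i f`, which triangularity controls. -/
theorem dunkl_mem_homog (θ : K) (i : Fin N) {n : ℕ} {f : MvPolynomial (Fin N) K}
    (hf : f ∈ homog K N (n + 1)) : dunkl θ i f ∈ homog K N n := by
  have h := xD_mem_partSpan θ i (isDominanceLower_size (n + 1)) hf
  rw [mem_partSpan] at h ⊢
  intro γ hγ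
  have h1 := h (Finsupp.single i 1 + γ) (by
    rw [mem_support_iff, xD_apply, coeff_X_mul]
    exact mem_support_iff.mp hγ)
  simp only [Set.mem_ofPred_eq, sum_plus, Finsupp.coe_add, Pi.add_apply, Finset.sum_add_distrib]
    at h1 ⊢
  have : ∑ x, (Finsupp.single i 1) x = 1 := by simp [Finsupp.single_apply]
  omega

theorem eq_C_of_mem_homog_zero {f : MvPolynomial (Fin N) K} (hf : f ∈ homog K N 0) :
    f = C (constantCoeff f) := by
  have h := mem_homog.mp hf
  exact (totalDegree_eq_zero_iff_eq_C.mp (Nat.le_zero.mp h.totalDegree_le))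

/-- The operator `∑ x_i D_i`. -/
noncomputable def eulerOp (θ : K) : Module.End K (MvPolynomial (Fin N) K) := ∑ i, xD θ i

theorem eulerOp_mem_homog (θ : K) {n : ℕ} {f : MvPolynomial (Fin N) K}
    (hf : f ∈ homog K N n) : eulerOp θ f ∈ homog K N n := by
  rw [eulerOp, LinearMap.sum_apply]
  exact Submodule.sum_mem _ fun i _ => xD_mem_partSpan θ i (isDominanceLower_size n) hf

theorem pairing_eulerOp (θ : K) (f g : MvPolynomial (Fin N) K) :
    pairing θ (eulerOp θ f) g = ∑ i, pairing θ (dunkl θ i f) (dunkl θ i g) := by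
  rw [eulerOp, LinearMap.sum_apply, pairing_sum_left]
  exact Finset.sum_congr rfl fun i _ => by rw [xD_apply, pairing_X_mul]

theorem divDiff₀_comm (i j : Fin N) (f : MvPolynomial (Fin N) K) :
    divDiff₀ j i f = - divDiff₀ i j f := by
  by_cases h : i = j
  · subst h; simp [divDiff₀_self]
  · apply divDiff₀_eq (Ne.symm h)
    rw [mul_neg, ← neg_mul, neg_sub, X_sub_X_mul_divDiff₀, Equiv.swap_comm]

/-- The `(i,j)` and `(j,i)` terms combine: `x_i Δ_ij + x_j Δ_ji = (x_i - x_j) Δ_ij = 1 - (i,j)`. In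
this form the operator is visibly symmetric for any `S_N`-invariant form and, when `θ > 0`,
positive. -/
theorem eulerOp_eq [CharZero K] (θ : K) {n : ℕ} {f : MvPolynomial (Fin N) K}
    (hf : f ∈ homog K N n) :
    eulerOp θ f = (n : K) • f + (θ / 2) • ∑ i, ∑ j, (f - permRep K N (Equiv.swap i j) f) := by
  have h1 : ∑ i, X i * pderiv i f = (n : K) • f := by
    rw [(mem_homog.mp hf).sum_X_mul_pderiv, Nat.cast_smul_eq_nsmul]
  have h2 : ∑ i, ∑ j, (f - permRep K N (Equiv.swap i j) f) =
      (2 : K) • ∑ i, ∑ j, X i * divDiff₀ i j f := by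
    rw [two_smul]
    nth_rewrite 3 [Finset.sum_comm]
    rw [← Finset.sum_add_distrib]
    refine Finset.sum_congr rfl fun i _ => ?_
    rw [← Finset.sum_add_distrib]
    refine Finset.sum_congr rfl fun j _ => ?_
    rw [← X_sub_X_mul_divDiff₀, divDiff₀_comm i j]
    ring
  rw [h2, smul_smul, div_mul_cancel₀ _ two_ne_zero, ← h1, eulerOp, LinearMap.sum_apply,
    Finset.smul_sum, ← Finset.sum_add_distrib]
  refine Finset.sum_congr rfl fun i _ => ?_
  rw [xD_apply, dunkl_apply, mul_add, Algebra.mul_smul_comm, Finset.mul_sum]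

end Pairing

/-! ### Positivity of the Dunkl pairing and semisimplicity of `P_m` over an ordered field -/

section Ordered

variable {F : Type*} [Field F] [LinearOrder F] [IsStrictOrderedRing F] {N : ℕ} {θ : F}

/-- A maximum principle: at a coefficient of largest absolute value, the sum of its differences with
the exchanged coefficients has its sign or is zero, so it cannot cancel the term `(n + 1)` times
that coefficient. -/
theorem eulerOp_injOn (hθ : 0 < θ) {n : ℕ} {f : MvPolynomial (Fin N) F}
    (hf : f ∈ homog F N (n + 1)) (h0 : eulerOp θ f = 0) : f = 0 := by
  by_contra hne
  obtain ⟨γ, hγ, hmax⟩ := Finset.exists_max_image f.support (fun γ => |coeff γ f|)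
    (Finset.nonempty_iff_ne_empty.mpr fun h => hne (support_eq_empty.mp h))
  have hpos : 0 < |coeff γ f| := abs_pos.mpr (mem_support_iff.mp hγ)
  have hle : ∀ δ, coeff δ f ≤ |coeff γ f| ∧ -coeff δ f ≤ |coeff γ f| := by
    intro δ
    by_cases hδ : δ ∈ f.support
    · exact ⟨(le_abs_self _).trans (hmax δ hδ), (neg_le_abs _).trans (hmax δ hδ)⟩
    · rw [notMem_support_iff.mp hδ]; simp [hpos.le]
  have hsw : ∀ i j, coeff γ (permRep F N (Equiv.swap i j) f) =
      coeff (γ.mapDomain (Equiv.swap i j)) f := by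
    intro i j
    have : γ = (γ.mapDomain (Equiv.swap i j)).mapDomain (Equiv.swap i j) := by
      rw [← Finsupp.mapDomain_comp, ← Equiv.Perm.coe_mul, Equiv.swap_mul_self, Equiv.Perm.coe_one,
        Finsupp.mapDomain_id]
    conv_lhs => rw [this]
    rw [permRep_apply, coeff_rename_mapDomain _ (Equiv.injective _)]
  rw [eulerOp_eq θ hf] at h0
  have hc : ((n + 1 : ℕ) : F) * coeff γ f + (θ / 2) * ∑ i : Fin N, ∑ j : Fin N,
      (coeff γ f - coeff (γ.mapDomain (Equiv.swap i j)) f) = 0 := by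
    have := congrArg (coeff γ) h0
    simpa only [coeff_add, coeff_smul, smul_eq_mul, coeff_sum, coeff_sub, hsw, coeff_zero]
      using this
  have hn : (0 : F) < ((n + 1 : ℕ) : F) := by positivity
  rcases le_or_gt 0 (coeff γ f) with hs | hs
  · rw [abs_of_nonneg hs] at hle hpos
    have : 0 ≤ ∑ i : Fin N, ∑ j : Fin N,
        (coeff γ f - coeff (γ.mapDomain (Equiv.swap i j)) f) :=
      Finset.sum_nonneg fun i _ => Finset.sum_nonneg fun j _ => sub_nonneg.mpr (hle _).1
    have h2 := mul_nonneg (half_pos hθ).le this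
    have h3 := mul_pos hn hpos
    linarith
  · rw [abs_of_neg hs] at hle hpos
    have : ∑ i : Fin N, ∑ j : Fin N,
        (coeff γ f - coeff (γ.mapDomain (Equiv.swap i j)) f) ≤ 0 :=
      Finset.sum_nonpos fun i _ => Finset.sum_nonpos fun j _ => by
        have := (hle (γ.mapDomain (Equiv.swap i j))).2
        linarith
    have h2 := mul_nonpos_of_nonneg_of_nonpos (half_pos hθ).le this
    have h3 := mul_neg_of_pos_of_neg hn hs
    linarith

theorem eulerOp_surjOn (hθ : 0 < θ) {n : ℕ} {f : MvPolynomial (Fin N) F}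
    (hf : f ∈ homog F N (n + 1)) : ∃ g ∈ homog F N (n + 1), eulerOp θ g = f := by
  let E : Module.End F (homog F N (n + 1)) :=
    (eulerOp θ).restrict fun g hg => eulerOp_mem_homog θ hg
  have hinj : Function.Injective E := by
    rw [injective_iff_map_eq_zero]
    intro g hg
    apply Subtype.ext
    exact eulerOp_injOn hθ g.2 (congrArg Subtype.val hg)
  obtain ⟨g, hg⟩ := LinearMap.injective_iff_surjective.mp hinj ⟨f, hf⟩
  exact ⟨g, g.2, congrArg Subtype.val hg⟩

theorem pairing_eulerOp_comm (θ : F) {n : ℕ} {f g : MvPolynomial (Fin N) F}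
    (hf : f ∈ homog F N n) (hg : g ∈ homog F N n) :
    pairing θ (eulerOp θ f) g = pairing θ f (eulerOp θ g) := by
  rw [eulerOp_eq θ hf, eulerOp_eq θ hg]
  simp only [pairing_add_left, pairing_add_right, pairing_smul_left, pairing_smul_right,
    pairing_sum_left, pairing_sum_right, pairing_sub_left, pairing_sub_right, pairing_swap]

/-- Induction on the degree. With `E = ∑ x_i D_i`, the form `⟨E f, g⟩ = ∑ ⟨D_i f, D_i g⟩` is
symmetric by induction; `E` is self-adjoint and onto in positive degree, so symmetry passes to the
pairing itself. -/
theorem pairing_comm (hθ : 0 < θ) {n : ℕ} {f g : MvPolynomial (Fin N) F}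
    (hf : f ∈ homog F N n) (hg : g ∈ homog F N n) : pairing θ f g = pairing θ g f := by
  induction n generalizing f g with
  | zero =>
    rw [eq_C_of_mem_homog_zero hf, eq_C_of_mem_homog_zero hg, C_eq_smul_one, C_eq_smul_one]
    simp only [pairing_smul_left, pairing_smul_right]
    ring
  | succ n ih =>
    have key : ∀ f ∈ homog F N (n + 1), ∀ g ∈ homog F N (n + 1),
        pairing θ (eulerOp θ f) g = pairing θ (eulerOp θ g) f := by
      intro f hf g hg
      rw [pairing_eulerOp, pairing_eulerOp]
      exact Finset.sum_congr rfl fun i _ => ih (dunkl_mem_homog θ i hf) (dunkl_mem_homog θ i hg)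
    obtain ⟨f', hf', rfl⟩ := eulerOp_surjOn hθ hf
    rw [key f' hf' g hg, pairing_eulerOp_comm θ hg hf']

/-- Write `f = E h` with `E = ∑ x_i D_i`. By induction `G(u, v) = ⟨E u, v⟩ = ∑ ⟨D_i u, D_i v⟩` is
positive semidefinite, and `G(h, h) = 0` would force all `D_i h = 0`, hence `f = 0`. Finally `⟨E h,
E h⟩ = G(h, E h)` expands by `eulerOp_eq` into a positive multiple of `G(h, h)` plus nonnegative
terms. -/
theorem pairing_self_pos (hθ : 0 < θ) {n : ℕ} {f : MvPolynomial (Fin N) F}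
    (hf : f ∈ homog F N n) (h0 : f ≠ 0) : 0 < pairing θ f f := by
  induction n generalizing f with
  | zero =>
    rw [eq_C_of_mem_homog_zero hf] at h0 ⊢
    have ha : constantCoeff f ≠ 0 := fun e => h0 (by rw [e, C_0])
    have h1 : pairing θ (1 : MvPolynomial (Fin N) F) 1 = 1 := by simp [pairing]
    rw [C_eq_smul_one, pairing_smul_left, pairing_smul_right, h1, mul_one]
    exact mul_self_pos.mpr ha
  | succ n ih =>
    let G : MvPolynomial (Fin N) F → MvPolynomial (Fin N) F → F :=
      fun f g => pairing θ (eulerOp θ f) g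
    have hnn : ∀ h ∈ homog F N n, 0 ≤ pairing θ h h := by
      intro h hh
      by_cases h0 : h = 0
      · rw [h0, pairing_zero_right]
      · exact (ih hh h0).le
    have hG : ∀ h ∈ homog F N (n + 1), 0 ≤ G h h := by
      intro h hh
      simp only [G, pairing_eulerOp]
      exact Finset.sum_nonneg fun i _ => hnn _ (dunkl_mem_homog θ i hh)
    obtain ⟨h, hh, rfl⟩ := eulerOp_surjOn hθ hf
    have hGpos : 0 < G h h := by
      refine lt_of_le_of_ne (hG h hh) fun e => h0 ?_
      simp only [G, pairing_eulerOp] at e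
      have e' := (Finset.sum_eq_zero_iff_of_nonneg
        fun i _ => hnn _ (dunkl_mem_homog θ i hh)).mp e.symm
      rw [eulerOp, LinearMap.sum_apply]
      refine Finset.sum_eq_zero fun i hi => ?_
      have hz : dunkl θ i h = 0 := by
        by_contra hz
        exact (ih (dunkl_mem_homog θ i hh) hz).ne' (e' i hi)
      rw [xD_apply, hz, mul_zero]
    have hs : ∀ i j, 0 ≤ G h (h - permRep F N (Equiv.swap i j) h) := by
      intro i j
      have hm : permRep F N (Equiv.swap i j) h ∈ homog F N (n + 1) := permRep_mem_partSpan _ hh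
      have h1 := hG _ (sub_mem hh hm)
      have hsw : ∀ g, G (permRep F N (Equiv.swap i j) h) g =
          G h (permRep F N (Equiv.swap i j) g) := by
        intro g
        have hA : eulerOp θ (permRep F N (Equiv.swap i j) h) =
            permRep F N (Equiv.swap i j) (eulerOp θ h) := by
          have := LinearMap.congr_fun (permRep_mul_hpOp θ (Equiv.swap i j) 1) h
          simpa [hpOp_eq, eulerOp] using this.symm
        simp only [G]
        rw [hA, pairing_swap]
      -- An exchange is a `G`-self-adjoint involution, so `1 - (i,j)` is twice a projection; this
      -- makes `G(h, h - (i,j) h)` nonnegative.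
      have h2 : G (h - permRep F N (Equiv.swap i j) h) (h - permRep F N (Equiv.swap i j) h) =
          2 * G h (h - permRep F N (Equiv.swap i j) h) := by
        have e1 : ∀ a b g, G (a - b) g = G a g - G b g := fun a b g => by
          simp only [G, map_sub, pairing_sub_left]
        have e2 : ∀ a b g, G g (a - b) = G g a - G g b := fun a b g => by
          simp only [G, pairing_sub_right]
        rw [e1, hsw, map_sub, permRep_swap_swap, e2, e2]
        ring
      rw [h2] at h1
      linarith
    have hfin : pairing θ (eulerOp θ h) (eulerOp θ h) = ((n + 1 : ℕ) : F) * G h h +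
        (θ / 2) * ∑ i, ∑ j, G h (h - permRep F N (Equiv.swap i j) h) := by
      have e := congrArg (G h) (eulerOp_eq θ hh)
      simp only [G] at e ⊢
      rw [e]
      simp only [pairing_add_right, pairing_smul_right, pairing_sum_right]
    rw [hfin]
    have : (0 : F) < ((n + 1 : ℕ) : F) := by positivity
    exact add_pos_of_pos_of_nonneg (mul_pos this hGpos) (mul_nonneg (half_pos hθ).le
      (Finset.sum_nonneg fun i _ => Finset.sum_nonneg fun j _ => hs i j))

/-- Both sides equal `⟨D_i f, D_i g⟩`, up to the symmetry of the pairing. -/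
theorem pairing_xD (hθ : 0 < θ) (i : Fin N) {n : ℕ} {f g : MvPolynomial (Fin N) F}
    (hf : f ∈ homog F N n) (hg : g ∈ homog F N n) :
    pairing θ (xD θ i f) g = pairing θ f (xD θ i g) := by
  have hg' := xD_mem_partSpan θ i (isDominanceLower_size n) hg
  rw [pairing_comm hθ hf hg', xD_apply, xD_apply, pairing_X_mul, pairing_X_mul]
  cases n with
  | zero =>
    rw [eq_C_of_mem_homog_zero hf, eq_C_of_mem_homog_zero hg, dunkl_C, dunkl_C,
      pairing_zero_right]
  | succ n => exact pairing_comm hθ (dunkl_mem_homog θ i hf) (dunkl_mem_homog θ i hg)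

theorem pairing_hpOp (hθ : 0 < θ) (m : ℕ) {n : ℕ} {f g : MvPolynomial (Fin N) F}
    (hf : f ∈ homog F N n) (hg : g ∈ homog F N n) :
    pairing θ (hpOp θ m f) g = pairing θ f (hpOp θ m g) := by
  have h : ∀ i (m : ℕ) (f : MvPolynomial (Fin N) F), f ∈ homog F N n →
      pairing θ ((xD θ i ^ m) f) g = pairing θ f ((xD θ i ^ m) g) := by
    intro i m
    induction m with
    | zero => simp
    | succ m ih =>
      intro f hf
      rw [pow_succ, Module.End.mul_apply, ih _ (xD_mem_partSpan θ i (isDominanceLower_size n) hf),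
        pairing_xD hθ i hf (xD_pow_mem_partSpan θ i m (isDominanceLower_size n) hg), ← pow_succ,
        ← Module.End.mul_apply, ← pow_succ']
  rw [hpOp_eq, LinearMap.sum_apply, LinearMap.sum_apply, pairing_sum_left, pairing_sum_right]
  exact Finset.sum_congr rfl fun i _ => h i m f hf

theorem aeval_mul_X_apply {K M : Type*} [Field K] [AddCommGroup M] [Module K M]
    (T : Module.End K M) (p : Polynomial K) (v : M) :
    Polynomial.aeval T (p * Polynomial.X) v = Polynomial.aeval T p (T v) := by
  rw [map_mul, Polynomial.aeval_X]; rfl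

theorem aeval_mul_X_apply' {K M : Type*} [Field K] [AddCommGroup M] [Module K M]
    (T : Module.End K M) (p : Polynomial K) (v : M) :
    Polynomial.aeval T (p * Polynomial.X) v = T (Polynomial.aeval T p v) := by
  rw [mul_comm, map_mul, Polynomial.aeval_X]; rfl

theorem aeval_hpOp_mem_homog {K : Type*} [Field K] (θ : K) (m : ℕ) (q : Polynomial K) {n : ℕ}
    {f : MvPolynomial (Fin N) K} (hf : f ∈ homog K N n) :
    Polynomial.aeval (hpOp θ m) q f ∈ homog K N n := by
  induction q using Polynomial.induction_on generalizing f with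
  | C a => simpa using Submodule.smul_mem _ a hf
  | add p q hp hq => rw [map_add, LinearMap.add_apply]; exact add_mem (hp hf) (hq hf)
  | monomial k a ih =>
    rw [pow_succ, ← mul_assoc, aeval_mul_X_apply]
    exact ih (hpOp_mem_partSpan θ m (isDominanceLower_size n) hf)

theorem pairing_aeval_hpOp (hθ : 0 < θ) (m : ℕ) (q : Polynomial F) {n : ℕ}
    {f g : MvPolynomial (Fin N) F} (hf : f ∈ homog F N n) (hg : g ∈ homog F N n) :
    pairing θ (Polynomial.aeval (hpOp θ m) q f) g =
      pairing θ f (Polynomial.aeval (hpOp θ m) q g) := by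
  induction q using Polynomial.induction_on generalizing f with
  | C a =>
    simp only [Polynomial.aeval_C, Module.algebraMap_end_apply, pairing_smul_left,
      pairing_smul_right]
  | add p q hp hq =>
    simp only [map_add, LinearMap.add_apply, pairing_add_left, pairing_add_right, hp hf, hq hf]
  | monomial k a ih =>
    rw [pow_succ, ← mul_assoc, aeval_mul_X_apply, aeval_mul_X_apply',
      ih (hpOp_mem_partSpan θ m (isDominanceLower_size n) hf),
      pairing_hpOp hθ m hf (aeval_hpOp_mem_homog θ m _ hg)]

/-- Take for `q` a squarefree polynomial of which some power is divisible by the minimal polynomial.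
Then `T = q(P_m)` is nilpotent and self-adjoint; `T² f = 0` gives `⟨T f, T f⟩ = 0`, so `T f = 0` by
positivity, and `T` itself vanishes. -/
theorem exists_squarefree_aeval_hpOp_of_ordered (hθ : 0 < θ) (m n : ℕ) :
    ∃ q : Polynomial F, Squarefree q ∧
      ∀ f ∈ homog F N n, Polynomial.aeval (hpOp θ m) q f = 0 := by
  let E : Module.End F (homog F N n) :=
    (hpOp θ m).restrict fun g hg => hpOp_mem_partSpan θ m (isDominanceLower_size n) hg
  obtain ⟨q, k, hq, -, hk⟩ :=
    exists_squarefree_dvd_pow_of_ne_zero (minpoly.ne_zero_of_finite F E)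
  refine ⟨q, hq, ?_⟩
  have hE : ∀ (r : Polynomial F) (f : homog F N n),
      ((Polynomial.aeval E r f : homog F N n) : MvPolynomial (Fin N) F) =
        Polynomial.aeval (hpOp θ m) r f := by
    intro r f
    induction r using Polynomial.induction_on generalizing f with
    | C a => simp
    | add p q hp hq => simp [hp, hq]
    | monomial k a ih =>
      rw [pow_succ, ← mul_assoc, aeval_mul_X_apply, aeval_mul_X_apply, ih]
      rfl
  set T := Polynomial.aeval (hpOp (N := N) θ m) q with hT
  have hnil : ∀ f ∈ homog F N n, (T ^ k) f = 0 := by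
    intro f hf
    have h0 : Polynomial.aeval E (q ^ k) = 0 := by
      obtain ⟨r, hr⟩ := hk
      have h1 : Polynomial.aeval E (minpoly F E) = 0 := minpoly.aeval F E
      rw [hr, map_mul, h1, zero_mul]
    have := hE (q ^ k) ⟨f, hf⟩
    rw [h0, map_pow] at this
    simpa using this.symm
  have hTm : ∀ (j : ℕ), ∀ f ∈ homog F N n, (T ^ j) f ∈ homog F N n := by
    intro j f hf
    rw [hT, ← map_pow]
    exact aeval_hpOp_mem_homog θ m _ hf
  have hker : ∀ f ∈ homog F N n, T (T f) = 0 → T f = 0 := by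
    intro f hf h
    by_contra hne
    have h1 := aeval_hpOp_mem_homog θ m q hf
    have := pairing_self_pos hθ h1 hne
    rw [pairing_aeval_hpOp hθ m q hf h1, ← hT, h, pairing_zero_right] at this
    exact lt_irrefl _ this
  intro f hf
  have hstep : ∀ j, (T ^ (j + 1)) f = 0 → T f = 0 := by
    intro j
    induction j with
    | zero => simp
    | succ j ih =>
      intro h
      apply ih
      rw [pow_succ', Module.End.mul_apply]
      apply hker _ (hTm j f hf)
      rwa [pow_succ', pow_succ', Module.End.mul_apply, Module.End.mul_apply] at h
  apply hstep k
  rw [pow_succ', Module.End.mul_apply, hnil f hf, map_zero]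

end Ordered

/-! ### Change of the base field -/

section BaseChange

variable {F K : Type*} [Field F] [Field K] {N : ℕ} (φ : F →+* K)

theorem map_divDiff₀ (i j : Fin N) (f : MvPolynomial (Fin N) F) :
    map φ (divDiff₀ i j f) = divDiff₀ i j (map φ f) := by
  by_cases h : i = j
  · subst h; simp [divDiff₀_self]
  symm
  apply divDiff₀_eq h
  have := congrArg (map φ) (X_sub_X_mul_divDiff₀ i j f)
  simpa [permRep_apply, map_rename] using this

theorem map_smul_eq (c : F) (f : MvPolynomial (Fin N) F) : map φ (c • f) = φ c • map φ f := by
  simp [smul_eq_C_mul]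

theorem map_xD (θ : F) (i : Fin N) (f : MvPolynomial (Fin N) F) :
    map φ (xD θ i f) = xD (φ θ) i (map φ f) := by
  rw [xD_apply, xD_apply, dunkl_apply, dunkl_apply, map_mul, map_add, map_X, map_smul_eq, map_sum,
    ← pderiv_map]
  simp only [map_divDiff₀]

theorem map_hpOp (θ : F) (m : ℕ) (f : MvPolynomial (Fin N) F) :
    map φ (hpOp θ m f) = hpOp (φ θ) m (map φ f) := by
  have h : ∀ i, map φ ((xD θ i ^ m) f) = (xD (φ θ) i ^ m) (map φ f) := by
    intro i
    induction m with
    | zero => simp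
    | succ m ih => rw [pow_succ', pow_succ', Module.End.mul_apply, map_xD, ih, Module.End.mul_apply]
  rw [hpOp_eq, hpOp_eq, LinearMap.sum_apply, LinearMap.sum_apply, map_sum]
  exact Finset.sum_congr rfl fun i _ => h i

theorem map_aeval_hpOp (θ : F) (m : ℕ) (q : Polynomial F) (f : MvPolynomial (Fin N) F) :
    map φ (Polynomial.aeval (hpOp θ m) q f) =
      Polynomial.aeval (hpOp (φ θ) m) (q.map φ) (map φ f) := by
  induction q using Polynomial.induction_on generalizing f with
  | C a => simp [map_smul_eq]
  | add p q hp hq => simp [hp, hq]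
  | monomial k a ih =>
    rw [pow_succ, ← mul_assoc, aeval_mul_X_apply, Polynomial.map_mul, Polynomial.map_X,
      aeval_mul_X_apply, ih, map_hpOp]

/-- Squarefreeness may be lost under field extension, but over a perfect field it is the same as
separability, which is preserved. The annihilation need only be checked on monomials, and these come
from the smaller field. -/
theorem exists_squarefree_aeval_hpOp_map [CharZero F] {θ : F} {m n : ℕ}
    (h : ∃ q : Polynomial F, Squarefree q ∧
      ∀ f ∈ homog F N n, Polynomial.aeval (hpOp θ m) q f = 0) :
    ∃ q : Polynomial K, Squarefree q ∧
      ∀ f ∈ homog K N n, Polynomial.aeval (hpOp (φ θ) m) q f = 0 := by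
  obtain ⟨q, hq, h⟩ := h
  refine ⟨q.map φ, ?_, fun f hf => ?_⟩
  · exact ((PerfectField.separable_iff_squarefree.mpr hq).map (f := φ)).squarefree
  · refine partSpan_induction
      (p := fun f => Polynomial.aeval (hpOp (φ θ) m) (q.map φ) f = 0) (fun γ hγ => ?_)
      (map_zero _) (fun f g hf hg => ?_) (fun c f hf => ?_) hf
    · have := h _ (monomial_mem_partSpan hγ 1)
      have e : (monomial γ 1 : MvPolynomial (Fin N) K) = map φ (monomial γ 1) := by simp
      rw [e, ← map_aeval_hpOp, this, map_zero]
    · rw [map_add, hf, hg, add_zero]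
    · rw [map_smul, hf, smul_zero]

theorem exists_squarefree_aeval_hpOp {K : Type*} [Field K] [Algebra ℂ K] {θ : K}
    (hθ : (∃ t : ℝ, 0 < t ∧ θ = algebraMap ℂ K (t : ℂ)) ∨ Transcendental ℂ θ) (m n : ℕ) :
    ∃ q : Polynomial K, Squarefree q ∧
      ∀ f ∈ homog K N n, Polynomial.aeval (hpOp θ m) q f = 0 := by
  rcases hθ with ⟨t, ht, rfl⟩ | hθ
  · exact exists_squarefree_aeval_hpOp_map ((algebraMap ℂ K).comp Complex.ofRealHom)
      (exists_squarefree_aeval_hpOp_of_ordered ht m n)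
  · have : CharZero K := charZero_of_injective_algebraMap (algebraMap ℂ K).injective
    -- A positive transcendental real number. Since `θ` is transcendental too, `ℚ(X)` embeds into
    -- both `ℝ` and `K`; the order pulled back from `ℝ` makes `X` positive, and the second embedding
    -- carries the result to `θ`.
    let t : ℝ := liouvilleNumber (2 : ℕ)
    have ht : 0 < t := by
      have h2 : (1 : ℝ) < (2 : ℕ) := by norm_num
      simp only [t]
      rw [← LiouvilleNumber.partialSum_add_remainder h2 0]
      refine add_pos_of_nonneg_of_pos ?_ (LiouvilleNumber.remainder_pos h2 0)
      exact Finset.sum_nonneg fun _ _ => by positivity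
    have htr : Function.Injective (Polynomial.aeval t : Polynomial ℚ →ₐ[ℚ] ℝ) := by
      refine transcendental_iff_injective.mp fun h => transcendental_liouvilleNumber le_rfl ?_
      exact (IsFractionRing.isAlgebraic_iff ℤ ℚ ℝ).mpr h
    have hθr : Function.Injective (Polynomial.aeval θ : Polynomial ℚ →ₐ[ℚ] K) :=
      transcendental_iff_injective.mp (hθ.restrictScalars (algebraMap ℚ ℂ).injective)
    let a : FractionRing (Polynomial ℚ) →+* ℝ :=
      IsFractionRing.lift (g := (Polynomial.aeval t : Polynomial ℚ →ₐ[ℚ] ℝ).toRingHom) htr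
    let b : FractionRing (Polynomial ℚ) →+* K :=
      IsFractionRing.lift (g := (Polynomial.aeval θ : Polynomial ℚ →ₐ[ℚ] K).toRingHom) hθr
    let x : FractionRing (Polynomial ℚ) := algebraMap (Polynomial ℚ) _ Polynomial.X
    have ha : a x = t := by simp [a, x, IsFractionRing.lift_algebraMap]
    have hb : b x = θ := by simp [b, x, IsFractionRing.lift_algebraMap]
    let _ : LinearOrder (FractionRing (Polynomial ℚ)) := LinearOrder.lift' a a.injective
    have _ : IsStrictOrderedRing (FractionRing (Polynomial ℚ)) :=
      Function.Injective.isStrictOrderedRing a (map_zero a) (map_one a) (map_add a) (map_mul a)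
        Iff.rfl Iff.rfl
    have hx : 0 < x := by
      show a 0 < a x
      rwa [map_zero, ha]
    rw [← hb]
    exact exists_squarefree_aeval_hpOp_map b (exists_squarefree_aeval_hpOp_of_ordered hx m n)

end BaseChange

end HeckmanPolychronakos

namespace HeckmanPolychronakos

open MvPolynomial Finset

/-! ### Representations of finite groups -/

section Representations

open Representation

/-- By Maschke's theorem a subrepresentation is the sum of the irreducible ones that it contains. No
finiteness of dimension is needed, which allows working inside the whole polynomial ring. -/
theorem subrepresentation_le_of_atoms {k G W : Type*} [Field k] [Group G] [Finite G]
    [NeZero (Nat.card G : k)] [AddCommGroup W] [Module k W] {ρ : Representation k G W}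
    (U : Subrepresentation ρ) (T : Submodule k W)
    (h : ∀ A : Subrepresentation ρ, IsAtom A → A ≤ U → A.toSubmodule ≤ T) :
    U.toSubmodule ≤ T := by
  let e := Subrepresentation.subrepresentationSubmoduleOrderIso (ρ := ρ)
  have : IsSemisimpleModule (MonoidAlgebra k G) ρ.asModule :=
    (isSemisimpleRepresentation_iff_isSemisimpleModule_asModule ρ).mp inferInstance
  intro x hx
  have hx' : (x : ρ.asModule) ∈ sSup {a | IsAtom a ∧ a ≤ e U} := by
    rw [sSup_atoms_le_eq]; exact hx
  rw [sSup_eq_iSup'] at hx'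
  refine Submodule.iSup_induction _ (motive := fun y : ρ.asModule => (y : W) ∈ T) hx' ?_ ?_ ?_
  · rintro ⟨a, ha, haU⟩ y hy
    refine h (e.symm a) ((OrderIso.isAtom_iff e.symm a).mpr ha) ?_ hy
    have := e.symm.monotone haU
    rwa [OrderIso.symm_apply_apply] at this
  · exact T.zero_mem
  · exact fun a b ha hb => T.add_mem ha hb

theorem isIrreducible_of_atom {k G V W : Type*} [Field k] [Group G] [AddCommGroup V] [Module k V]
    [AddCommGroup W] [Module k W] {ρ : Representation k G V} {σ : Representation k G W}
    (φ : IntertwiningMap ρ σ) (hφ : Function.Injective φ) {A : Subrepresentation σ}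
    (hA : IsAtom A) (hr : LinearMap.range φ.toLinearMap = A.toSubmodule) : ρ.IsIrreducible := by
  have hinj : Function.Injective φ.toLinearMap := hφ
  have key : ∀ S : Subrepresentation ρ, S = ⊥ ∨ S = ⊤ := by
    intro S
    let S' : Subrepresentation σ :=
      { toSubmodule := S.toSubmodule.map φ.toLinearMap
        apply_mem_toSubmodule := by
          rintro g _ ⟨v, hv, rfl⟩
          exact ⟨ρ g v, S.apply_mem_toSubmodule g hv, IntertwiningMap.isIntertwining _ _ φ g v⟩ }
    have hle : S' ≤ A := by
      rintro _ ⟨v, hv, rfl⟩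
      change _ ∈ A.toSubmodule
      rw [← hr]
      exact ⟨v, rfl⟩
    rcases hA.le_iff.mp hle with h | h
    · left
      apply Subrepresentation.toSubmodule_injective
      have h1 : S.toSubmodule.map φ.toLinearMap = ⊥ := congrArg Subrepresentation.toSubmodule h
      exact Submodule.map_injective_of_injective hinj (h1.trans (Submodule.map_bot _).symm)
    · right
      apply Subrepresentation.toSubmodule_injective
      have h1 : S.toSubmodule.map φ.toLinearMap = A.toSubmodule :=
        congrArg Subrepresentation.toSubmodule h
      rw [← hr, LinearMap.range_eq_map] at h1
      exact Submodule.map_injective_of_injective hinj h1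
  have hne : (⊥ : Subrepresentation ρ) ≠ ⊤ := by
    intro h
    apply hA.1
    apply Subrepresentation.toSubmodule_injective
    rw [← hr, LinearMap.range_eq_map]
    have h1 : (⊥ : Submodule k V) = ⊤ := congrArg Subrepresentation.toSubmodule h
    rw [← h1, Submodule.map_bot]
    rfl
  have : Nontrivial (Subrepresentation ρ) := ⟨⟨_, _, hne⟩⟩
  exact { eq_bot_or_eq_top := key }

/-- Weighting the group elements by a class function gives an intertwining endomorphism, which is a
scalar by Schur's lemma. -/
theorem exists_sum_class_function_smul {k G V : Type*} [Field k] [IsAlgClosed k] [Group G]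
    [Fintype G] [AddCommGroup V] [Module k V] [FiniteDimensional k V] (ρ : Representation k G V)
    [ρ.IsIrreducible] (c : G → k) (hc : ∀ g h, c (h * g * h⁻¹) = c g) :
    ∃ a : k, ∑ g, c g • ρ g = a • LinearMap.id := by
  let φ : IntertwiningMap ρ ρ :=
    { toLinearMap := ∑ g, c g • ρ g
      isIntertwining' := by
        intro h
        change (∑ g, c g • ρ g) * ρ h = ρ h * ∑ g, c g • ρ g
        rw [Finset.sum_mul, Finset.mul_sum, ← Equiv.sum_comp (MulAut.conj h).toEquiv]
        refine Finset.sum_congr rfl fun g _ => ?_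
        simp only [MulEquiv.toEquiv_eq_coe, MulEquiv.coe_toEquiv, MulAut.conj_apply]
        rw [hc, smul_mul_assoc, mul_smul_comm, ← map_mul, ← map_mul, inv_mul_cancel_right] }
  obtain ⟨a, ha⟩ := (IsIrreducible.algebraMap_intertwiningMap_bijective_of_isAlgClosed
    (ρ := ρ)).2 φ
  refine ⟨a, ?_⟩
  have := congrArg (fun f : IntertwiningMap ρ ρ => f.toLinearMap) ha
  exact this.symm

end Representations

/-! ### Isotypical components and their projections -/

section Isotypic

open Representation

variable {K : Type*} [Field K] {N : ℕ}

instance (τ : Irr K N) : τ.rep.IsIrreducible := (Quotient.out τ).2.2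

theorem Irr.eq_iff (σ τ : Irr K N) : σ = τ ↔ Nonempty (Representation.Equiv σ.rep τ.rep) :=
  (Quotient.out_equiv_out (s := irrSetoid K N)).symm

/-- Together with `Irr.chi_inv`, which holds because a permutation and its inverse have the same
cycle type, this makes `g ↦ χ^τ(g⁻¹)` a class function equal to `χ^τ`. -/
theorem Irr.chi_conj (τ : Irr K N) (g h : Equiv.Perm (Fin N)) :
    τ.chi (h * g * h⁻¹) = τ.chi g := char_conj _ g h

theorem Irr.chi_inv (τ : Irr K N) (g : Equiv.Perm (Fin N)) : τ.chi g⁻¹ = τ.chi g := by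
  have h : IsConj g g⁻¹ := by
    rw [Equiv.Perm.isConj_iff_cycleType_eq, Equiv.Perm.cycleType_inv]
  obtain ⟨c, hc⟩ := isConj_iff.mp h
  rw [← hc, Irr.chi_conj]

theorem Irr.dim_ne_zero [CharZero K] (τ : Irr K N) : (τ.dim : K) ≠ 0 := by
  rw [Nat.cast_ne_zero]
  intro h
  have hs : Subsingleton (Fin τ.dim → K) := by
    have : IsEmpty (Fin τ.dim) := by rw [h]; infer_instance
    infer_instance
  have hss : Subsingleton (Subrepresentation τ.rep) :=
    ⟨fun a b => Subrepresentation.toSubmodule_injective (Subsingleton.elim _ _)⟩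
  exact not_subsingleton _ hss

/-- The projection to the `τ`-isotypical component. -/
noncomputable def isoProj (τ : Irr K N) : Module.End K (MvPolynomial (Fin N) K) :=
  ((τ.dim : K) / (N.factorial : K)) • ∑ g : Equiv.Perm (Fin N), τ.chi g⁻¹ • permRep K N g

theorem isotypic_le (l : Part N) (τ : Irr K N) : isotypic l τ ≤ partSpan K {l} :=
  sSup_le fun _ hW => hW.1.trans (V_eq_partSpan l).le

instance finite_isotypic (l : Part N) (τ : Irr K N) : Module.Finite K (isotypic l τ) :=
  Submodule.finiteDimensional_of_le (isotypic_le l τ)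

/-- A basis moves the irreducible subrepresentation to some `K^d`, where its class is an element of
`Irr K N`. -/
theorem atom_le_isotypic {l : Part N} {A : Subrepresentation (permRep K N)} (hA : IsAtom A)
    (hl : A.toSubmodule ≤ partSpan K {l}) : ∃ τ : Irr K N, A.toSubmodule ≤ isotypic l τ := by
  have : Module.Finite K A.toSubmodule := Submodule.finiteDimensional_of_le hl
  let e : A.toSubmodule ≃ₗ[K] (Fin (Module.finrank K A.toSubmodule) → K) :=
    (Module.finBasis K A.toSubmodule).equivFun
  let ρ : Representation K (Equiv.Perm (Fin N)) (Fin (Module.finrank K A.toSubmodule) → K) :=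
    { toFun := fun g => e.conj (A.toRepresentation g)
      map_one' := by rw [map_one]; exact e.conj_id
      map_mul' := fun g h => by rw [map_mul]; exact e.conj_comp _ _ }
  let φ : IntertwiningMap ρ (permRep K N) :=
    { toLinearMap := A.toSubmodule.subtype ∘ₗ e.symm.toLinearMap
      isIntertwining' := by
        intro g
        refine LinearMap.ext fun v => ?_
        simp [ρ, LinearEquiv.conj_apply]
        rfl }
  have hφ : Function.Injective φ := Subtype.val_injective.comp e.symm.injective
  have hr : LinearMap.range φ.toLinearMap = A.toSubmodule := by
    change LinearMap.range (A.toSubmodule.subtype ∘ₗ e.symm.toLinearMap) = _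
    rw [LinearMap.range_comp, LinearEquiv.range, Submodule.map_top, Submodule.range_subtype]
  have hirr : ρ.IsIrreducible := isIrreducible_of_atom φ hφ hA hr
  let x : Σ d : ℕ, {ρ : Representation K (Equiv.Perm (Fin N)) (Fin d → K) // ρ.IsIrreducible} :=
    ⟨_, ρ, hirr⟩
  let τ : Irr K N := Quotient.mk (irrSetoid K N) x
  obtain ⟨ψ⟩ : Nonempty (Representation.Equiv τ.rep ρ) :=
    Quotient.exact (s := irrSetoid K N) (Quotient.out_eq τ)
  refine ⟨τ, le_sSup ⟨hl.trans (V_eq_partSpan l).ge, φ.comp ψ.toIntertwiningMap, ?_, ?_⟩⟩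
  · exact hφ.comp ψ.toLinearEquiv.injective
  · change LinearMap.range (φ.toLinearMap ∘ₗ ψ.toLinearEquiv.toLinearMap) = _
    rw [LinearMap.range_comp, LinearEquiv.range, Submodule.map_top, hr]

theorem commute_isoProj {T : Module.End K (MvPolynomial (Fin N) K)}
    (hT : ∀ g, permRep K N g * T = T * permRep K N g) (τ : Irr K N) :
    isoProj τ * T = T * isoProj τ := by
  rw [isoProj, smul_mul_assoc, mul_smul_comm, Finset.sum_mul, Finset.mul_sum]
  congr 1
  exact Finset.sum_congr rfl fun g _ => by rw [smul_mul_assoc, mul_smul_comm, hT]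

theorem isoProj_lead (τ : Irr K N) (l : Part N) (f : MvPolynomial (Fin N) K) :
    isoProj τ (lead K l f) = lead K l (isoProj τ f) :=
  LinearMap.congr_fun (commute_isoProj (T := lead K l)
    (fun g => LinearMap.ext fun f => permRep_lead l g f) τ) f

theorem isoProj_hpOp (τ : Irr K N) (θ : K) (m : ℕ) (f : MvPolynomial (Fin N) K) :
    isoProj τ (hpOp θ m f) = hpOp θ m (isoProj τ f) :=
  LinearMap.congr_fun (commute_isoProj (fun g => permRep_mul_hpOp θ g m) τ) f

theorem iSup_isotypic [CharZero K] (l : Part N) : ⨆ τ : Irr K N, isotypic l τ = partSpan K {l} := by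
  apply le_antisymm (iSup_le fun τ => isotypic_le l τ)
  have : NeZero (Nat.card (Equiv.Perm (Fin N)) : K) := ⟨by
    rw [Nat.card_eq_fintype_card, Nat.cast_ne_zero]; exact Fintype.card_ne_zero⟩
  let U : Subrepresentation (permRep K N) :=
    ⟨partSpan K {l}, fun g _ hv => permRep_mem_partSpan g hv⟩
  refine subrepresentation_le_of_atoms U _ fun A hA hAU => ?_
  obtain ⟨τ, hτ⟩ := atom_le_isotypic hA hAU
  exact hτ.trans (le_iSup (fun τ : Irr K N => isotypic l τ) τ)

variable [CharZero K] [IsAlgClosed K]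

open Classical in
-- By Schur's lemma the averaging operator acts on a copy of `σ` by a scalar; taking the trace and
-- using orthonormality of characters gives its value.
theorem isoProj_intertwiningMap (τ σ : Irr K N) (φ : IntertwiningMap σ.rep (permRep K N))
    (v : Fin σ.dim → K) : isoProj τ (φ v) = if σ = τ then φ v else 0 := by
  have hcard : (Nat.card (Equiv.Perm (Fin N)) : K) = N.factorial := by
    rw [Nat.card_eq_fintype_card, Fintype.card_perm, Fintype.card_fin]
  have hN : (N.factorial : K) ≠ 0 := Nat.cast_ne_zero.mpr (Nat.factorial_ne_zero N)
  let _ : Invertible (Nat.card (Equiv.Perm (Fin N)) : K) :=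
    invertibleOfNonzero (by rw [hcard]; exact hN)
  obtain ⟨a, ha⟩ := exists_sum_class_function_smul σ.rep (fun g => τ.chi g⁻¹) (fun g h => by
    rw [Irr.chi_inv, Irr.chi_inv, Irr.chi_conj])
  have htr : a * σ.dim = if σ = τ then (N.factorial : K) else 0 := by
    have h1 := congrArg (LinearMap.trace K _) ha
    rw [map_sum, map_smul, LinearMap.trace_id, Module.finrank_fin_fun, smul_eq_mul] at h1
    rw [← h1]
    have h2 := char_orthonormal σ.rep τ.rep
    rw [hcard, inv_mul_eq_iff_eq_mul₀ hN] at h2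
    have h3 : ∑ g, LinearMap.trace K (Fin σ.dim → K) (τ.chi g⁻¹ • σ.rep g) =
        ∑ g, σ.rep.character g * τ.rep.character g⁻¹ := by
      refine Finset.sum_congr rfl fun g _ => ?_
      rw [map_smul, smul_eq_mul, mul_comm]
      rfl
    rw [h3, h2, ← Irr.eq_iff]
    by_cases h : σ = τ
    · simp [h]
    · simp [h, Ne.symm h]
  have hφ : isoProj τ (φ v) = ((τ.dim : K) / (N.factorial : K)) • a • φ v := by
    rw [isoProj, LinearMap.smul_apply, ← map_smul φ a]
    congr 1
    have := LinearMap.congr_fun ha v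
    simp only [LinearMap.sum_apply, LinearMap.smul_apply, LinearMap.id_apply] at this ⊢
    rw [← this, map_sum]
    refine Finset.sum_congr rfl fun g _ => ?_
    rw [map_smul, φ.isIntertwining]
  rw [hφ, smul_smul]
  by_cases h : σ = τ
  · subst h
    rw [if_pos rfl] at htr ⊢
    rw [div_mul_eq_mul_div, mul_comm, htr, div_self hN, one_smul]
  · rw [if_neg h] at htr ⊢
    rw [(mul_eq_zero.mp htr).resolve_right σ.dim_ne_zero, mul_zero, zero_smul]

open Classical in
theorem isoProj_of_mem (τ σ : Irr K N) {l : Part N} {f : MvPolynomial (Fin N) K}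
    (hf : f ∈ isotypic l σ) : isoProj τ f = if σ = τ then f else 0 := by
  rw [isotypic, sSup_eq_iSup'] at hf
  refine Submodule.iSup_induction _
    (motive := fun f => isoProj τ f = if σ = τ then f else 0) hf ?_ ?_ ?_
  · rintro ⟨W, -, φ, -, rfl⟩ _ ⟨v, rfl⟩
    exact isoProj_intertwiningMap τ σ φ v
  · simp
  · intro f g hf hg
    rw [map_add, hf, hg]
    split_ifs <;> simp

theorem isoProj_of_mem_self {τ : Irr K N} {l : Part N} {f : MvPolynomial (Fin N) K}
    (hf : f ∈ isotypic l τ) : isoProj τ f = f := by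
  classical
  rw [isoProj_of_mem τ τ hf, if_pos rfl]

theorem isoProj_of_mem_ne {τ σ : Irr K N} (h : σ ≠ τ) {l : Part N} {f : MvPolynomial (Fin N) K}
    (hf : f ∈ isotypic l σ) : isoProj τ f = 0 := by
  classical
  rw [isoProj_of_mem τ σ hf, if_neg h]

theorem isoProj_mem {l : Part N} (τ : Irr K N) {f : MvPolynomial (Fin N) K}
    (hf : f ∈ partSpan K {l}) : isoProj τ f ∈ isotypic l τ := by
  classical
  rw [← iSup_isotypic] at hf
  refine Submodule.iSup_induction _ (motive := fun f => isoProj τ f ∈ isotypic l τ) hf ?_ ?_ ?_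
  · intro σ f hf
    rw [isoProj_of_mem τ σ hf]
    split_ifs with h
    · exact h ▸ hf
    · exact zero_mem _
  · simp
  · intro f g hf hg
    rw [map_add]; exact add_mem hf hg

/-- In this form, preservation of `V_{λ;τ}` by an operator on `V_λ` follows from its commuting with
the projection. -/
theorem mem_isotypic_iff {l : Part N} {τ : Irr K N} {f : MvPolynomial (Fin N) K} :
    f ∈ isotypic l τ ↔ f ∈ partSpan K {l} ∧ isoProj τ f = f :=
  ⟨fun h => ⟨isotypic_le l τ h, isoProj_of_mem_self h⟩, fun h => h.2 ▸ isoProj_mem τ h.1⟩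

end Isotypic

end HeckmanPolychronakos

namespace HeckmanPolychronakos

open MvPolynomial Finset

/-! ### Existence of eigensystems -/

section Existence

variable {K : Type*} [Field K] {N : ℕ} {θ : K}

theorem dominated_subset_size (l : Part N) :
    {μ : Part N | Dominated μ l} ⊆ {μ | ∑ i, μ.1 i = ∑ i, l.1 i} := fun _ h => h.1

theorem exists_basis_of_span {M : Type*} [AddCommGroup M] [Module K M]
    [Module.Finite K M] {s : Set M} (hs : ⊤ ≤ Submodule.span K s) :
    ∃ b : Module.Basis (Fin (Module.finrank K M)) K M, ∀ i, b i ∈ s := by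
  let b := Module.Basis.ofSpan hs
  have : Finite ((linearIndepOn_empty K id).extend (Set.empty_subset s)) :=
    Module.Finite.finite_basis b
  let _ := Fintype.ofFinite ((linearIndepOn_empty K id).extend (Set.empty_subset s))
  let e := Fintype.equivFinOfCardEq (Module.finrank_eq_card_basis b).symm
  refine ⟨b.reindex e, fun i => ?_⟩
  rw [Module.Basis.reindex_apply]
  exact Module.Basis.ofSpan_subset hs ⟨_, rfl⟩

theorem aeval_restrict_apply {M : Type*} [AddCommGroup M] [Module K M] (T : Module.End K M)
    (U : Submodule K M) (hU : ∀ v ∈ U, T v ∈ U) (q : Polynomial K) (v : U) :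
    ((Polynomial.aeval (T.restrict hU) q v : U) : M) = Polynomial.aeval T q v := by
  induction q using Polynomial.induction_on generalizing v with
  | C a => simp
  | add p q hp hq => simp [hp, hq]
  | monomial k a ih =>
    rw [pow_succ, ← mul_assoc, aeval_mul_X_apply, aeval_mul_X_apply, ih]
    rfl

theorem sum_Iic_lt_of_mem_below {μ l : Part N} (h : μ ∈ below l) :
    ∑ k, ∑ i ∈ Iic k, μ.1 i < ∑ k, ∑ i ∈ Iic k, l.1 i := by
  refine lt_of_le_of_ne (Finset.sum_le_sum fun k _ => h.1.2 k) fun e => h.2 ?_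
  have e' := (Finset.sum_eq_sum_iff_of_le fun k _ => h.1.2 k).mp e
  exact h.1.antisymm ⟨h.1.1.symm, fun k => (e' k (Finset.mem_univ k)).ge⟩

/-- Induction along dominance, made well-founded by `∑ k, ∑ i ∈ Iic k, l i`, which strictly
decreases below `l`. -/
theorem partSpan_le_of_lead (T : Submodule K (MvPolynomial (Fin N) K))
    (hT : ∀ l : Part N, ∀ v ∈ partSpan K {l},
      partSpan K (below l) ≤ T → v ∈ T) : T = ⊤ := by
  have key : ∀ (n : ℕ) (l : Part N), ∑ k, ∑ i ∈ Iic k, l.1 i = n → partSpan K {l} ≤ T := by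
    intro n
    induction n using Nat.strong_induction_on with
    | _ n ih =>
      intro l hl v hv
      refine hT l v hv fun f hf => ?_
      refine partSpan_induction (p := fun f => f ∈ T) (fun γ hγ => ?_) T.zero_mem
        (fun f g hf hg => T.add_mem hf hg) (fun c f hf => T.smul_mem c hf) hf
      exact ih _ (hl ▸ sum_Iic_lt_of_mem_below hγ) (plus γ) rfl
        (monomial_mem_partSpan (Set.mem_singleton _) 1)
  rw [eq_top_iff, ← partSpan_univ]
  intro f hf
  refine partSpan_induction (p := fun f => f ∈ T) (fun γ hγ => ?_) T.zero_mem
    (fun f g hf hg => T.add_mem hf hg) (fun c f hf => T.smul_mem c hf) hf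
  exact key _ (plus γ) rfl (monomial_mem_partSpan (Set.mem_singleton _) 1)

variable [IsAlgClosed K] [CharZero K]

/-- Semisimplicity of all the `P_m` on the spaces of homogeneous polynomials. -/
def IsHomogSemisimple (N : ℕ) (θ : K) : Prop :=
  ∀ m n : ℕ, ∃ q : Polynomial K, Squarefree q ∧
    ∀ f ∈ homog K N n, Polynomial.aeval (hpOp θ m) q f = 0

/-- The joint eigenvectors in `U` of all the `P_m`. -/
def jointEigen (θ : K) (U : Submodule K (MvPolynomial (Fin N) K)) : Set U :=
  {u | ∃ χ : ℕ → K, ∀ m, hpOp θ m u = χ m • (u : MvPolynomial (Fin N) K)}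

/-- Commuting operators on a finite-dimensional space over an algebraically closed field have a
joint decomposition into generalized eigenspaces; semisimplicity makes these ordinary eigenspaces.
-/
theorem span_jointEigen (hss : IsHomogSemisimple N θ) {n : ℕ}
    (U : Submodule K (MvPolynomial (Fin N) K)) (hn : U ≤ homog K N n)
    (hU : ∀ m, ∀ f ∈ U, hpOp θ m f ∈ U) : Submodule.span K (jointEigen θ U) = ⊤ := by
  have : Module.Finite K U := Submodule.finiteDimensional_of_le hn
  let E : ℕ → Module.End K U := fun m => (hpOp θ m).restrict (hU m)
  have hE : ∀ m, (E m).IsSemisimple := by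
    intro m
    obtain ⟨q, hq, h⟩ := hss m n
    refine Module.End.isSemisimple_of_squarefree_aeval_eq_zero hq (LinearMap.ext fun v => ?_)
    apply Subtype.ext
    rw [aeval_restrict_apply, h _ (hn v.2)]
    rfl
  have hcomm : Pairwise fun i j => Commute (E i) (E j) := by
    intro i j _
    refine LinearMap.ext fun v => Subtype.ext ?_
    exact LinearMap.congr_fun (hpOp_commute θ i j).eq v.1
  have htop := Module.End.iSup_iInf_maxGenEigenspace_eq_top_of_iSup_maxGenEigenspace_eq_top_of_commute
    E hcomm fun m => Module.End.iSup_maxGenEigenspace_eq_top (E m)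
  rw [eq_top_iff, ← htop]
  refine iSup_le fun χ v hv => Submodule.subset_span ⟨χ, fun m => ?_⟩
  have hm := (Submodule.mem_iInf _).mp hv m
  rw [(Module.End.isFinitelySemisimple_iff_isSemisimple.mpr
    (hE m)).maxGenEigenspace_eq_eigenspace, Module.End.mem_eigenspace_iff] at hm
  exact congrArg Subtype.val hm

/-- Consider the polynomials dominated by `l` whose leading part lies in `V_{l;τ}`. The `P_m`
preserve them, so joint eigenvectors span; taking leading parts maps them onto `V_{l;τ}`, and a
basis can be extracted from the images of the eigenvectors. -/
theorem exists_eigenfunctions (hss : IsHomogSemisimple N θ) (l : Part N) (τ : Irr K N) :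
    ∃ (F : Fin (Module.finrank K (isotypic l τ)) → MvPolynomial (Fin N) K)
      (b : Module.Basis (Fin (Module.finrank K (isotypic l τ))) K (isotypic l τ))
      (χ : Fin (Module.finrank K (isotypic l τ)) → ℕ → K),
      ∀ i, F i ∈ partSpan K {μ | Dominated μ l} ∧ lead K l (F i) = b i ∧
        ∀ m, hpOp θ m (F i) = χ i m • F i := by
  let U : Submodule K (MvPolynomial (Fin N) K) :=
    partSpan K {μ | Dominated μ l} ⊓ (isotypic l τ).comap (lead K l)
  have hUle : U ≤ partSpan K {μ | Dominated μ l} := inf_le_left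
  have hU : ∀ m, ∀ f ∈ U, hpOp θ m f ∈ U := by
    rintro m f ⟨hf, hf'⟩
    refine ⟨hpOp_mem_partSpan θ m (isDominanceLower_dominated l) hf, ?_⟩
    rw [SetLike.mem_coe, Submodule.mem_comap] at hf' ⊢
    rw [lead_hpOp θ l m hf, mem_isotypic_iff, isoProj_lead, isoProj_hpOp,
      isoProj_of_mem_self hf']
    exact ⟨lead_mem l _, rfl⟩
  have hspan := span_jointEigen hss U (hUle.trans (partSpan_mono (dominated_subset_size l))) hU
  let L : U →ₗ[K] isotypic l τ := ((lead K l).comp U.subtype).codRestrict _ fun u => u.2.2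
  have hL : Function.Surjective L := by
    rintro ⟨v, hv⟩
    have hl := lead_of_mem (isotypic_le l τ hv)
    refine ⟨⟨v, partSpan_singleton_le l (isotypic_le l τ hv), ?_⟩, Subtype.ext hl⟩
    rw [SetLike.mem_coe, Submodule.mem_comap, hl]
    exact hv
  have hspan' : ⊤ ≤ Submodule.span K (L '' jointEigen θ U) := by
    rw [Submodule.span_image, hspan, Submodule.map_top, LinearMap.range_eq_top.mpr hL]
  obtain ⟨b, hb⟩ := exists_basis_of_span hspan'
  choose u hu hub using hb
  choose χ hχ using hu
  refine ⟨fun i => u i, b, χ, fun i => ⟨hUle (u i).2, ?_, hχ i⟩⟩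
  rw [← hub]
  rfl

theorem exists_isEigenSystem (hss : IsHomogSemisimple N θ) :
    ∃ F eig, IsEigenSystem (N := N) θ F eig := by
  choose F b χ h using exists_eigenfunctions (N := N) hss
  refine ⟨F, fun m l τ i => χ l τ i m, ?_, fun m _ l τ i => (h l τ i).2.2 m, ?_, ?_, ?_, ?_⟩
  · intro l τ i h0
    have h1 := (h l τ i).2.1
    rw [h0, map_zero] at h1
    exact (b l τ).ne_zero i (Subtype.ext h1.symm)
  · exact fun l τ i => (mem_partSpan_size_iff _ _).mp
      (partSpan_mono (dominated_subset_size l) (h l τ i).1)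
  · exact fun l τ i => mem_partSpan.mp (h l τ i).1
  · intro l τ i
    rw [← lead_apply, (h l τ i).2.1]
    exact (b l τ i).2
  · apply partSpan_le_of_lead
    intro l v hv hbelow
    rw [← iSup_isotypic] at hv
    refine (iSup_le fun τ => ?_ : ⨆ τ : Irr K N, isotypic l τ ≤ _) hv
    have hb : ∀ i, ((b l τ i : isotypic l τ) : MvPolynomial (Fin N) K) ∈
        Submodule.span K {f | ∃ l τ i, f = F l τ i} := by
      intro i
      rw [← (h l τ i).2.1, ← sub_sub_cancel (F l τ i) (lead K l (F l τ i))]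
      exact sub_mem (Submodule.subset_span ⟨l, τ, i, rfl⟩)
        (hbelow (sub_lead_mem_below (h l τ i).1))
    intro w hw
    have hsum := congrArg Subtype.val ((b l τ).sum_repr ⟨w, hw⟩)
    simp only [AddSubmonoidClass.coe_finsetSum, Submodule.coe_smul] at hsum
    rw [← hsum]
    exact Submodule.sum_mem _ fun i _ => Submodule.smul_mem _ _ (hb i)

end Existence

/-! ### Leading parts of an eigensystem -/

section Leading

variable {K : Type*} [Field K] {N : ℕ} {θ : K}

theorem partSpan_le_iSup_isotypic [CharZero K] (S : Set (Part N)) :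
    partSpan K S ≤ ⨆ l : S, ⨆ τ : Irr K N, isotypic l.1 τ := by
  intro f hf
  refine partSpan_induction
    (p := fun f => f ∈ ⨆ l : S, ⨆ τ : Irr K N, isotypic l.1 τ) (fun γ hγ => ?_) (zero_mem _)
    (fun f g hf hg => add_mem hf hg) (fun c f hf => Submodule.smul_mem _ c hf) hf
  refine le_iSup (fun l : S => ⨆ τ : Irr K N, isotypic l.1 τ) ⟨plus γ, hγ⟩ ?_
  rw [iSup_isotypic]
  exact monomial_mem_partSpan (Set.mem_singleton _) 1

variable {F : (l : Part N) → (τ : Irr K N) → Fin (Module.finrank K (isotypic l τ)) →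
      MvPolynomial (Fin N) K}
    {eig : ℕ → (l : Part N) → (τ : Irr K N) → Fin (Module.finrank K (isotypic l τ)) → K}

theorem IsEigenSystem.mem_dominated (h : IsEigenSystem θ F eig) (l : Part N) (τ : Irr K N)
    (i : Fin (Module.finrank K (isotypic l τ))) : F l τ i ∈ partSpan K {μ | Dominated μ l} :=
  mem_partSpan.mpr (h.dominated l τ i)

/-- Taking homogeneous components makes `T` onto in each degree, hence injective there by finite
dimension. It is then injective on the smaller invariant space spanned by `S`, hence onto it. -/
theorem surjOn_of_surjOn_homog {T : Module.End K (MvPolynomial (Fin N) K)}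
    {S : Set (Part N)} {n : ℕ} (hS : ∀ μ ∈ S, ∑ i, μ.1 i = n)
    (hT : ∀ n, ∀ f ∈ homog K N n, T f ∈ homog K N n) (hsurj : Function.Surjective T)
    (hTS : ∀ f ∈ partSpan K S, T f ∈ partSpan K S) :
    ∀ f ∈ partSpan K S, ∃ g ∈ partSpan K S, T g = f := by
  have hcomp : ∀ f, T (homogeneousComponent n f) = homogeneousComponent n (T f) := by
    intro f
    have h1 : ∀ k, T (homogeneousComponent n (homogeneousComponent k f)) =
        homogeneousComponent n (T (homogeneousComponent k f)) := by
      intro k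
      have h2 := homogeneousComponent_isHomogeneous k f
      have h3 := mem_homog.mp (hT k _ (mem_homog.mpr h2))
      rw [homogeneousComponent_of_mem ((mem_homogeneousSubmodule _ _).mpr h2),
        homogeneousComponent_of_mem ((mem_homogeneousSubmodule _ _).mpr h3)]
      split_ifs <;> simp
    conv_lhs => rw [← sum_homogeneousComponent f]
    conv_rhs => rw [← sum_homogeneousComponent f]
    simp only [map_sum, h1]
  let E : Module.End K (homog K N n) := T.restrict (hT n)
  have hE : Function.Surjective E := by
    rintro ⟨f, hf⟩
    obtain ⟨g, hg⟩ := hsurj f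
    refine ⟨⟨homogeneousComponent n g, mem_homog.mpr (homogeneousComponent_isHomogeneous n g)⟩,
      Subtype.ext ?_⟩
    change T (homogeneousComponent n g) = f
    rw [hcomp, hg, homogeneousComponent_of_mem ((mem_homogeneousSubmodule _ _).mpr
      (mem_homog.mp hf)), if_pos rfl]
  have hEi := LinearMap.injective_iff_surjective.mpr hE
  have := finite_partSpan (K := K) hS
  let E' : Module.End K (partSpan K S) := T.restrict hTS
  have hE'i : Function.Injective E' := by
    rw [injective_iff_map_eq_zero]
    rintro ⟨f, hf⟩ h0
    have h1 : T f = 0 := congrArg Subtype.val h0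
    have h2 : E ⟨f, partSpan_mono hS hf⟩ = 0 := Subtype.ext h1
    have h3 : f = 0 := congrArg Subtype.val ((injective_iff_map_eq_zero E).mp hEi _ h2)
    exact Subtype.ext h3
  intro f hf
  obtain ⟨g, hg⟩ := LinearMap.injective_iff_surjective.mp hE'i ⟨f, hf⟩
  exact ⟨g, g.2, congrArg Subtype.val hg⟩

variable [IsAlgClosed K] [CharZero K]

open Classical in
theorem isInternal_isotypic :
    DirectSum.IsInternal (fun p : Part N × Irr K N => isotypic p.1 p.2) := by
  apply DirectSum.isInternal_submodule_of_iSupIndep_of_iSup_eq_top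
  · rw [iSupIndep_def]
    rintro ⟨l, τ⟩
    rw [Submodule.disjoint_def]
    intro x hx hx'
    have h1 : isoProj τ (lead K l x) = x := by
      rw [lead_of_mem (isotypic_le l τ hx), isoProj_of_mem_self hx]
    have h2 : ⨆ q, ⨆ (_ : q ≠ (l, τ)), isotypic (K := K) q.1 q.2 ≤
        LinearMap.ker (isoProj τ * lead K l) := by
      refine iSup_le fun q => iSup_le fun hq y hy => ?_
      rw [LinearMap.mem_ker, Module.End.mul_apply]
      by_cases hl : l = q.1
      · have hτ : q.2 ≠ τ := fun e => hq (Prod.ext hl.symm e)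
        rw [hl, lead_of_mem (isotypic_le _ _ hy), isoProj_of_mem_ne hτ hy]
      · rw [lead_eq_zero (by simpa using hl) (isotypic_le _ _ hy), map_zero]
    rw [← h1]
    exact h2 hx'
  · apply partSpan_le_of_lead
    intro l v hv _
    rw [← iSup_isotypic] at hv
    refine (iSup_le fun τ => ?_ : ⨆ τ : Irr K N, isotypic l τ ≤ _) hv
    exact le_iSup (fun p : Part N × Irr K N => isotypic p.1 p.2) (l, τ)

/-- The spanning condition is global, so a dimension count is needed. Since there are as many `F λ τ
i` as basis vectors of `V_{λ;τ}`, they define an endomorphism `T`, triangular for dominance and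
surjective, hence onto each finite-dimensional space of polynomials dominated by `l`. Comparing
leading parts gives the claim. -/
theorem IsEigenSystem.isotypic_le_span_lead (h : IsEigenSystem θ F eig) (l : Part N)
    (τ : Irr K N) : isotypic l τ ≤ Submodule.span K (Set.range fun i => lead K l (F l τ i)) := by
  classical
  let b : ∀ p : Part N × Irr K N, Module.Basis (Fin (Module.finrank K (isotypic p.1 p.2))) K
    (isotypic p.1 p.2) := fun p => Module.finBasis K _
  let B := (isInternal_isotypic (K := K) (N := N)).collectedBasis b
  let T : Module.End K (MvPolynomial (Fin N) K) := B.constr K fun a => F a.1.1 a.1.2 a.2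
  have hTb : ∀ l τ i, T (b (l, τ) i) = F l τ i := by
    intro l τ i
    have h1 : (b (l, τ) i : MvPolynomial (Fin N) K) = B ⟨(l, τ), i⟩ := by
      simp only [B, DirectSum.IsInternal.collectedBasis_coe]
    rw [h1]
    exact B.constr_basis K _ _
  have hTiso : ∀ l τ, ∀ f ∈ isotypic l τ, T f ∈ Submodule.span K (Set.range (F l τ)) := by
    intro l τ f hf
    have hsum := congrArg Subtype.val ((b (l, τ)).sum_repr ⟨f, hf⟩)
    simp only [AddSubmonoidClass.coe_finsetSum, Submodule.coe_smul] at hsum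
    rw [← hsum, map_sum]
    refine Submodule.sum_mem _ fun i _ => ?_
    rw [map_smul, hTb]
    exact Submodule.smul_mem _ _ (Submodule.subset_span ⟨i, rfl⟩)
  have hTS : ∀ S : Set (Part N), IsDominanceLower S → ∀ f ∈ partSpan K S, T f ∈ partSpan K S := by
    intro S hS f hf
    have hle : ⨆ l : S, ⨆ τ : Irr K N, isotypic l.1 τ ≤ (partSpan K S).comap T := by
      refine iSup_le fun l => iSup_le fun τ f hf => ?_
      refine (Submodule.span_le.mpr ?_ : _ ≤ partSpan K S) (hTiso l τ f hf)
      rintro _ ⟨i, rfl⟩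
      exact partSpan_mono (fun μ hμ => hS l l.2 μ hμ) (h.mem_dominated l τ i)
    exact hle (partSpan_le_iSup_isotypic S hf)
  have hsurj : Function.Surjective T := by
    rw [← LinearMap.range_eq_top, eq_top_iff, ← h.span_eq_top, Submodule.span_le]
    rintro _ ⟨l, τ, i, rfl⟩
    exact ⟨_, hTb l τ i⟩
  intro v hv
  obtain ⟨w, hw, rfl⟩ := surjOn_of_surjOn_homog (n := ∑ i, l.1 i) (fun μ hμ => hμ.1)
    (fun n => hTS _ (isDominanceLower_size n)) hsurj (hTS _ (isDominanceLower_dominated l)) v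
    (partSpan_singleton_le l (isotypic_le l τ hv))
  -- Here `T w` is the given element of `V_{l;τ}`: the part of `w` below `l` does not reach the
  -- leading part, and the components of `lead K l w` in other `V_{l;σ}` are killed by the
  -- projection.
  have h1 : T w = isoProj τ (lead K l (T (lead K l w))) := by
    have h2 : lead K l (T (w - lead K l w)) = 0 :=
      lead_below (hTS _ (isDominanceLower_below l) _ (sub_lead_mem_below hw))
    rw [map_sub, map_sub, sub_eq_zero, lead_of_mem (isotypic_le l τ hv)] at h2
    rw [← h2, isoProj_of_mem_self hv]
  rw [h1]
  have hle : ⨆ σ : Irr K N, isotypic l σ ≤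
      (Submodule.span K (Set.range fun i => lead K l (F l τ i))).comap
        (isoProj τ * lead K l * T) := by
    refine iSup_le fun σ f hf => ?_
    rw [Submodule.mem_comap, Module.End.mul_apply, Module.End.mul_apply]
    have hm : ∀ g ∈ Submodule.span K (Set.range (F l σ)),
        lead K l g ∈ Submodule.span K (Set.range fun i => lead K l (F l σ i)) := by
      intro g hg
      have := Submodule.mem_map_of_mem (f := lead K l) hg
      rwa [Submodule.map_span, ← Set.range_comp] at this
    have hiso : Submodule.span K (Set.range fun i => lead K l (F l σ i)) ≤ isotypic l σ := by
      rw [Submodule.span_le]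
      rintro _ ⟨i, rfl⟩
      exact h.leading l σ i
    have hx := hm _ (hTiso l σ f hf)
    by_cases hσ : σ = τ
    · subst hσ
      rwa [isoProj_of_mem_self (hiso hx)]
    · rw [isoProj_of_mem_ne hσ (hiso hx)]
      exact zero_mem _
  apply hle
  rw [iSup_isotypic]
  exact lead_mem l w

/-- The endomorphism of the span of the monomials `x^γ`, `γ⁺ = l`, induced by the leading part
of `P_m` and the projection to the `τ`-isotypical component. -/
noncomputable def leadEnd (θ : K) (m : ℕ) (l : Part N) (τ : Irr K N) :
    Module.End K (partSpan K {l}) :=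
  (lead K l * hpOp θ m * isoProj τ).restrict fun _ _ => lead_mem l _

/-- The leading parts span `V_{l;τ}` and have the right number, so they form a basis of eigenvectors
for the leading part of `P_m`. Cyclicity of the trace then passes from `V_{l;τ}` to all of `V_l`,
where the monomials are a basis. -/
theorem IsEigenSystem.sum_eig (h : IsEigenSystem θ F eig) {m : ℕ} (hm : 1 ≤ m) (l : Part N)
    (τ : Irr K N) :
    ∑ i, eig m l τ i = LinearMap.trace K (partSpan K {l}) (leadEnd θ m l τ) := by
  classical
  let u : Fin (Module.finrank K (isotypic l τ)) → isotypic l τ :=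
    fun i => ⟨lead K l (F l τ i), h.leading l τ i⟩
  have hu : ⊤ ≤ Submodule.span K (Set.range u) := by
    rintro ⟨v, hv⟩ -
    have h1 := h.isotypic_le_span_lead l τ hv
    have h2 : (Set.range fun i => lead K l (F l τ i)) =
        (isotypic l τ).subtype '' Set.range u := by
      rw [← Set.range_comp]; rfl
    rw [h2, ← Submodule.map_span] at h1
    obtain ⟨w, hw, hwv⟩ := h1
    have : w = ⟨v, hv⟩ := Subtype.ext hwv
    exact this ▸ hw
  let b := basisOfTopLeSpanOfCardEqFinrank u hu (Fintype.card_fin _)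
  let Q : Module.End K (isotypic l τ) := (lead K l * hpOp θ m).restrict fun f hf => by
    rw [mem_isotypic_iff, Module.End.mul_apply, isoProj_lead, isoProj_hpOp, isoProj_of_mem_self hf]
    exact ⟨lead_mem l _, rfl⟩
  have hQ : ∀ i, Q (b i) = eig m l τ i • b i := by
    intro i
    simp only [b, coe_basisOfTopLeSpanOfCardEqFinrank]
    apply Subtype.ext
    change lead K l (hpOp θ m (lead K l (F l τ i))) = eig m l τ i • lead K l (F l τ i)
    rw [← lead_hpOp θ l m (h.mem_dominated l τ i), h.eigen m hm, map_smul]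
  have htr : LinearMap.trace K _ Q = ∑ i, eig m l τ i := by
    rw [LinearMap.trace_eq_matrix_trace K b, Matrix.trace]
    refine Finset.sum_congr rfl fun i _ => ?_
    rw [Matrix.diag_apply, LinearMap.toMatrix_apply, hQ]
    simp
  let ι : isotypic l τ →ₗ[K] partSpan K {l} := Submodule.inclusion (isotypic_le l τ)
  let π : partSpan K {l} →ₗ[K] isotypic l τ :=
    ((isoProj τ).comp (Submodule.subtype _)).codRestrict _ fun f => isoProj_mem τ f.2
  have h1 : leadEnd θ m l τ = ι ∘ₗ (Q ∘ₗ π) := rfl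
  have h2 : (Q ∘ₗ π) ∘ₗ ι = Q := by
    refine LinearMap.ext fun f => ?_
    have : π (ι f) = f := Subtype.ext (isoProj_of_mem_self f.2)
    simp [this]
  rw [← htr, h1, LinearMap.trace_comp_comm', h2]

end Leading

end HeckmanPolychronakos

namespace HeckmanPolychronakos

open MvPolynomial Finset

/-! ### Complete homogeneous symmetric polynomials of subsets -/

section CompleteHomogeneous

variable {K : Type*} [Field K] {N : ℕ} (θ : K) (n : Composition N) (d : Fin n.length → ℕ)

theorem hSub_eq_sum_sym (A : Finset (Fin n.length)) (q : ℕ) :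
    hSub θ n d A q = ∑ s ∈ A.sym q, ((s : Multiset (Fin n.length)).map (shiftedDeg θ n d)).prod := by
  rw [hSub, hsymm, map_sum]
  refine sum_bij (fun s _ => s.map Subtype.val) (fun s _ => ?_)
    (fun s _ t _ h => Sym.map_injective Subtype.val_injective q h) (fun t ht => ?_) (fun s _ => ?_)
  · rw [mem_sym_iff]
    intro a ha
    obtain ⟨b, -, rfl⟩ := Sym.mem_map.mp ha
    exact b.2
  · rw [mem_sym_iff] at ht
    refine ⟨t.attach.map fun x => ⟨x.1, ht _ x.2⟩, mem_univ _, ?_⟩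
    rw [Sym.map_map]
    exact Sym.attach_map_coe t
  · rw [map_multiset_prod, Multiset.map_map, Sym.coe_map, Multiset.map_map]
    congr 2
    funext a
    simp

theorem hSub_zero (A : Finset (Fin n.length)) : hSub θ n d A 0 = 1 := by
  rw [hSub, hsymm_zero, map_one]

theorem hSub_empty_succ (q : ℕ) : hSub θ n d ∅ (q + 1) = 0 := by
  rw [hSub_eq_sum_sym, sym_empty, sum_empty]

/-- Split the multisets by whether they contain `a`, and remove one copy of `a` from those that do.
-/
theorem hSub_succ {A : Finset (Fin n.length)} {a : Fin n.length} (ha : a ∈ A) (q : ℕ) :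
    hSub θ n d A (q + 1) =
      shiftedDeg θ n d a * hSub θ n d A q + hSub θ n d (A.erase a) (q + 1) := by
  classical
  simp only [hSub_eq_sum_sym]
  have h1 : (A.sym (q + 1)).filter (fun s => a ∈ s) = (A.sym q).image (Sym.cons a) := by
    ext s
    simp only [mem_filter, mem_image, mem_sym_iff]
    constructor
    · rintro ⟨h, hs⟩
      obtain ⟨t, rfl⟩ := Sym.exists_cons_of_mem hs
      exact ⟨t, fun b hb => h b (Sym.mem_cons_of_mem hb), rfl⟩
    · rintro ⟨t, ht, rfl⟩
      refine ⟨fun b hb => ?_, Sym.mem_cons_self a t⟩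
      rcases Sym.mem_cons.mp hb with rfl | hb
      · exact ha
      · exact ht b hb
  have h2 : (A.sym (q + 1)).filter (fun s => ¬ a ∈ s) = (A.erase a).sym (q + 1) := by
    ext s
    simp only [mem_filter, mem_sym_iff, mem_erase]
    constructor
    · rintro ⟨h, hs⟩ b hb
      exact ⟨fun e => hs (e ▸ hb), h b hb⟩
    · intro h
      exact ⟨fun b hb => (h b hb).2, fun hs => (h a hs).1 rfl⟩
  rw [← sum_filter_add_sum_filter_not _ (fun s => a ∈ s), h1, h2,
    sum_image (fun s _ t _ h => Sym.cons_inj_right a s t |>.mp h), mul_sum]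
  congr 1
  refine sum_congr rfl fun s _ => ?_
  rw [Sym.coe_cons, Multiset.map_cons, Multiset.prod_cons]

/-- The coefficient `(-θ)^(|A| - 1) h_{m + 1 - |A|} (ℓ̃_a : a ∈ A)`, set to `0` outside
`1 ≤ |A| ≤ m + 1`. -/
noncomputable def pathWeight (m : ℕ) (A : Finset (Fin n.length)) : K :=
  if #A ∈ Icc 1 (m + 1) then (-θ) ^ (#A - 1) * hSub θ n d A (m + 1 - #A) else 0

theorem pathWeight_empty (m : ℕ) : pathWeight θ n d m ∅ = 0 := by simp [pathWeight]

/-- The last step of a walk currently in block `a` either stayed there or entered it, at the cost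
`-θ`, from a walk that had not visited `a`. The choice of `a ∈ A` is free because `h_q` is
symmetric. -/
theorem pathWeight_succ (m : ℕ) {A : Finset (Fin n.length)} {a : Fin n.length} (ha : a ∈ A) :
    pathWeight θ n d (m + 1) A =
      shiftedDeg θ n d a * pathWeight θ n d m A - θ * pathWeight θ n d m (A.erase a) := by
  obtain ⟨k, hk⟩ : ∃ k, #A = k + 1 := Nat.exists_eq_succ_of_ne_zero (card_ne_zero_of_mem ha)
  have hk' : #(A.erase a) = k := by rw [card_erase_of_mem ha, hk, Nat.add_sub_cancel]
  simp only [pathWeight, hk, hk', mem_Icc]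
  rcases Nat.eq_zero_or_pos k with rfl | hpos
  · have he : A.erase a = ∅ := card_eq_zero.mp hk'
    have h := hSub_succ θ n d ha m
    rw [he, hSub_empty_succ, add_zero] at h
    simp [h]
  · obtain ⟨j, rfl⟩ := Nat.exists_eq_succ_of_ne_zero hpos.ne'
    rcases lt_trichotomy (j + 1) (m + 1) with h | h | h
    · obtain ⟨q, rfl⟩ := Nat.exists_eq_add_of_lt (Nat.lt_of_succ_lt_succ h)
      have e := hSub_succ θ n d ha q
      rw [if_pos (by omega), if_pos (by omega), if_pos (by omega),
        show j + q + 1 + 1 + 1 - (j.succ + 1) = q + 1 by omega,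
        show j + q + 1 + 1 - (j.succ + 1) = q by omega,
        show j + q + 1 + 1 - j.succ = q + 1 by omega, e]
      simp only [Nat.succ_eq_add_one, Nat.add_sub_cancel]
      ring
    -- The boundary case `#A = m + 2`: there is no room for a stay, so the `ℓ̃_a` term is zero and
    -- only the jump remains.
    · obtain rfl : j = m := by omega
      rw [if_pos (by omega), if_neg (by omega), if_pos (by omega),
        show j + 1 + 1 - (j.succ + 1) = 0 by omega, show j + 1 - j.succ = 0 by omega,
        hSub_zero, hSub_zero]
      simp only [Nat.succ_eq_add_one, Nat.add_sub_cancel]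
      ring
    · rw [if_neg (by omega), if_neg (by omega), if_neg (by omega)]
      ring

theorem pathWeight_zero_singleton (a : Fin n.length) : pathWeight θ n d 0 {a} = 1 := by
  simp [pathWeight, hSub_zero]

theorem pathWeight_zero_of_one_lt {A : Finset (Fin n.length)} (h : 1 < #A) :
    pathWeight θ n d 0 A = 0 := by
  rw [pathWeight, if_neg]
  simp; omega

end CompleteHomogeneous

/-! ### Increasing cycles -/

section IncreasingCycle

variable {N : ℕ}

/-- The cycle through the elements of `J` in increasing order. -/
def incCycle (J : Finset (Fin N)) : Equiv.Perm (Fin N) := (J.sort (· ≤ ·)).formPerm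

theorem incCycle_singleton (i : Fin N) : incCycle {i} = 1 := by
  rw [incCycle, sort_singleton, List.formPerm_singleton]

theorem incCycle_apply_of_notMem {J : Finset (Fin N)} {j : Fin N} (h : j ∉ J) :
    incCycle J j = j :=
  List.formPerm_apply_of_notMem (by rwa [mem_sort])

theorem incCycle_apply_mem {J : Finset (Fin N)} {j : Fin N} (h : j ∈ J) : incCycle J j ∈ J := by
  rw [← mem_sort (· ≤ ·)]
  exact List.formPerm_apply_mem_of_mem (by rwa [mem_sort])

theorem exists_incCycle_insert {J : Finset (Fin N)} (hJ : J.Nonempty) {j : Fin N}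
    (hj : ∀ k ∈ J, j < k) : ∃ a ∈ J, (∀ k ∈ J, a ≤ k) ∧
      incCycle (insert j J) = Equiv.swap j a * incCycle J := by
  cases hs : J.sort (· ≤ ·) with
  | nil =>
    have h := length_sort (s := J) (· ≤ ·)
    rw [hs] at h
    exact absurd h.symm (card_ne_zero.mpr hJ)
  | cons a t =>
    have hp := pairwise_sort J (· ≤ ·)
    rw [hs, List.pairwise_cons] at hp
    have hm : ∀ k, k ∈ a :: t ↔ k ∈ J := fun k => by rw [← hs, mem_sort]
    refine ⟨a, (hm a).mp List.mem_cons_self, fun k hk => ?_, ?_⟩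
    · rcases List.mem_cons.mp ((hm k).mpr hk) with rfl | h
      · exact le_rfl
      · exact hp.1 k h
    · rw [incCycle, sort_insert _ (fun k hk => (hj k hk).le) (fun h => lt_irrefl _ (hj j h)), hs,
        List.formPerm_cons_cons, incCycle, hs]

/-- An increasing cycle sends the largest element of `J` to the smallest one. -/
theorem incCycle_max_le {J : Finset (Fin N)} {i : Fin N} (hi : i ∈ J) (hmax : ∀ j ∈ J, j ≤ i)
    {k : Fin N} (hk : k ∈ J) : incCycle J i ≤ k := by
  induction J using Finset.induction_on_min generalizing i k with
  | empty => simp at hi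
  | insert a J ha ih =>
    rcases J.eq_empty_or_nonempty with rfl | hJ
    · have h1 := mem_singleton.mp (by simpa using hi)
      have h2 := mem_singleton.mp (by simpa using hk)
      rw [insert_empty_eq, incCycle_singleton, h1, h2]; rfl
    · have hiJ : i ∈ J := by
        rcases mem_insert.mp hi with rfl | h
        · obtain ⟨b, hb⟩ := hJ
          exact absurd (ha b hb) (hmax b (mem_insert_of_mem hb)).not_gt
        · exact h
      obtain ⟨b, hb, hle, he⟩ := exists_incCycle_insert hJ ha
      have hib : incCycle J i = b :=
        le_antisymm (ih hiJ (fun j hj => hmax j (mem_insert_of_mem hj)) hb)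
          (hle _ (incCycle_apply_mem hiJ))
      rw [he, Equiv.Perm.mul_apply, hib, Equiv.swap_apply_right]
      rcases mem_insert.mp hk with rfl | h
      · exact le_rfl
      · exact (ha k h).le

/-- Prepending `j` multiplies on the left by `(j, c i)`, where `c i` is the smallest element of `J`;
as `c j = j`, conjugating by `c` turns this into `(i,j)` on the right. Thus applying `(i,j)` to `c⁻¹
x^λ` extends the cycle by `j`. -/
theorem incCycle_insert {J : Finset (Fin N)} {i j : Fin N} (hi : i ∈ J) (hmax : ∀ k ∈ J, k ≤ i)
    (hj : ∀ k ∈ J, j < k) : incCycle (insert j J) = incCycle J * Equiv.swap i j := by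
  obtain ⟨b, hb, hle, he⟩ := exists_incCycle_insert ⟨i, hi⟩ hj
  have hib : incCycle J i = b :=
    le_antisymm (incCycle_max_le hi hmax hb) (hle _ (incCycle_apply_mem hi))
  have hjj : incCycle J j = j := incCycle_apply_of_notMem fun h => lt_irrefl _ (hj j h)
  rw [he, Equiv.swap_comm i j, Equiv.mul_swap_eq_swap_mul, hib, hjj]

theorem formPerm_map (g : Equiv.Perm (Fin N)) (L : List (Fin N)) :
    (L.map g).formPerm = g * L.formPerm * g⁻¹ := by
  induction L with
  | nil => simp
  | cons x L ih =>
    cases L with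
    | nil => simp
    | cons y L =>
      rw [List.map_cons, List.map_cons, List.formPerm_cons_cons, List.formPerm_cons_cons,
        ← List.map_cons, ih, Equiv.swap_apply_apply]
      group

end IncreasingCycle

end HeckmanPolychronakos

namespace HeckmanPolychronakos

open MvPolynomial Finset

/-! ### The blocks of a composition -/

section Blocks

variable {N : ℕ} (n : Composition N)

theorem card_index_eq (a : Fin n.length) : #{j | n.index j = a} = n.blocksFun a := by
  have h : ({j | n.index j = a} : Finset (Fin N)) = univ.map (n.embedding a).toEmbedding := by
    ext j
    simp only [mem_filter, mem_univ, true_and, mem_map]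
    constructor
    · rintro rfl
      exact ⟨n.invEmbedding j, n.embedding_comp_inv j⟩
    · rintro ⟨k, rfl⟩
      exact n.index_embedding a k
  rw [h, card_map, card_univ, Fintype.card_fin]

theorem index_lastOfBlock (a : Fin n.length) : n.index (lastOfBlock n a) = a :=
  n.index_embedding a _

end Blocks

/-! ### The walk expansion of the leading part of `P_m x^λ` -/

section PathSum

variable {K : Type*} [Field K] {N : ℕ} (n : Composition N) (d : Fin n.length → ℕ)

/-- The exponent of `x^λ`, `λ = (d_1^{n_1}, …, d_p^{n_p})`. -/
noncomputable def blockExp : Fin N →₀ ℕ := Finsupp.equivFunOnFinite.symm fun j => d (n.index j)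

theorem blockExp_apply (j : Fin N) : blockExp n d j = d (n.index j) := rfl

theorem plus_blockExp (hd : StrictAnti d) : plus (blockExp n d) = blockPart n d hd :=
  plus_self (blockPart n d hd)

/-- The image of `x^λ` under the inverse of the cycle through `J`. -/
noncomputable def cycleMonomial (K : Type*) [Field K] (J : Finset (Fin N)) :
    MvPolynomial (Fin N) K :=
  permRep K N (incCycle J)⁻¹ (monomial (blockExp n d) 1)

/-- The sets which meet each block at most once. -/
noncomputable def partialTransversals : Finset (Finset (Fin N)) := {J | Set.InjOn n.index J}

variable {n} in
theorem mem_partialTransversals {J : Finset (Fin N)} :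
    J ∈ partialTransversals n ↔ Set.InjOn n.index J := by
  simp [partialTransversals]

/-- The sets `J` with largest element `i` which meet each block at most once. -/
noncomputable def transversals (i : Fin N) : Finset (Finset (Fin N)) :=
  {J | i ∈ J ∧ (∀ j ∈ J, j ≤ i) ∧ Set.InjOn n.index J}

variable {n} in
theorem mem_transversals {i : Fin N} {J : Finset (Fin N)} :
    J ∈ transversals n i ↔ i ∈ J ∧ (∀ j ∈ J, j ≤ i) ∧ Set.InjOn n.index J := by
  simp [transversals]

variable {n} in
theorem insert_mem_transversals {i j : Fin N} {J : Finset (Fin N)} (hJ : J ∈ transversals n i)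
    (hj : n.index j < n.index (incCycle J i)) :
    (∀ k ∈ J, j < k) ∧ insert j J ∈ transversals n i ∧ incCycle (insert j J) i = j := by
  obtain ⟨hi, hmax, hinj⟩ := mem_transversals.mp hJ
  have hlt : ∀ k ∈ J, n.index j < n.index k := fun k hk =>
    hj.trans_le (index_mono n (incCycle_max_le hi hmax hk))
  have hjk : ∀ k ∈ J, j < k := fun k hk =>
    lt_of_not_ge fun h => (index_mono n h).not_gt (hlt k hk)
  refine ⟨hjk, mem_transversals.mpr ⟨mem_insert_of_mem hi, ?_, ?_⟩, ?_⟩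
  · intro k hk
    rcases mem_insert.mp hk with rfl | hk
    · exact (hjk i hi).le
    · exact hmax k hk
  · rw [coe_insert, Set.injOn_insert (fun h => lt_irrefl _ (hjk j h))]
    refine ⟨hinj, ?_⟩
    rintro ⟨k, hk, e⟩
    exact (hlt k hk).ne' e
  · rw [incCycle_insert hi hmax hjk, Equiv.Perm.mul_apply, Equiv.swap_apply_left,
      incCycle_apply_of_notMem fun h => lt_irrefl _ (hjk j h)]

variable {n d} in
-- In `c_J⁻¹ x^λ` position `j` carries the exponent of the block of `c_J j`; position `i` carries
-- that of the smallest element of `J`. A larger exponent belongs to an earlier block, hence to a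
-- position before all of `J`, which `c_J` fixes; exchanging it with position `i` inserts it into
-- the cycle. The number of smaller exponents is unaffected by the permutation `c_J`.
theorem lead_xD_cycleMonomial (hd : StrictAnti d) (θ : K) {i : Fin N} {J : Finset (Fin N)}
    (hJ : J ∈ transversals n i) :
    lead K (blockPart n d hd) (xD θ i (cycleMonomial n d K J)) =
      shiftedDeg θ n d (n.index (incCycle J i)) • cycleMonomial n d K J -
        θ • ∑ j with n.index j < n.index (incCycle J i), cycleMonomial n d K (insert j J) := by
  obtain ⟨hi, hmax, hinj⟩ := mem_transversals.mp hJ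
  set c := incCycle J with hc
  set γ := (blockExp n d).mapDomain ⇑c⁻¹ with hγ
  have hγa : ∀ j, γ j = d (n.index (c j)) := fun j => by
    rw [hγ, coe_mapDomain_perm, inv_inv]; rfl
  have hm : cycleMonomial n d K J = monomial γ 1 := by rw [cycleMonomial, permRep_monomial]
  have hl : plus γ = blockPart n d hd := by rw [hγ, plus_mapDomain, plus_blockExp]
  rw [hm, ← hl, lead_xD_monomial, xDLead, ← hm]
  have hcard : #{j | γ j < γ i} = ∑ b ∈ Ioi (n.index (c i)), n.blocksFun b := by
    have h1 : #{j | γ j < γ i} = #{j | n.index (c i) < n.index j} := by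
      refine card_bij (fun j _ => c j) (fun j hj => ?_) (fun j _ k _ h => c.injective h)
        (fun j hj => ⟨c⁻¹ j, ?_, by simp⟩)
      · simpa [hγa, hd.lt_iff_gt] using hj
      · simpa [hγa, hd.lt_iff_gt] using hj
    rw [h1, card_eq_sum_card_fiberwise (f := n.index) (t := Ioi (n.index (c i)))
      (fun j hj => by simpa using hj)]
    refine sum_congr rfl fun b hb => ?_
    rw [← card_index_eq n b, filter_filter]
    congr 1
    ext j
    simp only [mem_filter, mem_univ, true_and, and_iff_right_iff_imp]
    rintro rfl
    exact mem_Ioi.mp hb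
  congr 1
  · rw [shiftedDeg, hcard, hγa]
    push_cast
    rfl
  · congr 1
    have hcj : ∀ j, n.index j < n.index (c i) → c j = j := fun j hj =>
      incCycle_apply_of_notMem fun h => lt_irrefl _ ((insert_mem_transversals hJ hj).1 j h)
    have hs : univ.filter (fun j => γ i < γ j) =
        univ.filter fun j => n.index j < n.index (c i) := by
      ext j
      simp only [mem_filter, mem_univ, true_and, hγa, hd.lt_iff_gt]
      constructor
      · intro h
        by_cases hjJ : j ∈ J
        · exact absurd (index_mono n (incCycle_max_le hi hmax (incCycle_apply_mem hjJ))) h.not_ge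
        · rwa [hc, incCycle_apply_of_notMem hjJ, ← hc] at h
      · intro h
        rwa [hcj j h]
    rw [hs]
    refine sum_congr rfl fun j hj => ?_
    have hj' := (mem_filter.mp hj).2
    rw [cycleMonomial, cycleMonomial, permRep_permRep,
      incCycle_insert hi hmax (insert_mem_transversals hJ hj').1, mul_inv_rev, Equiv.swap_inv]

variable {n d} in
theorem lead_mul_xD_pow_monomial (hd : StrictAnti d) (θ : K) (i : Fin N) (m : ℕ) :
    ((lead K (blockPart n d hd) * xD θ i) ^ m) (monomial (blockExp n d) 1) =
      ∑ J ∈ transversals n i,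
        pathWeight θ n d m (J.image n.index) • cycleMonomial n d K J := by
  induction m with
  | zero =>
    rw [pow_zero, Module.End.one_apply, sum_eq_single {i}]
    · rw [image_singleton, pathWeight_zero_singleton, cycleMonomial, incCycle_singleton, inv_one,
        map_one (permRep K N), one_smul, Module.End.one_apply]
    · intro J hJ hne
      obtain ⟨hi, -, hinj⟩ := mem_transversals.mp hJ
      rw [pathWeight_zero_of_one_lt, zero_smul]
      rw [card_image_of_injOn hinj]
      by_contra h
      refine hne (eq_singleton_iff_unique_mem.mpr ⟨hi, fun j hj => ?_⟩)
      exact card_le_one.mp (not_lt.mp h) j hj i hi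
    · intro h
      refine absurd (mem_transversals.mpr ⟨mem_singleton_self i, ?_, ?_⟩) h
      · simp
      · simp
  | succ m ih =>
    rw [pow_succ', Module.End.mul_apply, ih, map_sum]
    have h1 : ∀ J ∈ transversals n i, (lead K (blockPart n d hd) * xD θ i)
        (pathWeight θ n d m (J.image n.index) • cycleMonomial n d K J) =
        (shiftedDeg θ n d (n.index (incCycle J i)) * pathWeight θ n d m (J.image n.index)) •
          cycleMonomial n d K J - θ • ∑ j with n.index j < n.index (incCycle J i),
            pathWeight θ n d m (J.image n.index) • cycleMonomial n d K (insert j J) := by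
      intro J hJ
      rw [map_smul, Module.End.mul_apply, lead_xD_cycleMonomial hd θ hJ, smul_sub, smul_smul,
        mul_comm, smul_comm, smul_sum]
    have h2 : ∀ J ∈ transversals n i,
        pathWeight θ n d (m + 1) (J.image n.index) • cycleMonomial n d K J =
        (shiftedDeg θ n d (n.index (incCycle J i)) * pathWeight θ n d m (J.image n.index)) •
          cycleMonomial n d K J -
        θ • pathWeight θ n d m ((J.image n.index).erase (n.index (incCycle J i))) •
          cycleMonomial n d K J := by
      intro J hJ
      rw [pathWeight_succ θ n d m (mem_image_of_mem n.index
        (incCycle_apply_mem (mem_transversals.mp hJ).1)), sub_smul, smul_smul]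
    rw [sum_congr rfl h1, sum_congr rfl h2, sum_sub_distrib, sum_sub_distrib, ← smul_sum,
      ← smul_sum, sum_sigma']
    congr 2
    have herase : ∀ {J : Finset (Fin N)} {j : Fin N}, J ∈ transversals n i →
        n.index j < n.index (incCycle J i) →
        ((insert j J).image n.index).erase (n.index j) = J.image n.index := by
      intro J j hJ hj
      rw [image_insert, erase_insert]
      intro h
      obtain ⟨k, hk, e⟩ := mem_image.mp h
      exact e.not_gt (hj.trans_le (index_mono n
        (incCycle_max_le (mem_transversals.mp hJ).1 (mem_transversals.mp hJ).2.1 hk)))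
    have hval : ∀ x ∈ (transversals n i).sigma fun J =>
        univ.filter fun j => n.index j < n.index (incCycle J i),
        pathWeight θ n d m (x.1.image n.index) • cycleMonomial n d K (insert x.2 x.1) =
        pathWeight θ n d m (((insert x.2 x.1).image n.index).erase
          (n.index (incCycle (insert x.2 x.1) i))) • cycleMonomial n d K (insert x.2 x.1) := by
      rintro ⟨J, j⟩ h
      obtain ⟨hJ, hj⟩ := mem_sigma.mp h
      have hj' := (mem_filter.mp hj).2
      rw [(insert_mem_transversals hJ hj').2.2, herase hJ hj']
    -- A cycle with at least two elements arises from exactly one jump, undone by removing its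
    -- smallest element `incCycle b i`. Singletons do not arise, but their weight here is that of
    -- the empty set, which is zero.
    refine sum_bij_ne_zero (fun x _ _ => insert x.2 x.1) ?_ ?_ ?_ fun x hx _ => hval x hx
    · rintro ⟨J, j⟩ h -
      obtain ⟨hJ, hj⟩ := mem_sigma.mp h
      exact (insert_mem_transversals hJ (mem_filter.mp hj).2).2.1
    · rintro ⟨J, j⟩ h - ⟨J', j'⟩ h' - e
      obtain ⟨hJ, hj⟩ := mem_sigma.mp h
      obtain ⟨hJ', hj'⟩ := mem_sigma.mp h'
      obtain ⟨a1, -, a2⟩ := insert_mem_transversals hJ (mem_filter.mp hj).2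
      obtain ⟨b1, -, b2⟩ := insert_mem_transversals hJ' (mem_filter.mp hj').2
      dsimp only at e a1 a2 b1 b2
      have hjj : j = j' := by rw [← a2, ← b2, e]
      subst hjj
      have hJJ : J = J' := by
        rw [← erase_insert (fun h => lt_irrefl _ (a1 j h)), e,
          erase_insert (fun h => lt_irrefl _ (b1 j h))]
      subst hJJ
      rfl
    · intro b hb hne
      obtain ⟨hi, hmax, hinj⟩ := mem_transversals.mp hb
      set j := incCycle b i with hjdef
      have hjb : j ∈ b := incCycle_apply_mem hi
      have hij : i ≠ j := by
        intro e
        have : b = {i} := eq_singleton_iff_unique_mem.mpr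
          ⟨hi, fun k hk => le_antisymm (hmax k hk) (e ▸ incCycle_max_le hi hmax hk)⟩
        rw [this, ← e, image_singleton, erase_singleton, pathWeight_empty, zero_smul] at hne
        exact hne rfl
      have hJ : b.erase j ∈ transversals n i := mem_transversals.mpr
        ⟨mem_erase.mpr ⟨hij, hi⟩, fun k hk => hmax k (mem_of_mem_erase hk),
          hinj.mono (by rw [coe_erase]; exact Set.sdiff_subset)⟩
      have hlt : n.index j < n.index (incCycle (b.erase j) i) := by
        obtain ⟨h1, h2⟩ := mem_erase.mp (incCycle_apply_mem (mem_transversals.mp hJ).1)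
        exact lt_of_le_of_ne (index_mono n (incCycle_max_le hi hmax h2))
          fun e => h1 (hinj hjb h2 e).symm
      have hmem : (⟨b.erase j, j⟩ : Σ _ : Finset (Fin N), Fin N) ∈
          (transversals n i).sigma fun J =>
            univ.filter fun j => n.index j < n.index (incCycle J i) :=
        mem_sigma.mpr ⟨hJ, mem_filter.mpr ⟨mem_univ _, hlt⟩⟩
      refine ⟨⟨b.erase j, j⟩, hmem, ?_, insert_erase hjb⟩
      rw [hval _ hmem]
      dsimp only
      rwa [insert_erase hjb]

variable {n d} in
/-- The leading part of `P_m x^λ`. -/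
theorem lead_hpOp_monomial (hd : StrictAnti d) (θ : K) (m : ℕ) :
    lead K (blockPart n d hd) (hpOp θ m (monomial (blockExp n d) 1)) =
      ∑ J ∈ partialTransversals n,
        pathWeight θ n d m (J.image n.index) • cycleMonomial n d K J := by
  have hmem : monomial (blockExp n d) (1 : K) ∈ partSpan K {blockPart n d hd} :=
    monomial_mem_partSpan (by rw [plus_blockExp n d hd]; exact Set.mem_singleton _) _
  rw [hpOp_eq, LinearMap.sum_apply, map_sum]
  have h : ∀ i, lead K (blockPart n d hd) ((xD θ i ^ m) (monomial (blockExp n d) 1)) =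
      ∑ J ∈ partialTransversals n, if i ∈ J ∧ (∀ j ∈ J, j ≤ i) then
        pathWeight θ n d m (J.image n.index) • cycleMonomial n d K J else 0 := by
    intro i
    rw [lead_xD_pow θ _ i m (partSpan_singleton_le _ hmem), lead_of_mem hmem,
      lead_mul_xD_pow_monomial, ← sum_filter]
    refine sum_congr ?_ fun _ _ => rfl
    ext J
    rw [mem_transversals, mem_filter, mem_partialTransversals]
    tauto
  rw [sum_congr rfl fun i _ => h i, sum_comm]
  refine sum_congr rfl fun J _ => ?_
  -- Each nonempty `J` is counted exactly once, for `i` its maximum; the empty set has no maximum,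
  -- but its weight is zero.
  rcases J.eq_empty_or_nonempty with rfl | hJ
  · simp [pathWeight_empty]
  · rw [sum_eq_single (J.max' hJ), if_pos ⟨J.max'_mem hJ, fun j hj => J.le_max' j hj⟩]
    · intro i _ hne
      rw [if_neg]
      rintro ⟨hi, hmax⟩
      exact hne (le_antisymm (J.le_max' i hi) (hmax _ (J.max'_mem hJ)))
    · simp

end PathSum

end HeckmanPolychronakos

namespace HeckmanPolychronakos

open MvPolynomial Finset

/-! ### The Young subgroup -/

section Young

variable {N : ℕ} (n : Composition N)

/-- The permutations preserving each block. -/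
def young : Finset (Equiv.Perm (Fin N)) := {g | ∀ j, n.index (g j) = n.index j}

variable {n} in
theorem mem_young {g : Equiv.Perm (Fin N)} : g ∈ young n ↔ ∀ j, n.index (g j) = n.index j := by
  simp [young]

variable {n} in
theorem mul_mem_young {g h : Equiv.Perm (Fin N)} (hg : g ∈ young n) (hh : h ∈ young n) :
    g * h ∈ young n :=
  mem_young.mpr fun j => by rw [Equiv.Perm.mul_apply, mem_young.mp hg, mem_young.mp hh]

variable {n} in
theorem inv_mem_young {g : Equiv.Perm (Fin N)} (hg : g ∈ young n) : g⁻¹ ∈ young n :=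
  mem_young.mpr fun j => by
    rw [← mem_young.mp hg (g⁻¹ j), ← Equiv.Perm.mul_apply, mul_inv_cancel, Equiv.Perm.one_apply]

theorem card_young : #(young n) = ∏ a, (n.blocksFun a).factorial := by
  have h := DomMulAct.stabilizer_card n.index
  rw [Fintype.card_subtype] at h
  have e : young n = ({g | n.index ∘ g = n.index} : Finset (Equiv.Perm (Fin N))) := by
    ext g
    simp [mem_young, funext_iff]
  rw [e, h]
  refine prod_congr rfl fun a _ => ?_
  rw [Fintype.card_subtype, card_index_eq]

theorem sort_map_index {J : Finset (Fin N)} (hJ : Set.InjOn n.index J) :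
    (J.sort (· ≤ ·)).map n.index = (J.image n.index).sort (· ≤ ·) := by
  have hs : StrictMonoOn n.index J := ((index_mono n).monotoneOn _).strictMonoOn_of_injOn hJ
  refine List.SortedLT.eq_of_mem_iff ?_ (sortedLT_sort _) fun a => ?_
  · rw [List.sortedLT_iff_pairwise, List.pairwise_map]
    exact (List.sortedLT_iff_pairwise.mp (sortedLT_sort J)).imp_of_mem fun ha hb h =>
      hs ((mem_sort _).mp ha) ((mem_sort _).mp hb) h
  · simp

/-- Cycles meeting the same blocks are conjugate under the Young subgroup. -/
theorem exists_conj_incCycle {J : Finset (Fin N)} (hJ : Set.InjOn n.index J) :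
    ∃ g ∈ young n, g * incCycle J * g⁻¹ = blockCycle n (J.image n.index) := by
  classical
  let r : Fin n.length → Fin N := fun a =>
    if h : ∃ j ∈ J, n.index j = a then h.choose else lastOfBlock n a
  have hr : ∀ a, n.index (r a) = a := by
    intro a
    by_cases h : ∃ j ∈ J, n.index j = a
    · simp only [r, dif_pos h]; exact h.choose_spec.2
    · simp only [r, dif_neg h, index_lastOfBlock]
  have hrJ : ∀ j ∈ J, r (n.index j) = j := by
    intro j hj
    have h : ∃ k ∈ J, n.index k = n.index j := ⟨j, hj, rfl⟩
    simp only [r, dif_pos h]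
    exact hJ h.choose_spec.1 hj h.choose_spec.2
  -- In every block, `f` exchanges the chosen representative with the last element. Where `J` misses
  -- the block, the representative is the last element and nothing moves.
  let f : Fin N → Fin N := fun x => Equiv.swap (r (n.index x)) (lastOfBlock n (n.index x)) x
  have hf : ∀ x, n.index (f x) = n.index x := by
    intro x
    simp only [f, Equiv.swap_apply_def]
    split_ifs with h1 h2
    · rw [index_lastOfBlock]
    · rw [hr]
    · rfl
  have hff : Function.Involutive f := fun x => by
    change Equiv.swap (r (n.index (f x))) (lastOfBlock n (n.index (f x))) (f x) = x
    rw [hf]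
    exact (Equiv.swap (r (n.index x)) (lastOfBlock n (n.index x))).symm_apply_apply x
  refine ⟨hff.toPerm, mem_young.mpr hf, ?_⟩
  rw [incCycle, ← formPerm_map, blockCycle, ← sort_map_index n hJ, List.map_map]
  congr 1
  refine List.map_congr_left fun j hj => ?_
  have hj' := hrJ j ((mem_sort _).mp hj)
  change Equiv.swap (r (n.index j)) _ j = _
  rw [hj', Equiv.swap_apply_left]
  rfl

/-- Conjugation by an element of the Young subgroup permutes that subgroup and leaves the character
unchanged, so only the blocks met by `J` matter. -/
theorem sum_young_chi {K : Type*} [Field K] (τ : Irr K N) {J : Finset (Fin N)}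
    (hJ : Set.InjOn n.index J) :
    ∑ h ∈ young n, τ.chi (h * incCycle J) =
      ∑ h ∈ young n, τ.chi (h * blockCycle n (J.image n.index)) := by
  obtain ⟨g, hg, e⟩ := exists_conj_incCycle n hJ
  refine sum_bij' (fun h _ => g * h * g⁻¹) (fun h _ => g⁻¹ * h * g) (fun h hh => ?_)
    (fun h hh => ?_) (fun h _ => by group) (fun h _ => by group) (fun h _ => ?_)
  · exact mul_mem_young (mul_mem_young hg hh) (inv_mem_young hg)
  · exact mul_mem_young (mul_mem_young (inv_mem_young hg) hh) hg
  · rw [← e, ← Irr.chi_conj τ (h * incCycle J) g]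
    congr 1
    group

/-- The number of transversals of the blocks `a ∈ A`. -/
theorem card_transversals (A : Finset (Fin n.length)) :
    #{J ∈ partialTransversals n | J.image n.index = A} = ∏ a ∈ A, n.blocksFun a := by
  classical
  have h1 : ∏ a ∈ A, n.blocksFun a = Fintype.card (∀ a : A, {j // n.index j = a}) := by
    rw [Fintype.card_pi, ← prod_attach, univ_eq_attach]
    refine prod_congr rfl fun a _ => ?_
    rw [Fintype.card_subtype, card_index_eq]
  rw [h1, ← card_univ]
  symm
  refine card_bij (fun r _ => univ.image fun a => (r a).1) (fun r _ => ?_) (fun r _ r' _ e => ?_)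
    (fun J hJ => ?_)
  · rw [mem_filter, mem_partialTransversals]
    constructor
    · intro j hj k hk e
      simp only [coe_image, coe_univ, Set.image_univ, Set.mem_range] at hj hk
      obtain ⟨a, rfl⟩ := hj
      obtain ⟨b, rfl⟩ := hk
      rw [(r a).2, (r b).2] at e
      rw [Subtype.ext e]
    · rw [image_image]
      ext a
      simp only [mem_image, mem_univ, true_and, Function.comp_apply]
      constructor
      · rintro ⟨b, rfl⟩
        rw [(r b).2]; exact b.2
      · intro ha
        exact ⟨⟨a, ha⟩, (r ⟨a, ha⟩).2⟩
  · funext a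
    have h : (r a).1 ∈ univ.image fun a => (r a).1 := mem_image_of_mem _ (mem_univ a)
    rw [show (univ.image fun a => (r a).1) = univ.image fun a => (r' a).1 from e] at h
    obtain ⟨b, -, hb⟩ := mem_image.mp h
    have : b = a := Subtype.ext (by rw [← (r' b).2, hb, (r a).2])
    subst this
    exact Subtype.ext hb.symm
  · obtain ⟨hinj, rfl⟩ := mem_filter.mp hJ
    rw [mem_partialTransversals] at hinj
    have h : ∀ a : J.image n.index, ∃ j ∈ J, n.index j = a := fun a => mem_image.mp a.2
    choose s hs hsa using h
    refine ⟨fun a => ⟨s a, hsa a⟩, mem_univ _, ?_⟩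
    ext j
    simp only [mem_image, mem_univ, true_and]
    constructor
    · rintro ⟨a, rfl⟩
      exact hs a
    · intro hj
      exact ⟨⟨n.index j, mem_image_of_mem _ hj⟩, hinj (hs _) hj (hsa _)⟩

end Young

end HeckmanPolychronakos

namespace HeckmanPolychronakos

open MvPolynomial Finset

/-! ### The trace of the leading part -/

section Trace

variable {K : Type*} [Field K] {N : ℕ}

theorem permRep_isoProj (τ : Irr K N) (g : Equiv.Perm (Fin N)) (f : MvPolynomial (Fin N) K) :
    permRep K N g (isoProj τ f) = isoProj τ (permRep K N g f) := by
  rw [isoProj, LinearMap.smul_apply, LinearMap.smul_apply, map_smul, LinearMap.sum_apply,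
    LinearMap.sum_apply, map_sum]
  congr 1
  refine Fintype.sum_equiv (MulAut.conj g).toEquiv _ _ fun h => ?_
  have e : (MulAut.conj g).toEquiv h = g * h * g⁻¹ := rfl
  rw [e, LinearMap.smul_apply, LinearMap.smul_apply, map_smul, permRep_permRep, permRep_permRep,
    show (g * h * g⁻¹)⁻¹ = g * h⁻¹ * g⁻¹ by group, Irr.chi_conj]
  congr 3
  group

theorem trace_eq_sum_coeff {S : Set (Part N)}
    [Fintype {γ : Fin N →₀ ℕ | plus γ ∈ S}] {T : Module.End K (MvPolynomial (Fin N) K)}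
    (hT : ∀ f ∈ partSpan K S, T f ∈ partSpan K S) :
    LinearMap.trace K (partSpan K S) (T.restrict hT) =
      ∑ γ : {γ : Fin N →₀ ℕ | plus γ ∈ S}, coeff γ.1 (T (monomial γ.1 1)) := by
  classical
  let b : Module.Basis _ K (partSpan K S) := basisRestrictSupport K {γ : Fin N →₀ ℕ | plus γ ∈ S}
  rw [LinearMap.trace_eq_matrix_trace K b, Matrix.trace]
  refine sum_congr rfl fun γ _ => ?_
  rw [Matrix.diag_apply, LinearMap.toMatrix_apply]
  have hrepr : ∀ (f : partSpan K S) γ, b.repr f γ = coeff γ.1 f.1 := fun _ _ => rfl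
  have hb : (b γ : MvPolynomial (Fin N) K) = monomial γ.1 1 := by
    have h : b γ = ⟨monomial γ.1 1, monomial_mem_partSpan γ.2 1⟩ := by
      rw [← b.repr.injective.eq_iff, b.repr_self]
      ext δ
      rw [hrepr, coeff_monomial, Finsupp.single_apply]
      exact if_congr Subtype.ext_iff rfl rfl
    rw [h]
  rw [hrepr, LinearMap.coe_restrict_apply, hb]

variable (n : Composition N) {d : Fin n.length → ℕ}

variable {n} in
theorem mapDomain_blockExp_eq_iff (hd : StrictAnti d) (g h : Equiv.Perm (Fin N)) :
    (blockExp n d).mapDomain g = (blockExp n d).mapDomain h ↔ h⁻¹ * g ∈ young n := by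
  rw [← DFunLike.coe_injective.eq_iff, coe_mapDomain_perm, coe_mapDomain_perm, mem_young]
  constructor
  · intro e j
    have := congrFun e (g j)
    simp only [Function.comp_apply, blockExp_apply, hd.injective.eq_iff,
      ← Equiv.Perm.mul_apply, inv_mul_cancel] at this
    exact this.symm
  · intro e
    funext j
    have := e (g⁻¹ j)
    rw [← Equiv.Perm.mul_apply, mul_assoc, mul_inv_cancel, mul_one] at this
    simp only [Function.comp_apply, blockExp_apply, this]

variable {n} in
theorem coeff_permRep_blockExp (hd : StrictAnti d) (g : Equiv.Perm (Fin N))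
    [Decidable (g ∈ young n)] :
    coeff (blockExp n d) (permRep K N g (monomial (blockExp n d) 1)) =
      if g ∈ young n then 1 else 0 := by
  classical
  have h := mapDomain_blockExp_eq_iff hd g 1
  rw [inv_one, one_mul, Equiv.Perm.coe_one, Finsupp.mapDomain_id] at h
  rw [permRep_monomial, coeff_monomial]
  exact if_congr h rfl rfl

variable {n} in
theorem coeff_isoProj_cycleMonomial (hd : StrictAnti d) (τ : Irr K N) (J : Finset (Fin N)) :
    coeff (blockExp n d) (isoProj τ (cycleMonomial n d K J)) =
      (τ.dim : K) / (N.factorial : K) * ∑ h ∈ young n, τ.chi (h * incCycle J) := by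
  classical
  rw [isoProj, LinearMap.smul_apply, coeff_smul, smul_eq_mul, LinearMap.sum_apply, coeff_sum]
  congr 1
  -- Substituting `g = h c_J` gives `g c_J⁻¹ x^λ = h x^λ`, which equals `x^λ` exactly when `h` is in
  -- the Young subgroup.
  rw [← Equiv.sum_comp (Equiv.mulRight (incCycle J)), ← univ_inter (young n), ← sum_ite_mem]
  refine sum_congr rfl fun h _ => ?_
  rw [Equiv.coe_mulRight, LinearMap.smul_apply, coeff_smul, cycleMonomial, permRep_permRep,
    mul_inv_cancel_right, coeff_permRep_blockExp hd, Irr.chi_inv, smul_eq_mul, mul_ite, mul_one,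
    mul_zero]

variable {n} in
theorem coeff_mapDomain_of_commute {T : Module.End K (MvPolynomial (Fin N) K)}
    (hT : ∀ g f, permRep K N g (T f) = T (permRep K N g f)) (γ : Fin N →₀ ℕ)
    (g : Equiv.Perm (Fin N)) :
    coeff (γ.mapDomain g) (T (monomial (γ.mapDomain g) 1)) = coeff γ (T (monomial γ 1)) := by
  rw [← permRep_monomial, ← hT, permRep_apply, coeff_rename_mapDomain _ g.injective]

variable {n} in
-- The operator commutes with `S_N`, which acts transitively on the monomials of `V_λ`, so all
-- diagonal entries agree. By orbit counting there are `N!` divided by the order of the Young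
-- subgroup many of them.
theorem trace_mul_card_young (hd : StrictAnti d) {T : Module.End K (MvPolynomial (Fin N) K)}
    (hT : ∀ g f, permRep K N g (T f) = T (permRep K N g f))
    (hmem : ∀ f ∈ partSpan K {blockPart n d hd}, T f ∈ partSpan K {blockPart n d hd}) :
    (#(young n) : K) * LinearMap.trace K (partSpan K {blockPart n d hd}) (T.restrict hmem) =
      N.factorial * coeff (blockExp n d) (T (monomial (blockExp n d) 1)) := by
  classical
  set S := {γ : Fin N →₀ ℕ | plus γ ∈ ({blockPart n d hd} : Set (Part N))} with hS
  have hfin : S.Finite := (finite_setOf_sum_eq (∑ i, (blockPart n d hd).1 i)).subset fun γ hγ =>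
    (sum_plus γ).symm.trans (congrArg (fun l : Part N => ∑ i, l.1 i) (Set.mem_singleton_iff.mp hγ))
  have : Fintype S := hfin.fintype
  have hg : ∀ γ ∈ S, ∃ g : Equiv.Perm (Fin N), (blockExp n d).mapDomain g = γ := by
    intro γ hγ
    have h1 : plus γ = plus (blockExp n d) := by
      rw [plus_blockExp n d hd]; exact Set.mem_singleton_iff.mp hγ
    obtain ⟨σ, hσ⟩ := (plus_eq_iff _ _).mp h1
    refine ⟨σ⁻¹, DFunLike.coe_injective ?_⟩
    rw [coe_mapDomain_perm, inv_inv, hσ]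
  have h1 : ∀ γ : S, coeff γ.1 (T (monomial γ.1 1)) =
      coeff (blockExp n d) (T (monomial (blockExp n d) 1)) := by
    rintro ⟨γ, hγ⟩
    obtain ⟨g, rfl⟩ := hg γ hγ
    exact coeff_mapDomain_of_commute hT _ g
  -- The fibres of the orbit map are the left cosets of the Young subgroup.
  have h2 : N.factorial = Fintype.card S * #(young n) := by
    have hmaps : Set.MapsTo (fun g : Equiv.Perm (Fin N) => (blockExp n d).mapDomain g)
        (univ : Finset (Equiv.Perm (Fin N))) S.toFinset := by
      intro g _
      rw [Set.coe_toFinset, hS]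
      change plus ((blockExp n d).mapDomain g) ∈ ({blockPart n d hd} : Set (Part N))
      rw [plus_mapDomain, plus_blockExp n d hd]
      exact Set.mem_singleton _
    rw [← Set.toFinset_card]
    have h3 := card_eq_sum_card_fiberwise hmaps
    rw [card_univ, Fintype.card_perm, Fintype.card_fin] at h3
    rw [h3, sum_const_nat]
    intro γ hγ
    obtain ⟨g, rfl⟩ := hg γ (Set.mem_toFinset.mp hγ)
    symm
    refine card_bij (fun h _ => g * h) (fun h hh => ?_) (fun h _ k _ e => mul_left_cancel e)
      (fun k hk => ⟨g⁻¹ * k, ?_, mul_inv_cancel_left g k⟩)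
    · rw [mem_filter, mapDomain_blockExp_eq_iff hd, inv_mul_cancel_left]
      exact ⟨mem_univ _, hh⟩
    · rw [mem_filter, mapDomain_blockExp_eq_iff hd] at hk
      exact hk.2
  rw [trace_eq_sum_coeff, sum_congr rfl fun γ _ => h1 γ, sum_const, card_univ, h2]
  push_cast
  rw [nsmul_eq_mul]
  ring

theorem sum_partialTransversals (f : Finset (Fin n.length) → K) :
    ∑ J ∈ partialTransversals n, f (J.image n.index) =
      ∑ A, (∏ a ∈ A, (n.blocksFun a : K)) * f A := by
  rw [← sum_fiberwise (partialTransversals n) fun J => J.image n.index]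
  refine sum_congr rfl fun A _ => ?_
  rw [sum_congr rfl fun J hJ => by rw [(mem_filter.mp hJ).2], sum_const, card_transversals,
    nsmul_eq_mul]
  push_cast
  rfl

theorem avgChi_eq (τ : Irr K N) (A : Finset (Fin n.length)) :
    avgChi n τ A = (#(young n) : K)⁻¹ * ∑ h ∈ young n, τ.chi (h * blockCycle n A) := by
  rw [avgChi, card_young]
  push_cast
  rfl

variable {n} in
/-- The trace of the leading part of `P_m` on the `τ`-isotypical component. -/
theorem trace_leadEnd [CharZero K] (hd : StrictAnti d) (θ : K) (m : ℕ) (τ : Irr K N) :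
    LinearMap.trace K _ (leadEnd θ m (blockPart n d hd) τ) =
      τ.dim * ∑ A, pathWeight θ n d m A * avgChi n τ A * ∏ a ∈ A, (n.blocksFun a : K) := by
  have hN : (N.factorial : K) ≠ 0 := Nat.cast_ne_zero.mpr N.factorial_ne_zero
  have hy : (#(young n) : K) ≠ 0 := by
    rw [Nat.cast_ne_zero, card_young]
    exact prod_ne_zero_iff.mpr fun a _ => Nat.factorial_ne_zero _
  let T : Module.End K (MvPolynomial (Fin N) K) :=
    lead K (blockPart n d hd) * hpOp θ m * isoProj τ
  have hcomm : ∀ g f, permRep K N g (T f) = T (permRep K N g f) := by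
    intro g f
    simp only [T]
    rw [Module.End.mul_apply, Module.End.mul_apply, Module.End.mul_apply, Module.End.mul_apply,
      permRep_lead, ← permRep_isoProj]
    exact congrArg _ (LinearMap.congr_fun (permRep_mul_hpOp θ g m) _)
  have h := trace_mul_card_young hd hcomm fun _ _ => lead_mem _ _
  have hval : T (monomial (blockExp n d) 1) =
      ∑ J ∈ partialTransversals n, pathWeight θ n d m (J.image n.index) •
        isoProj τ (cycleMonomial n d K J) := by
    simp only [T]
    rw [Module.End.mul_apply, Module.End.mul_apply, ← isoProj_hpOp, ← isoProj_lead,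
      lead_hpOp_monomial, map_sum]
    exact sum_congr rfl fun J _ => map_smul _ _ _
  have hcoef : ∀ J ∈ partialTransversals n, coeff (blockExp n d)
      (pathWeight θ n d m (J.image n.index) • isoProj τ (cycleMonomial n d K J)) =
      (τ.dim / N.factorial * #(young n) : K) *
        (pathWeight θ n d m (J.image n.index) * avgChi n τ (J.image n.index)) := by
    intro J hJ
    rw [coeff_smul, smul_eq_mul, coeff_isoProj_cycleMonomial hd,
      sum_young_chi n τ (mem_partialTransversals.mp hJ), avgChi_eq]
    field_simp
  rw [hval, coeff_sum, sum_congr rfl hcoef, ← mul_sum,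
    sum_partialTransversals n fun A => pathWeight θ n d m A * avgChi n τ A] at h
  apply mul_left_cancel₀ hy
  rw [leadEnd, h, sum_congr rfl fun A _ => mul_comm (∏ a ∈ A, (n.blocksFun a : K)) _]
  field_simp

variable {n} in
-- Grouping by `#A = k`: sets that are empty or have more than `m + 1` elements have weight zero,
-- and no set has more than `n.length` elements.
theorem sum_pathWeight (θ : K) (m : ℕ) (f : Finset (Fin n.length) → K) :
    ∑ A, pathWeight θ n d m A * f A =
      ∑ k ∈ Icc 1 (min (m + 1) n.length), (-θ) ^ (k - 1) *
        ∑ A : Finset (Fin n.length) with #A = k, hSub θ n d A (m + 1 - k) * f A := by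
  have h : ∀ A : Finset (Fin n.length), #A ≤ n.length := fun A =>
    (card_le_univ A).trans_eq (Fintype.card_fin _)
  rw [← sum_subset (subset_univ
      (univ.filter fun A : Finset (Fin n.length) => #A ∈ Icc 1 (min (m + 1) n.length))),
    ← sum_fiberwise_of_maps_to (g := card) (t := Icc 1 (min (m + 1) n.length))
      fun A hA => (mem_filter.mp hA).2]
  · refine sum_congr rfl fun k hk => ?_
    rw [filter_filter, mul_sum]
    refine sum_congr ?_ fun A hA => ?_
    · ext A
      simp only [mem_filter, mem_univ, true_and, and_iff_right_iff_imp]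
      rintro rfl
      exact hk
    · obtain rfl := (mem_filter.mp hA).2
      rw [pathWeight, if_pos, mul_assoc]
      simp only [mem_Icc, le_min_iff] at hk ⊢
      exact ⟨hk.1, hk.2.1⟩
  · intro A _ hA
    rw [pathWeight, if_neg, zero_mul]
    intro h'
    refine hA (mem_filter.mpr ⟨mem_univ _, ?_⟩)
    simp only [mem_Icc, le_min_iff] at h' ⊢
    exact ⟨h'.1, h'.2, h A⟩

end Trace

end HeckmanPolychronakos

/-! ### The theorem -/

theorem theorem5p4 {K : Type*} [Field K] [IsAlgClosed K] [Algebra ℂ K] (θ : K)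
    (hθ : (∃ t : ℝ, 0 < t ∧ θ = algebraMap ℂ K (t : ℂ)) ∨ Transcendental ℂ θ)
    (N : ℕ) (hN : 1 ≤ N) :
    (∃ F eig, HeckmanPolychronakos.IsEigenSystem (N := N) θ F eig) ∧
    ∀ F eig, HeckmanPolychronakos.IsEigenSystem (N := N) θ F eig →
      ∀ (n : Composition N) (d : Fin n.length → ℕ) (hd : StrictAnti d)
        (τ : HeckmanPolychronakos.Irr K N) (m : ℕ), 1 ≤ m →
        ∑ i, eig m (HeckmanPolychronakos.blockPart n d hd) τ i =
          (τ.dim : K) * ∑ k ∈ Finset.Icc 1 (min (m + 1) n.length), (-θ) ^ (k - 1) *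
            ∑ A : Finset (Fin n.length) with A.card = k,
              HeckmanPolychronakos.hSub θ n d A (m + 1 - k) *
                HeckmanPolychronakos.avgChi n τ A * ∏ a ∈ A, (n.blocksFun a : K) := by
  have : CharZero K := charZero_of_injective_algebraMap (algebraMap ℂ K).injective
  refine ⟨HeckmanPolychronakos.exists_isEigenSystem fun m n =>
    HeckmanPolychronakos.exists_squarefree_aeval_hpOp hθ m n, fun F eig h n d hd τ m hm => ?_⟩
  rw [h.sum_eig hm, HeckmanPolychronakos.trace_leadEnd]
  simp only [mul_assoc]
  rw [HeckmanPolychronakos.sum_pathWeight θ m]
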